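/- Setting. Let $S^3\subset\mathbb C^2$ be the unit sphere with contact form $\lambda=\sum_k (x_k\,dy_k-y_k\,dx_k)|_{S^3}$, whose Reeb flow is $z\mapsto e^{it}z$, let $\mathfrak P:S^3\to S^2$ be the Hopf fibration, $\mathfrak P(\alpha,\beta)=(|\alpha|^2-|\beta|^2,-2\,\mathrm{Im}(\bar\alpha\beta),-2\,\mathrm{Re}(\bar\alpha\beta))$, and let $P:SU(2)\to SO(3)$ be the double cover with $\mathfrak P(Az)=P(A)\mathfrak P(z)$. Let $G\subset SU(2)$ be a finite nontrivial subgroup, i.e. $G=AG_0A^{-1}$ with $A\in SU(2)$ and $G_0$ one of the following, where in each case a smooth $P(G_0)$-invariant function $f_0:S^2\to\mathbb R$ and thresholds $L_N$ are given: 1. $G_0$ is cyclic, generated by $\mathrm{diag}(e^{2\pi i/n},e^{-2\pi i/n})$, $n\ge2$; $f_0(x)=x_1$; $L_N=2\pi N-\frac{\pi}{n}$. 2. $G_0$ is the binary dihedral group of order $4n$, $n\ge 2$, generated by $\mathrm{diag}(e^{\pi i/n},e^{-\pi i/n})$ and $\begin{pmatrix}0&-1\\1&0\end{pmatrix}$;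 $L_N=2\pi N-\frac{\pi}{2n}$. Put $X_0=\{(0,\cos\frac{(2k+1)\pi}{n},\sin\frac{(2k+1)\pi}{n})\}_k$, $X_1=\{(0,\cos\frac{2k\pi}{n},\sin\frac{2k\pi}{n})\}_k$, $X_2=\{(\pm1,0,0)\}$. 3. $G_0$ is the preimage under $P$ of the rotation group of a regular tetrahedron, octahedron or icosahedron inscribed in $S^2$; $L_N=2\pi N-\frac{\pi}{10}$. Let $X_0,X_1,X_2$ be its vertices, edge midpoints and face barycenters, radially projected to $S^2$. In cases 2 and 3, $f_0$ is any such function with $\mathrm{Crit}(f_0)=X_0\cup X_1\cup X_2$ which, near each point of $X_0$, $X_1$, $X_2$, takes the form $\frac{x^2+y^2}{2}-1$, $\frac{y^2-x^2}{2}$, $1-\frac{x^2+y^2}{2}$, respectively, in suitable stereographic coordinates (the inverse stereographic parametrization $(x,y)\mapsto\frac{(2x,2y,1-x^2-y^2)}{1+x^2+y^2}$ followed by a rotation). Put $f=f_0\circ P(A)^{-1}$ and $H=P(G)$. For $\varepsilon>0$ let $\lambda_{G,\varepsilon}$ be the descent of $(1+\varepsilon\,\mathfrak P^*f)\lambda$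 to $S^3/G$. A Reeb orbit $\gamma$ is a closed integral curve $\mathbb R/T\mathbb Z\to S^3/G$ of its Reeb vector field; its action is $\mathcal A(\gamma)=\int_\gamma\lambda_{G,\varepsilon}=T$, its multiplicity is the $m$ for which it is the $m$-fold iterate of an embedded orbit, and $\mu_{CZ}(\gamma)$ is its Conley–Zehnder index with respect to the global trivialization of the contact structure induced by the left-invariant frame $V_1(\alpha,\beta)=(-\bar\beta,\bar\alpha)$, $V_2=iV_1$ on $S^3$. $\mathcal P^L(\lambda_{G,\varepsilon})$ is the set of Reeb orbits of action less than $L$. Proposition. There are $\delta_N>0$ $(N\in\mathbb N)$ such that, for every sequence $(\varepsilon_N)$ with $0<\varepsilon_N\le\delta_N$ and $\lambda_N:=\lambda_{G,\varepsilon_N}$: every $\lambda_N$ is a contact form ($1+\varepsilon_Nf>0$ on $S^2$), all orbits in $\mathcal P^{L_N}(\lambda_N)$ are nondegenerate, and for all $N,M$ and all $\gamma_+\in\mathcal P^{L_N}(\lambda_N)$ and $\gamma_-\in\mathcal P^{L_M}(\lambda_M)$ that are freely homotopic in $S^3/G$: (a) If $\mu_{CZ}(\gamma_+)=\mu_{CZ}(\gamma_-)$,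 then $\gamma_+\sim\gamma_-$, that is, both orbits project to the same point of $S^2/H$ under the map $S^3/G\to S^2/H$ induced by $\mathfrak P$, this point being the image of a critical point of $f$, and they have the same multiplicity. (b) If $\mu_{CZ}(\gamma_+)<\mu_{CZ}(\gamma_-)$, then $\mathcal A(\gamma_+)<\mathcal A(\gamma_-)$. -/

import Mathlib

open scoped Matrix ComplexConjugate ContDiff Topology Pointwise

noncomputable section

namespace LinkOrbits

/-! ### The groups `SU(2)` and `SO(3)` -/

/-- The group `SU(2)`. -/
abbrev SU2 : Type := Matrix.specialUnitaryGroup (Fin 2) ℂ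

/-- The group `SO(3)`. -/
abbrev SO3 : Type := Matrix.specialOrthogonalGroup (Fin 3) ℝ

theorem SU2.adjugate_eq (A : SU2) : (A : Matrix (Fin 2) (Fin 2) ℂ).adjugate = (A : Matrix _ _ ℂ)ᴴ := by
  obtain ⟨hU, hdet⟩ := Matrix.mem_specialUnitaryGroup_iff.1 A.2
  have h1 : (A : Matrix (Fin 2) (Fin 2) ℂ)ᴴ * A = 1 := (Matrix.mem_unitaryGroup_iff').1 hU
  calc (A : Matrix (Fin 2) (Fin 2) ℂ).adjugate
      = ((A : Matrix (Fin 2) (Fin 2) ℂ)ᴴ * A) * (A : Matrix (Fin 2) (Fin 2) ℂ).adjugate := by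
        rw [h1, one_mul]
    _ = (A : Matrix (Fin 2) (Fin 2) ℂ)ᴴ := by
        rw [mul_assoc, Matrix.mul_adjugate, hdet, one_smul, mul_one]

theorem SU2.apply_one_one (A : SU2) : A.1 1 1 = conj (A.1 0 0) := by
  have h := congrFun (congrFun (SU2.adjugate_eq A) 0) 0
  simpa [Matrix.adjugate_fin_two, Matrix.conjTranspose_apply] using h

theorem SU2.apply_zero_one (A : SU2) : A.1 0 1 = -conj (A.1 1 0) := by
  have h := congrFun (congrFun (SU2.adjugate_eq A) 0) 1
  have h' : -A.1 0 1 = conj (A.1 1 0) := by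
    simpa [Matrix.adjugate_fin_two, Matrix.conjTranspose_apply] using h
  rw [← h', neg_neg]

theorem SU2.normSq_add (A : SU2) :
    Complex.normSq (A.1 0 0) + Complex.normSq (A.1 1 0) = 1 := by
  have hdet := (Matrix.mem_specialUnitaryGroup_iff.1 A.2).2
  rw [Matrix.det_fin_two, SU2.apply_one_one, SU2.apply_zero_one] at hdet
  have h := congrArg Complex.re hdet
  simp only [Complex.sub_re, Complex.mul_re, Complex.neg_re, Complex.neg_im, Complex.conj_re,
    Complex.conj_im, Complex.one_re] at h
  rw [Complex.normSq_apply, Complex.normSq_apply]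
  linarith

/-- The element of `SU(2)` with first column `(α, β)`. -/
def SU2.ofPair (α β : ℂ) (h : Complex.normSq α + Complex.normSq β = 1) : SU2 :=
  ⟨!![α, -conj β; β, conj α], by
    rw [Complex.normSq_apply, Complex.normSq_apply] at h
    rw [Matrix.mem_specialUnitaryGroup_iff, Matrix.mem_unitaryGroup_iff']
    constructor
    · ext i j
      fin_cases i <;> fin_cases j <;>
        simp [Matrix.mul_apply, Fin.sum_univ_two, Complex.ext_iff] <;>
        (try constructor) <;> linarith
    · rw [Matrix.det_fin_two]
      simp [Complex.ext_iff]
      constructor <;> linarith⟩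

/-- The diagonal matrix `diag(e^{iθ}, e^{-iθ})`. -/
def SU2.diag (θ : ℝ) : SU2 :=
  SU2.ofPair (Complex.exp (θ * Complex.I)) 0 (by
    rw [Complex.normSq_eq_norm_sq, Complex.norm_exp_ofReal_mul_I]; simp)

/-- The real `3 × 3` matrix attached to the first column `(α, β)` of an element of `SU(2)`. -/
def coverMatrix (α β : ℂ) : Matrix (Fin 3) (Fin 3) ℝ :=
  !![Complex.normSq α - Complex.normSq β, 2 * (α * β).im, 2 * (α * β).re;
     -2 * (conj α * β).im, (α ^ 2 + β ^ 2).re, -(α ^ 2 + β ^ 2).im;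
     -2 * (conj α * β).re, (α ^ 2 - β ^ 2).im, (α ^ 2 - β ^ 2).re]

theorem coverMatrix_mem (A : SU2) :
    coverMatrix (A.1 0 0) (A.1 1 0) ∈ Matrix.specialOrthogonalGroup (Fin 3) ℝ := by
  have h := SU2.normSq_add A
  generalize A.1 0 0 = α at h
  generalize A.1 1 0 = β at h
  obtain ⟨a, b⟩ := α
  obtain ⟨c, d⟩ := β
  simp only [Complex.normSq_mk] at h
  rw [Matrix.mem_specialOrthogonalGroup_iff, Matrix.mem_orthogonalGroup_iff]
  constructor
  · ext i j
    fin_cases i <;> fin_cases j <;>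
      simp [coverMatrix, Matrix.mul_apply, Fin.sum_univ_three, pow_two, Complex.normSq_mk] <;>
      first
        | ring1
        | linear_combination ((a * a + b * b) + (c * c + d * d) + 1) * h
  · simp [coverMatrix, Matrix.det_fin_three, pow_two, Complex.normSq_mk]
    linear_combination (((a * a + b * b) + (c * c + d * d)) ^ 2 +
      ((a * a + b * b) + (c * c + d * d)) + 1) * h

/-- The double cover `P : SU(2) → SO(3)`. -/
def cover : SU2 →* SO3 where
  toFun A := ⟨coverMatrix (A.1 0 0) (A.1 1 0), coverMatrix_mem A⟩
  map_one' := by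
    apply Subtype.ext
    ext i j
    fin_cases i <;> fin_cases j <;> simp [coverMatrix]
  map_mul' A B := by
    apply Subtype.ext
    have e1 : (A * B).1 0 0 = A.1 0 0 * B.1 0 0 - conj (A.1 1 0) * B.1 1 0 := by
      simp [Matrix.mul_apply, Fin.sum_univ_two, SU2.apply_zero_one]
      ring
    have e2 : (A * B).1 1 0 = A.1 1 0 * B.1 0 0 + conj (A.1 0 0) * B.1 1 0 := by
      simp [Matrix.mul_apply, Fin.sum_univ_two, SU2.apply_one_one]
    simp only [e1, e2, Submonoid.coe_mul]
    generalize A.1 0 0 = α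
    generalize A.1 1 0 = β
    generalize B.1 0 0 = α'
    generalize B.1 1 0 = β'
    obtain ⟨a, b⟩ := α
    obtain ⟨c, d⟩ := β
    obtain ⟨a', b'⟩ := α'
    obtain ⟨c', d'⟩ := β'
    ext i j
    fin_cases i <;> fin_cases j <;>
      simp [coverMatrix, Matrix.mul_apply, Fin.sum_univ_three, pow_two, Complex.normSq_apply] <;>
      ring

/-! ### The spheres, the Hopf fibration and the quotients -/

/-- The unit sphere `S³ ⊂ ℂ²`. -/
def S3 : Type := {z : ℂ × ℂ // Complex.normSq z.1 + Complex.normSq z.2 = 1}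

instance : TopologicalSpace S3 := inferInstanceAs (TopologicalSpace (Subtype _))

/-- The unit sphere `S² ⊂ ℝ³`. -/
def S2 : Type := {x : Fin 3 → ℝ // x ⬝ᵥ x = 1}

/-- The linear action of `SU(2)` on `S³ ⊂ ℂ²`. -/
instance : MulAction SU2 S3 where
  smul A z := ⟨(A.1 0 0 * z.1.1 + A.1 0 1 * z.1.2, A.1 1 0 * z.1.1 + A.1 1 1 * z.1.2), by
    have hz := z.2
    have hA := SU2.normSq_add A
    simp only [SU2.apply_zero_one, SU2.apply_one_one]
    simp only [Complex.normSq_apply, Complex.add_re, Complex.add_im, Complex.mul_re,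
      Complex.mul_im, Complex.neg_re, Complex.neg_im, Complex.conj_re, Complex.conj_im] at hz hA ⊢
    linear_combination hA * (z.1.1.re * z.1.1.re + z.1.1.im * z.1.1.im +
      (z.1.2.re * z.1.2.re + z.1.2.im * z.1.2.im)) + hz⟩
  one_smul z := by
    apply Subtype.ext
    change ((1 : Matrix (Fin 2) (Fin 2) ℂ) 0 0 * z.1.1 + (1 : Matrix (Fin 2) (Fin 2) ℂ) 0 1 * z.1.2,
      (1 : Matrix (Fin 2) (Fin 2) ℂ) 1 0 * z.1.1 + (1 : Matrix (Fin 2) (Fin 2) ℂ) 1 1 * z.1.2) = z.1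
    simp
  mul_smul A B z := by
    apply Subtype.ext
    change ((A.1 * B.1) 0 0 * z.1.1 + (A.1 * B.1) 0 1 * z.1.2,
      (A.1 * B.1) 1 0 * z.1.1 + (A.1 * B.1) 1 1 * z.1.2) =
      (A.1 0 0 * (B.1 0 0 * z.1.1 + B.1 0 1 * z.1.2) + A.1 0 1 * (B.1 1 0 * z.1.1 + B.1 1 1 * z.1.2),
       A.1 1 0 * (B.1 0 0 * z.1.1 + B.1 0 1 * z.1.2) + A.1 1 1 * (B.1 1 0 * z.1.1 + B.1 1 1 * z.1.2))
    simp only [Matrix.mul_apply, Fin.sum_univ_two, Prod.mk.injEq]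
    constructor <;> ring

/-- The linear action of `SO(3)` on `S² ⊂ ℝ³`. -/
instance : MulAction SO3 S2 where
  smul R x := ⟨R.1 *ᵥ x.1, by
    have hR := (Matrix.mem_orthogonalGroup_iff' _ _).1 (Matrix.mem_specialOrthogonalGroup_iff.1 R.2).1
    rw [Matrix.dotProduct_mulVec, ← Matrix.mulVec_transpose, Matrix.mulVec_mulVec, hR,
      Matrix.one_mulVec]
    exact x.2⟩
  one_smul x := Subtype.ext (Matrix.one_mulVec x.1)
  mul_smul R R' x := Subtype.ext (Matrix.mulVec_mulVec x.1 R.1 R'.1).symm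

/-- The map `ℂ² → ℝ³` that restricts to the Hopf fibration `S³ → S²`. -/
def hopfVec (z : ℂ × ℂ) : Fin 3 → ℝ :=
  ![Complex.normSq z.1 - Complex.normSq z.2, -2 * (conj z.1 * z.2).im, -2 * (conj z.1 * z.2).re]

/-- The Hopf fibration `S³ → S²`. -/
def hopf (z : S3) : S2 :=
  ⟨hopfVec z.1, by
    have hz := z.2
    simp only [Complex.normSq_apply] at hz
    simp [hopfVec, dotProduct, Fin.sum_univ_three, Complex.normSq_apply]
    linear_combination (z.1.1.re * z.1.1.re + z.1.1.im * z.1.1.im +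
      (z.1.2.re * z.1.2.re + z.1.2.im * z.1.2.im) + 1) * hz⟩

theorem hopf_smul (A : SU2) (z : S3) : hopf (A • z) = cover A • hopf z := by
  apply Subtype.ext
  change hopfVec (A.1 0 0 * z.1.1 + A.1 0 1 * z.1.2, A.1 1 0 * z.1.1 + A.1 1 1 * z.1.2) =
    coverMatrix (A.1 0 0) (A.1 1 0) *ᵥ hopfVec z.1
  rw [SU2.apply_zero_one, SU2.apply_one_one]
  generalize A.1 0 0 = α
  generalize A.1 1 0 = β
  obtain ⟨⟨⟨z1, z2⟩, ⟨w1, w2⟩⟩, hz⟩ := z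
  obtain ⟨a, b⟩ := α
  obtain ⟨c, d⟩ := β
  ext i
  fin_cases i <;>
    simp [hopfVec, coverMatrix, Matrix.mulVec, dotProduct, Fin.sum_univ_three, pow_two,
      Complex.normSq_apply] <;>
    ring

/-- The quotient `S³/G`, with the quotient topology. -/
abbrev LinkSpace (G : Subgroup SU2) : Type := Quotient (MulAction.orbitRel G S3)

/-- The quotient `S²/H`, where `H = P(G)`. -/
abbrev OrbitSphere (G : Subgroup SU2) : Type := Quotient (MulAction.orbitRel (G.map cover) S2)

/-- The projection `S³ → S³/G`. -/
def toLink (G : Subgroup SU2) (z : S3) : LinkSpace G := Quotient.mk _ z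

/-- The projection `S² → S²/H`. -/
def toOrbitSphere (G : Subgroup SU2) (x : S2) : OrbitSphere G := Quotient.mk _ x

/-- The Seifert projection `S³/G → S²/H` induced by the Hopf fibration. -/
def seifert (G : Subgroup SU2) : LinkSpace G → OrbitSphere G :=
  Quotient.map' hopf (by
    rintro z w ⟨g, hg⟩
    refine ⟨⟨cover g.1, Subgroup.mem_map_of_mem cover g.2⟩, ?_⟩
    change cover g.1 • hopf w = hopf z
    rw [← hopf_smul]
    exact congrArg hopf hg)

/-! ### The perturbed contact forms and their Reeb flows

Smooth functions on `S²` are given as restrictions of smooth functions on `ℝ³`. Contact forms on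
`S³` are given as restrictions of one-forms on `ℂ² = ℝ⁴`; as restriction commutes with the exterior
derivative, the Reeb conditions on `S³` are those of the ambient form and its exterior derivative,
tested on vectors tangent to `S³`. -/

/-- The round contact form `λ = x₁ dy₁ - y₁ dx₁ + x₂ dy₂ - y₂ dx₂` at `z ∈ ℂ²`, that is,
`λ_z(v) = Im (z̄₁ v₁ + z̄₂ v₂)`; its Reeb flow on `S³` is `z ↦ e^{it} z`. -/
def roundForm (z : ℂ × ℂ) : (ℂ × ℂ) →L[ℝ] ℝ :=
  Complex.imCLM ∘L
    ((ContinuousLinearMap.mul ℝ ℂ (conj z.1)) ∘L ContinuousLinearMap.fst ℝ ℂ ℂ +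
      (ContinuousLinearMap.mul ℝ ℂ (conj z.2)) ∘L ContinuousLinearMap.snd ℝ ℂ ℂ)

/-- The perturbed form `λ_ε = (1 + ε 𝔓^* f) λ`, where `𝔓` is the Hopf map. -/
def perturbedForm (f : (Fin 3 → ℝ) → ℝ) (ε : ℝ) (z : ℂ × ℂ) : (ℂ × ℂ) →L[ℝ] ℝ :=
  (1 + ε * f (hopfVec z)) • roundForm z

/-- The exterior derivative `dλ_ε`. -/
def dPerturbedForm (f : (Fin 3 → ℝ) → ℝ) (ε : ℝ) (z : ℂ × ℂ) : (ℂ × ℂ) [⋀^Fin 2]→L[ℝ] ℝ :=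
  extDeriv (fun w => ContinuousAlternatingMap.ofSubsingleton ℝ (ℂ × ℂ) ℝ (0 : Fin 1)
    (perturbedForm f ε w)) z

/-- The Euclidean inner product on `ℂ² = ℝ⁴`. -/
def realInner (v w : ℂ × ℂ) : ℝ := (conj v.1 * w.1 + conj v.2 * w.2).re

/-- `v` is the value at `z ∈ S³` of the Reeb vector field of `λ_ε`. -/
def IsReebVector (f : (Fin 3 → ℝ) → ℝ) (ε : ℝ) (z : S3) (v : ℂ × ℂ) : Prop :=
  realInner z.1 v = 0 ∧ perturbedForm f ε z.1 v = 1 ∧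
    ∀ w, realInner z.1 w = 0 → dPerturbedForm f ε z.1 ![v, w] = 0

/-- `c` is an integral curve in `S³` of the Reeb vector field of `λ_ε`. -/
def IsReebTrajectory (f : (Fin 3 → ℝ) → ℝ) (ε : ℝ) (c : ℝ → S3) : Prop :=
  ∀ t, ∃ v, IsReebVector f ε (c t) v ∧ HasDerivAt (fun s => (c s).1) v t

theorem IsReebTrajectory.continuous {f : (Fin 3 → ℝ) → ℝ} {ε : ℝ} {c : ℝ → S3}
    (hc : IsReebTrajectory f ε c) : Continuous c := by
  refine Continuous.subtype_mk (f := fun s => (c s).1) ?_ (fun s => (c s).2)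
  refine continuous_iff_continuousAt.2 fun t => ?_
  obtain ⟨v, -, hv⟩ := hc t
  exact hv.continuousAt

/-- `φ` is the flow on `S³` of the Reeb vector field of `λ_ε`. -/
def IsReebFlow (f : (Fin 3 → ℝ) → ℝ) (ε : ℝ) (φ : ℝ → S3 → S3) : Prop :=
  ∀ z, φ 0 z = z ∧ IsReebTrajectory f ε (fun t => φ t z)

open Classical in
/-- The flow on `S³` of the Reeb vector field of `λ_ε` (the identity if there is none). -/
def reebFlow (f : (Fin 3 → ℝ) → ℝ) (ε : ℝ) : ℝ → S3 → S3 :=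
  if h : ∃ φ, IsReebFlow f ε φ then h.choose else fun _ z => z

/-- The left-invariant frame `V₁(α, β) = (-β̄, ᾱ)`, `V₂ = i V₁` of the contact planes, which is
orthonormal and descends to `S³/G`. -/
def frame (i : Fin 2) (z : ℂ × ℂ) : ℂ × ℂ :=
  ![(-conj z.2, conj z.1), (-(Complex.I * conj z.2), Complex.I * conj z.1)] i

/-- The great circle through `z ∈ S³` with initial velocity `V_i(z)`. -/
def greatCircle (i : Fin 2) (z : S3) (s : ℝ) : S3 :=
  ⟨Real.cos s • z.1 + Real.sin s • frame i z.1, by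
    have hz := z.2
    have hs := Real.sin_sq_add_cos_sq s
    simp only [Complex.normSq_apply] at hz
    generalize Real.sin s = y at hs
    generalize Real.cos s = x at hs
    fin_cases i <;>
      simp [frame, Complex.normSq_apply] <;>
      linear_combination hz * (y ^ 2 + x ^ 2) + hs⟩

/-- The matrix `M_t` of the linearized Reeb flow `dφ^t : ξ_z → ξ_{φ^t(z)}` of `λ_ε` with respect to
the frame `(V₁, V₂)`: the entry `(i, j)` is the `V_i`-component of `dφ^t (V_j)`. -/
def linearizedFlow (f : (Fin 3 → ℝ) → ℝ) (ε : ℝ) (z : S3) (t : ℝ) : Matrix (Fin 2) (Fin 2) ℝ :=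
  Matrix.of fun i j =>
    realInner (frame i (reebFlow f ε t z).1)
      (deriv (fun s : ℝ => (reebFlow f ε t (greatCircle j z s)).1) 0)

/-! ### The Conley–Zehnder index of a path of `2 × 2` matrices -/

/-- The rotation set of a path `M : [0, T] → GL⁺(2, ℝ)`: the total rotations, in full turns, of the
paths `t ↦ M_t u`, for nonzero vectors `u`. -/
def rotationSet (M : ℝ → Matrix (Fin 2) (Fin 2) ℝ) (T : ℝ) : Set ℝ :=
  {Δ | ∃ u : Fin 2 → ℝ, u ≠ 0 ∧ ∃ θ : ℝ → ℝ, ContinuousOn θ (Set.Icc 0 T) ∧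
    (∀ t ∈ Set.Icc 0 T, ∃ r : ℝ, 0 < r ∧ M t *ᵥ u = r • ![Real.cos (θ t), Real.sin (θ t)]) ∧
    Δ = (θ T - θ 0) / (2 * Real.pi)}

open Classical in
/-- The Conley–Zehnder index of a path `M : [0, T] → GL⁺(2, ℝ)` that starts at the identity and whose
endpoint is symplectic and does not have the eigenvalue `1`. Its rotation set `I` is a compact
interval of length less than `1/2`; the index is `2k` if `I` contains the integer `k`, and `2k + 1`
if `I ⊂ (k, k + 1)`. -/
def conleyZehnder (M : ℝ → Matrix (Fin 2) (Fin 2) ℝ) (T : ℝ) : ℤ :=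
  if h : ∃ k : ℤ, (k : ℝ) ∈ rotationSet M T then 2 * h.choose
  else 2 * ⌊sInf (rotationSet M T)⌋ + 1

/-! ### Reeb orbits of the perturbed forms on `S³/G` -/

/-- A (parametrized) Reeb orbit of the descent `λ_{G,ε}` of `λ_ε` to `S³/G`, viewed as a
`T`-periodic map on `ℝ`. The projection `S³ → S³/G` is a smooth covering that pulls `λ_{G,ε}` back to
`λ_ε`, so the integral curves of the Reeb vector field downstairs are the projections of those
upstairs. -/
structure ReebOrbit (G : Subgroup SU2) (f : (Fin 3 → ℝ) → ℝ) (ε : ℝ) where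
  /-- the period `T` -/
  period : ℝ
  period_pos : 0 < period
  /-- the underlying map -/
  toFun : ℝ → LinkSpace G
  periodic : Function.Periodic toFun period
  exists_lift : ∃ c : ℝ → S3, IsReebTrajectory f ε c ∧ ∀ t, toFun t = toLink G (c t)

namespace ReebOrbit

variable {G : Subgroup SU2} {f : (Fin 3 → ℝ) → ℝ} {ε : ℝ}

/-- A lift of the orbit to a Reeb trajectory in `S³`. -/
def lift (γ : ReebOrbit G f ε) : ℝ → S3 := γ.exists_lift.choose

theorem lift_spec (γ : ReebOrbit G f ε) :
    IsReebTrajectory f ε γ.lift ∧ ∀ t, γ.toFun t = toLink G (γ.lift t) :=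
  γ.exists_lift.choose_spec

theorem continuous (γ : ReebOrbit G f ε) : Continuous γ.toFun := by
  have h : γ.toFun = fun t => toLink G (γ.lift t) := funext γ.lift_spec.2
  rw [h]
  exact continuous_quotient_mk'.comp γ.lift_spec.1.continuous

/-- The action `∫_γ λ_{G,ε}`, computed along a lift. -/
def action (γ : ReebOrbit G f ε) : ℝ :=
  ∫ t in (0 : ℝ)..γ.period,
    perturbedForm f ε (γ.lift t).1 (deriv (fun s => (γ.lift s).1) t)

theorem action_eq_period (γ : ReebOrbit G f ε) : γ.action = γ.period := by
  have h : ∀ t, perturbedForm f ε (γ.lift t).1 (deriv (fun s => (γ.lift s).1) t) = 1 := by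
    intro t
    obtain ⟨v, hv, hd⟩ := γ.lift_spec.1 t
    rw [hd.deriv]
    exact hv.2.1
  simp [action, h]

/-- The orbit as a loop `ℝ/ℤ → S³/G`, after rescaling time linearly. -/
def loop (γ : ReebOrbit G f ε) : C(AddCircle (1 : ℝ), LinkSpace G) where
  toFun := Function.Periodic.lift (f := fun s : ℝ => γ.toFun (γ.period * s)) (c := 1) (by
    intro s
    change γ.toFun (γ.period * (s + 1)) = γ.toFun (γ.period * s)
    rw [mul_add, mul_one]
    exact γ.periodic _)
  continuous_toFun :=
    continuous_coinduced_dom.2 (γ.continuous.comp (continuous_const.mul continuous_id))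

/-- The multiplicity of the orbit is `m`: it is the `m`-fold iterate of an embedded orbit. -/
def HasMultiplicity (γ : ReebOrbit G f ε) (m : ℕ) : Prop :=
  0 < m ∧ Function.Periodic γ.toFun (γ.period / m) ∧
    Set.InjOn γ.toFun (Set.Ico 0 (γ.period / m))

/-- The linearized return map does not have the eigenvalue `1`. -/
def Nondegenerate (γ : ReebOrbit G f ε) : Prop :=
  (linearizedFlow f ε (γ.lift 0) γ.period - 1).det ≠ 0

/-- The Conley–Zehnder index with respect to the global trivialization of the contact structure of
`S³/G` that is induced by `(V₁, V₂)`. -/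
def czIndex (γ : ReebOrbit G f ε) : ℤ :=
  conleyZehnder (linearizedFlow f ε (γ.lift 0)) γ.period

end ReebOrbit

/-- `p ∈ S²` is a critical point of the restriction of `f` to `S²`. -/
def IsCritical (f : (Fin 3 → ℝ) → ℝ) (p : S2) : Prop :=
  ∀ v : Fin 3 → ℝ, p.1 ⬝ᵥ v = 0 → fderiv ℝ f p.1 v = 0

/-- The relation `γ₊ ∼ γ₋`: both orbits project to the same orbifold critical point in `S²/H`, and
they have the same multiplicity. -/
def Equivalent {G : Subgroup SU2} {f : (Fin 3 → ℝ) → ℝ} {ε₁ ε₂ : ℝ}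
    (γ₁ : ReebOrbit G f ε₁) (γ₂ : ReebOrbit G f ε₂) : Prop :=
  (∃ p : S2, IsCritical f p ∧ (∀ t, seifert G (γ₁.toFun t) = toOrbitSphere G p) ∧
    ∀ t, seifert G (γ₂.toFun t) = toOrbitSphere G p) ∧
  ∃ m : ℕ, γ₁.HasMultiplicity m ∧ γ₂.HasMultiplicity m

/-! ### The finite subgroups of `SU(2)` and the Morse functions -/

/-- The three regular polyhedra with triangular faces. -/
inductive Polyhedron
  | tetrahedron
  | octahedron
  | icosahedron

/-- The radial projection `ℝ³ ∖ {0} → S²`, with values in `ℝ³`. -/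
def radial (x : Fin 3 → ℝ) : Fin 3 → ℝ := (√(x ⬝ᵥ x))⁻¹ • x

namespace Polyhedron

/-- The vertices, inscribed in `S²`. -/
def vertices : Polyhedron → Set (Fin 3 → ℝ)
  | tetrahedron => radial '' {![1, 1, 1], ![1, -1, -1], ![-1, 1, -1], ![-1, -1, 1]}
  | octahedron => {![1, 0, 0], ![-1, 0, 0], ![0, 1, 0], ![0, -1, 0], ![0, 0, 1], ![0, 0, -1]}
  | icosahedron => radial ''
      {x | ∃ s ∈ ({1, -1} : Set ℝ), ∃ t ∈ ({1, -1} : Set ℝ),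
        x = ![0, s, t * Real.goldenRatio] ∨ x = ![s, t * Real.goldenRatio, 0] ∨
          x = ![t * Real.goldenRatio, 0, s]}

/-- Two vertices are joined by an edge: they are distinct and at minimal distance, that is, with
maximal inner product. -/
def Adjacent (Q : Polyhedron) (u v : Fin 3 → ℝ) : Prop :=
  u ∈ Q.vertices ∧ v ∈ Q.vertices ∧ u ≠ v ∧
    ∀ x ∈ Q.vertices, ∀ y ∈ Q.vertices, x ≠ y → x ⬝ᵥ y ≤ u ⬝ᵥ v

/-- The midpoints of the edges, projected to `S²`. -/
def edges (Q : Polyhedron) : Set (Fin 3 → ℝ) :=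
  {x | ∃ u v, Q.Adjacent u v ∧ x = radial (u + v)}

/-- The barycenters of the faces, projected to `S²`. -/
def faces (Q : Polyhedron) : Set (Fin 3 → ℝ) :=
  {x | ∃ u v w, Q.Adjacent u v ∧ Q.Adjacent v w ∧ Q.Adjacent u w ∧ x = radial (u + v + w)}

/-- The group of rotations that preserve the polyhedron. -/
def rotations (Q : Polyhedron) : Subgroup SO3 :=
  MulAction.stabilizer SO3 {x : S2 | x.1 ∈ Q.vertices}

end Polyhedron

/-- The conjugacy types of finite nontrivial subgroups of `SU(2)`. -/
inductive GroupType
  /-- cyclic of order `n ≥ 2` -/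
  | cyclic (n : ℕ) (hn : 2 ≤ n)
  /-- binary dihedral of order `4n`, where `n ≥ 2` -/
  | dihedral (n : ℕ) (hn : 2 ≤ n)
  /-- binary tetrahedral, octahedral or icosahedral -/
  | polyhedral (Q : Polyhedron)

namespace GroupType

/-- The standard subgroup of the given type: the cyclic group generated by
`diag(e^{2πi/n}, e^{-2πi/n})`, the binary dihedral group generated by `diag(e^{πi/n}, e^{-πi/n})` and
the matrix with rows `(0, -1)` and `(1, 0)`, or the preimage under `SU(2) → SO(3)` of the rotation
group of the polyhedron. -/
def standardGroup : GroupType → Subgroup SU2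
  | cyclic n _ => Subgroup.zpowers (SU2.diag (2 * Real.pi / n))
  | dihedral n _ => Subgroup.closure {SU2.diag (Real.pi / n), SU2.ofPair 0 1 (by simp)}
  | polyhedral Q => Q.rotations.comap cover

/-- The action thresholds `L_N`. -/
def threshold : GroupType → ℕ → ℝ
  | cyclic n _, N => 2 * Real.pi * N - Real.pi / n
  | dihedral n _, N => 2 * Real.pi * N - Real.pi / (2 * n)
  | polyhedral _, N => 2 * Real.pi * N - Real.pi / 10

end GroupType

/-- The inverse of stereographic projection, `ℝ² → S²`, which takes the origin to `(0, 0, 1)`. -/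
def stereo (q : ℝ × ℝ) : Fin 3 → ℝ :=
  (1 + q.1 ^ 2 + q.2 ^ 2)⁻¹ • ![2 * q.1, 2 * q.2, 1 - q.1 ^ 2 - q.2 ^ 2]

/-- In suitable stereographic coordinates at `p`, the function `f` takes the form `g` near the
origin. -/
def HasNormalForm (f : (Fin 3 → ℝ) → ℝ) (p : Fin 3 → ℝ) (g : ℝ × ℝ → ℝ) : Prop :=
  ∃ R : SO3, R.1 *ᵥ ![0, 0, 1] = p ∧ ∀ᶠ q in 𝓝 ((0, 0) : ℝ × ℝ), f (R.1 *ᵥ stereo q) = g q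

/-- The critical points of `f` on `S²` are the points of `X₀ ∪ X₁ ∪ X₂`; in suitable stereographic
coordinates at the points of `X₀`, `X₁`, `X₂`, the function `f` is `(x² + y²)/2 - 1`, `(y² - x²)/2`
and `1 - (x² + y²)/2`, respectively. -/
def IsAdapted (f : (Fin 3 → ℝ) → ℝ) (X₀ X₁ X₂ : Set (Fin 3 → ℝ)) : Prop :=
  (∀ p : S2, IsCritical f p ↔ p.1 ∈ X₀ ∪ X₁ ∪ X₂) ∧
  (∀ p ∈ X₀, HasNormalForm f p fun q => (q.1 ^ 2 + q.2 ^ 2) / 2 - 1) ∧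
  (∀ p ∈ X₁, HasNormalForm f p fun q => (q.2 ^ 2 - q.1 ^ 2) / 2) ∧
  (∀ p ∈ X₂, HasNormalForm f p fun q => 1 - (q.1 ^ 2 + q.2 ^ 2) / 2)

/-- The Morse functions used for the standard group of the given type: smooth, invariant under its
image in `SO(3)`, and equal to the height function along the axis of rotation in the cyclic case,
adapted to the three orbits of points with nontrivial isotropy otherwise. -/
def GroupType.IsMorseFunction (τ : GroupType) (f : (Fin 3 → ℝ) → ℝ) : Prop :=
  ContDiff ℝ ∞ f ∧
  (∀ A ∈ τ.standardGroup, ∀ x : S2, f (cover A • x).1 = f x.1) ∧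
  match τ with
  | .cyclic _ _ => ∀ x : S2, f x.1 = x.1 0
  | .dihedral n _ => IsAdapted f
      {p | ∃ k : ℤ, p = ![0, Real.cos ((Real.pi + 2 * k * Real.pi) / n),
        Real.sin ((Real.pi + 2 * k * Real.pi) / n)]}
      {p | ∃ k : ℤ, p = ![0, Real.cos (2 * k * Real.pi / n), Real.sin (2 * k * Real.pi / n)]}
      {![1, 0, 0], ![-1, 0, 0]}
  | .polyhedral Q => IsAdapted f Q.vertices Q.edges Q.faces

end LinkOrbits

end

noncomputable section

namespace LinkOrbits

/-! ### Ordinary differential equations: existence, dependence on initial values, short periods -/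

section ODE

variable {E : Type*} [NormedAddCommGroup E] [NormedSpace ℝ E]

/-! Write `F` for the pullback of `f` under the Hopf map and `h = 1 + ε F`. On `S³` the Reeb vector
field of `h λ` is explicit (`isReebVector_iff`): it is `h⁻¹ · iz` plus `ε / (2h²)` times the
horizontal gradient of `F` turned by a right angle. Hence `h` is constant along trajectories, and
the Hopf image of a trajectory follows an autonomous field on `S²`, slowed by a constant factor of
order `ε`.

An orbit in `S³/G` of period below `L` lifts to a trajectory that closes up after `|G|` periods. For
small `ε` the slow curve on `S²` cannot have so short a period unless it is constant
(`deriv_eq_zero_of_periodic`). So the orbit runs in the fibre over a critical point of `f`, of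
critical value `s ∈ {-1, 0, 1}`. It is recorded by a point `z` of that fibre, a deck transformation
`g ∈ G` and an angle `θ > 0` with `g • z = e^{iθ} z`, and its period is `(1 + εs) θ`
(`exists_isFibreOrbit`).

In the left-invariant frame the linearized flow along such a fibre is the rotation by `2t / h` times
the exponential of a constant generator of order `ε`, read off from the Hessian of `F`
(`linearizedFlow_critical`). At an extremum this exponential is a slow rotation, at a saddle a
symmetric hyperbolic matrix. As `|G| θ ∈ 2πℤ`, the number `θ / π` is an integer or at least `1 /
|G|` away from the integers. So for small `ε` the orbit is nondegenerate, and its index is `2k + s`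
if `θ = kπ` and `2⌊θ/π⌋ + 1` otherwise (`critical_index`).

A free homotopy conjugates the deck transformations (`exists_conj_of_homotopic`). Their traces `2
cos θ` and `2 cos θ'` therefore agree, and the rest is arithmetic (`index_comparison`). Equal
indices force `θ = θ'`, and also `s = s'` when `sin θ = 0`. If `sin θ ≠ 0`, then `e^{iθ}` is a
simple eigenvalue of `g`, whose eigenline gives the point of `S²`; if `sin θ = 0`, one uses that `G`
is transitive on critical points of equal value. The multiplicity is `θ` divided by the least
positive angle by which `G` rotates the fibre, so it agrees too. If the first index is smaller, then
either `θ < θ'`, and the gap of at least `2π / |G|` outweighs the differences between periods and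
angles, or `θ = θ'` and `s < s'`, and then `1 + εs < 1 + ε's'` whatever the two positive parameters
are.

What remains concerns the groups: finiteness, Hessians of the prescribed shape, and transitivity on
the critical points of each value (`Admissible`). The Hessians come from the local normal forms; the
rest is checked for each standard group and transported by conjugation. -/

open scoped Manifold in
theorem exists_integralCurve [CompleteSpace E] {X : E → E} (hX : ContDiff ℝ 1 X)
    (hc : HasCompactSupport X) (x : E) :
    ∃ c : ℝ → E, c 0 = x ∧ ∀ t, HasDerivAt c (X (c t)) t := by
  obtain ⟨K, hK⟩ := ContDiff.lipschitzWith_of_hasCompactSupport hc hX one_ne_zero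
  obtain ⟨L, hL⟩ := hc.exists_bound_of_continuous hX.continuous
  have hL0 : 0 ≤ L := (norm_nonneg _).trans (hL x)
  -- A field bounded by `L` moves by at most `L / (L + 1) ≤ 1` in this time, so Picard–Lindelöf in
  -- unit balls gives the same existence time at every point. A uniform time makes the curve global.
  have hpos : (0 : ℝ) < 1 / (L + 1) := by positivity
  obtain ⟨γ, h0, hγ⟩ := exists_isMIntegralCurve_of_isMIntegralCurveOn (I := 𝓘(ℝ, E)) (M := E)
    (v := X) (contMDiff_vectorSpace_iff_contDiff.2 hX) hpos (fun y => by
      have hPL : IsPicardLindelof (fun _ => X) (tmin := -(1 / (L + 1))) (tmax := 1 / (L + 1))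
          ⟨0, by constructor <;> linarith⟩ y 1 0 ⟨L, hL0⟩ K := by
        refine ⟨fun t _ => hK.lipschitzOnWith, fun z _ => continuousOn_const, fun t _ z _ => hL z, ?_⟩
        simp only [sub_zero, zero_sub, neg_neg, max_self]
        change L * (1 / (L + 1)) ≤ (1 : ℝ) - (0 : ℝ)
        rw [mul_one_div, div_le_iff₀ (by positivity)]
        linarith
      obtain ⟨α, hα0, hα⟩ := hPL.exists_eq_forall_mem_Icc_hasDerivWithinAt₀
      refine ⟨α, hα0, fun t ht => ?_⟩
      have h1 := (hα t ⟨ht.1.le, ht.2.le⟩).hasDerivAt (Icc_mem_nhds ht.1 ht.2)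
      have h2 : HasFDerivAt α (ContinuousLinearMap.smulRight (1 : ℝ →L[ℝ] ℝ) (X (α t))) t :=
        hasDerivAt_iff_hasFDerivAt.1 h1
      exact (hasMFDerivAt_iff_hasFDerivAt.2 h2).hasMFDerivWithinAt) x
  refine ⟨γ, h0, fun t => ?_⟩
  have h2 : HasFDerivAt γ (ContinuousLinearMap.smulRight (1 : ℝ →L[ℝ] ℝ) (X (γ t))) t :=
    hasMFDerivAt_iff_hasFDerivAt.1 (hγ t)
  exact hasDerivAt_iff_hasFDerivAt.2 h2

/-- Taylor's formula with quadratic remainder for a compactly supported `C²` map. -/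
theorem exists_taylor_bound {X : E → E} (hX : ContDiff ℝ 2 X) (hc : HasCompactSupport X) :
    ∃ C : ℝ, 0 ≤ C ∧ ∀ a b, ‖X (a + b) - X a - fderiv ℝ X a b‖ ≤ C * ‖b‖ ^ 2 := by
  obtain ⟨C, hC⟩ := ContDiff.lipschitzWith_of_hasCompactSupport (hc.fderiv ℝ)
    (hX.fderiv_right (m := 1) le_rfl) one_ne_zero
  refine ⟨C, C.2, fun a b => ?_⟩
  have hd : ∀ x, HasFDerivAt X (fderiv ℝ X x) x := fun x =>
    (hX.differentiable two_ne_zero x).hasFDerivAt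
  -- On the segment from `a` to `a + b` the derivative stays within `C * ‖b‖` of its value at `a`,
  -- since it is Lipschitz; the mean value inequality supplies the second factor `‖b‖`.
  have h := Convex.norm_image_sub_le_of_norm_hasFDerivWithin_le' (f := X) (f' := fderiv ℝ X)
    (φ := fderiv ℝ X a) (s := segment ℝ a (a + b)) (x := a) (y := a + b) (C := C * ‖b‖)
    (fun x _ => (hd x).hasFDerivWithinAt) (fun x hx => ?_) (convex_segment _ _)
    (left_mem_segment _ _ _) (right_mem_segment _ _ _)
  · rw [add_sub_cancel_left] at h
    calc _ ≤ C * ‖b‖ * ‖b‖ := h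
      _ = _ := by ring
  · rw [← dist_eq_norm]
    refine (hC.dist_le_mul _ _).trans ?_
    gcongr
    obtain ⟨s, hs, rfl⟩ := (segment_eq_image' ℝ a (a + b)).subset hx
    simp only [add_sub_cancel_left, dist_self_add_left, norm_smul, Real.norm_eq_abs, abs_of_nonneg hs.1]
    exact mul_le_of_le_one_left (norm_nonneg _) hs.2

/-- Differentiability of a family of integral curves with respect to the initial value. -/
theorem hasDerivAt_integralCurve_initial {X : E → E} (hX : ContDiff ℝ 2 X)
    (hc : HasCompactSupport X) {c : ℝ → ℝ → E} (hcd : ∀ s t, HasDerivAt (c s) (X (c s t)) t)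
    {w : ℝ → E} (hw : ∀ t, HasDerivAt w (fderiv ℝ X (c 0 t) (w t)) t)
    (h0 : ∃ C₀ : ℝ, ∀ s : ℝ, |s| ≤ 1 → ‖c s 0 - c 0 0 - s • w 0‖ ≤ C₀ * s ^ 2) {T : ℝ}
    (hT : 0 ≤ T) : HasDerivAt (fun s => c s T) (w T) 0 := by
  obtain ⟨K, hK⟩ := ContDiff.lipschitzWith_of_hasCompactSupport hc hX two_ne_zero
  obtain ⟨C, hC0, hC⟩ := exists_taylor_bound hX hc
  obtain ⟨C₀, hC₀⟩ := h0
  have hwc : Continuous w := continuous_iff_continuousAt.2 fun t => (hw t).continuousAt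
  obtain ⟨B, hB⟩ := isCompact_Icc.exists_bound_of_continuousOn (s := Set.Icc 0 T) hwc.continuousOn
  have hB0 : 0 ≤ B := (norm_nonneg _).trans (hB 0 ⟨le_rfl, hT⟩)
  have key : ∀ s : ℝ, |s| ≤ 1 → ‖c s T - c 0 T - s • w T‖ ≤
      gronwallBound C₀ K (C * B ^ 2) T * s ^ 2 := by
    intro s hs
    -- The first-order approximation solves the equation up to an error `C * B ^ 2 * s ^ 2` by
    -- Taylor's formula, so Grönwall bounds its distance from the true curve by a multiple of `s ^
    -- 2`.
    have hder : ∀ t, HasDerivAt (fun t => c 0 t + s • w t)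
        (X (c 0 t) + s • fderiv ℝ X (c 0 t) (w t)) t := fun t =>
      (hcd 0 t).add ((hw t).const_smul s)
    have := dist_le_of_approx_trajectories_ODE (v := fun _ => X) (K := K) (f := c s)
      (f' := fun t => X (c s t)) (g := fun t => c 0 t + s • w t)
      (g' := fun t => X (c 0 t) + s • fderiv ℝ X (c 0 t) (w t)) (a := 0) (b := T) (εf := 0)
      (εg := C * B ^ 2 * s ^ 2) (δ := C₀ * s ^ 2) (fun _ => hK)
      (continuous_iff_continuousAt.2 fun t => (hcd s t).continuousAt).continuousOn
      (fun t _ => (hcd s t).hasDerivWithinAt) (fun t _ => by simp)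
      (continuous_iff_continuousAt.2 fun t => (hder t).continuousAt).continuousOn
      (fun t _ => (hder t).hasDerivWithinAt) (fun t ht => ?_) ?_ T ⟨hT, le_rfl⟩
    · rw [dist_eq_norm, ← sub_sub] at this
      refine this.trans (le_of_eq ?_)
      rw [zero_add, sub_zero]
      -- `gronwallBound` is linear in its initial error and defect, so `s ^ 2` factors out; its
      -- definition differs for `K = 0`.
      by_cases hK0 : (K : ℝ) = 0
      · rw [hK0, gronwallBound_K0, gronwallBound_K0]; ring
      · rw [gronwallBound_of_K_ne_0 hK0, gronwallBound_of_K_ne_0 hK0]; ring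
    · rw [dist_comm, dist_eq_norm, ← sub_sub, ← map_smul]
      refine (hC _ _).trans ?_
      rw [mul_assoc]
      gcongr
      rw [norm_smul, mul_pow, mul_comm, Real.norm_eq_abs, sq_abs]
      gcongr
      exact hB t ⟨ht.1, ht.2.le⟩
    · rw [dist_eq_norm, ← sub_sub]
      exact hC₀ s hs
  rw [hasDerivAt_iff_isLittleO]
  refine Asymptotics.IsBigO.trans_isLittleO (g := fun s : ℝ => s ^ 2) ?_ ?_
  · refine Asymptotics.IsBigO.of_bound (gronwallBound C₀ K (C * B ^ 2) T) ?_
    filter_upwards [Metric.closedBall_mem_nhds (0 : ℝ) one_pos] with s hs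
    rw [sub_zero, Real.norm_eq_abs (s ^ 2), abs_of_nonneg (sq_nonneg s)]
    exact key s (by simpa using hs)
  · simp only [sub_zero]
    exact Asymptotics.isLittleO_pow_id (by norm_num)

/-- A curve of small speed in `ℝⁿ` that is periodic and solves an autonomous Lipschitz equation is
constant if its period is short. -/
theorem deriv_eq_zero_of_periodic {ι : Type*} [Fintype ι] {W : (ι → ℝ) → (ι → ℝ)}
    {S : Set (ι → ℝ)} {K : NNReal} (hW : LipschitzOnWith K W S) {x : ℝ → ι → ℝ} {κ T : ℝ}
    (hx : ∀ t, HasDerivAt x (κ • W (x t)) t) (hS : ∀ t, x t ∈ S) (hT : 0 < T)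
    (hper : Function.Periodic x T) (hsmall : |κ| * K * T < 1) (t : ℝ) : κ • W (x t) = 0 := by
  have hxc : Continuous x := continuous_iff_continuousAt.2 fun t => (hx t).continuousAt
  have hWc : Continuous fun t => W (x t) :=
    hW.continuousOn.comp_continuous hxc hS
  set v : ℝ → ι → ℝ := fun t => κ • W (x t) with hv
  have hvc : Continuous v := hWc.const_smul κ
  have hvper : Function.Periodic v T := fun t => by simp only [hv, hper t]
  obtain ⟨t₀, -, ht₀⟩ := (isCompact_Icc (a := (0 : ℝ)) (b := T)).exists_isMaxOn
    (Set.nonempty_Icc.2 hT.le) hvc.norm.continuousOn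
  have hmax : ∀ t, ‖v t‖ ≤ ‖v t₀‖ := by
    intro t
    obtain ⟨s, hs, hs'⟩ := hvper.exists_mem_Ico₀ hT t
    rw [hs']
    exact ht₀ ⟨hs.1, hs.2.le⟩
  have hlip : ∀ a b, ‖x a - x b‖ ≤ ‖v t₀‖ * |a - b| := by
    intro a b
    have := Convex.norm_image_sub_le_of_norm_hasDerivWithin_le (f := x) (f' := v)
      (s := Set.univ) (C := ‖v t₀‖) (fun s _ => (hx s).hasDerivWithinAt) (fun s _ => hmax s)
      convex_univ (Set.mem_univ b) (Set.mem_univ a)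
    simpa [Real.norm_eq_abs] using this
  have hcomp : ∀ i, ‖v t₀ i‖ ≤ |κ| * K * T * ‖v t₀‖ := by
    intro i
    -- By Rolle each velocity component vanishes somewhere within one period. The Lipschitz bound
    -- then makes the maximal speed at most `|κ| * K * T < 1` times itself. The sup norm lets the
    -- components be treated one at a time.
    obtain ⟨s, hs, hs0⟩ := exists_hasDerivAt_eq_zero (f := fun t => x t i) (f' := fun t => v t i)
      (a := t₀) (b := t₀ + T) (by linarith)
      ((continuous_apply i).comp hxc).continuousOn (by simp only [hper t₀])
      (fun s _ => hasDerivAt_pi.1 (hx s) i)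
    have h1 : ‖v t₀ i‖ ≤ ‖v t₀ - v s‖ := by
      have := norm_le_pi_norm (v t₀ - v s) i
      rwa [Pi.sub_apply, hs0, sub_zero] at this
    refine h1.trans ?_
    have h2 : ‖W (x t₀) - W (x s)‖ ≤ K * ‖x t₀ - x s‖ := by
      simpa [dist_eq_norm] using hW.dist_le_mul _ (hS t₀) _ (hS s)
    have h3 : |t₀ - s| ≤ T := by
      rw [abs_le]; constructor <;> linarith [hs.1, hs.2]
    calc ‖v t₀ - v s‖ = |κ| * ‖W (x t₀) - W (x s)‖ := by
          rw [hv]; simp only [← smul_sub, norm_smul, Real.norm_eq_abs]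
      _ ≤ |κ| * (K * (‖v t₀‖ * T)) := by
          gcongr
          exact h2.trans (by gcongr; exact (hlip _ _).trans (by gcongr))
      _ = _ := by ring
  have hB : ‖v t₀‖ ≤ |κ| * K * T * ‖v t₀‖ :=
    (pi_norm_le_iff_of_nonneg (by positivity)).2 hcomp
  have hz : ‖v t₀‖ = 0 := by nlinarith [norm_nonneg (v t₀)]
  have := hmax t
  rw [hz] at this
  exact norm_le_zero_iff.1 this

end ODE

section ReebField

/-! ### Calculus of the Hopf map -/

/-- The squared Euclidean norm on `ℂ²`. -/
def normSq₂ (z : ℂ × ℂ) : ℝ := Complex.normSq z.1 + Complex.normSq z.2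

/-- The derivative of `hopfVec` at `z` in the direction `v`. -/
def hopfDeriv (z v : ℂ × ℂ) : Fin 3 → ℝ :=
  ![2 * (conj z.1 * v.1).re - 2 * (conj z.2 * v.2).re,
    -2 * (conj v.1 * z.2 + conj z.1 * v.2).im, -2 * (conj v.1 * z.2 + conj z.1 * v.2).re]

theorem contDiff_hopfVec : ContDiff ℝ ∞ hopfVec := by
  have h1 : ContDiff ℝ ∞ (fun z : ℂ × ℂ => z.1.re) :=
    Complex.reCLM.contDiff.comp contDiff_fst
  have h2 : ContDiff ℝ ∞ (fun z : ℂ × ℂ => z.1.im) :=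
    Complex.imCLM.contDiff.comp contDiff_fst
  have h3 : ContDiff ℝ ∞ (fun z : ℂ × ℂ => z.2.re) :=
    Complex.reCLM.contDiff.comp contDiff_snd
  have h4 : ContDiff ℝ ∞ (fun z : ℂ × ℂ => z.2.im) :=
    Complex.imCLM.contDiff.comp contDiff_snd
  rw [contDiff_pi]
  intro i
  fin_cases i <;> simp [hopfVec, Complex.normSq_apply] <;> fun_prop

theorem contDiff_normSq₂ : ContDiff ℝ ∞ normSq₂ := by
  have h1 : ContDiff ℝ ∞ (fun z : ℂ × ℂ => z.1.re) :=
    Complex.reCLM.contDiff.comp contDiff_fst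
  have h2 : ContDiff ℝ ∞ (fun z : ℂ × ℂ => z.1.im) :=
    Complex.imCLM.contDiff.comp contDiff_fst
  have h3 : ContDiff ℝ ∞ (fun z : ℂ × ℂ => z.2.re) :=
    Complex.reCLM.contDiff.comp contDiff_snd
  have h4 : ContDiff ℝ ∞ (fun z : ℂ × ℂ => z.2.im) :=
    Complex.imCLM.contDiff.comp contDiff_snd
  unfold normSq₂
  simp only [Complex.normSq_apply]
  fun_prop

theorem contDiff_frame (i : Fin 2) : ContDiff ℝ ∞ (frame i) := by
  have hc : ContDiff ℝ ∞ (fun z : ℂ => conj z) := Complex.conjCLE.contDiff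
  have h1 : ContDiff ℝ ∞ (fun z : ℂ × ℂ => conj z.1) := hc.comp contDiff_fst
  have h2 : ContDiff ℝ ∞ (fun z : ℂ × ℂ => conj z.2) := hc.comp contDiff_snd
  fin_cases i
  · exact h2.neg.prodMk h1
  · exact (contDiff_const.mul h2).neg.prodMk (contDiff_const.mul h1)

/-- The Hopf map is quadratic, so its restriction to a line is an exact polynomial whose linear
coefficient is the derivative. -/
theorem hopfVec_add_smul (z v : ℂ × ℂ) (t : ℝ) :
    hopfVec (z + t • v) = hopfVec z + t • hopfDeriv z v + t ^ 2 • hopfVec v := by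
  ext i
  fin_cases i <;> simp [hopfVec, hopfDeriv, Complex.normSq_apply] <;> ring

theorem normSq₂_add_smul (z v : ℂ × ℂ) (t : ℝ) :
    normSq₂ (z + t • v) = normSq₂ z + t * (2 * realInner z v) + t ^ 2 * normSq₂ v := by
  simp [normSq₂, realInner, Complex.normSq_apply]
  ring

theorem hasDerivAt_line {V : Type*} [NormedAddCommGroup V] [NormedSpace ℝ V] (z v : V) (t : ℝ) :
    HasDerivAt (fun s : ℝ => z + s • v) v t := by
  simpa using ((hasDerivAt_id t).smul_const v).const_add z

theorem hasDerivAt_comp_line {V W : Type*} [NormedAddCommGroup V] [NormedSpace ℝ V]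
    [NormedAddCommGroup W] [NormedSpace ℝ W] {g : V → W} {z : V} (hg : DifferentiableAt ℝ g z)
    (v : V) : HasDerivAt (fun s : ℝ => g (z + s • v)) (fderiv ℝ g z v) 0 :=
  hg.hasFDerivAt.comp_hasDerivAt_of_eq (0 : ℝ) (hasDerivAt_line z v 0) (by simp)

theorem hasDerivAt_quadratic {V : Type*} [NormedAddCommGroup V] [NormedSpace ℝ V] (a b c : V) :
    HasDerivAt (fun s : ℝ => a + s • b + s ^ 2 • c) b 0 := by
  have h := (((hasDerivAt_id (0 : ℝ)).smul_const b).const_add a).add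
    (((hasDerivAt_id (0 : ℝ)).pow 2).smul_const c)
  simp only [id_eq, one_smul, Nat.cast_ofNat, Nat.add_one_sub_one, pow_one, mul_zero, mul_one,
    zero_smul, add_zero] at h
  exact h

theorem fderiv_hopfVec (z v : ℂ × ℂ) : fderiv ℝ hopfVec z v = hopfDeriv z v := by
  have h1 := hasDerivAt_comp_line (contDiff_hopfVec.differentiable (by simp) z) v
  simp only [hopfVec_add_smul] at h1
  exact h1.unique (hasDerivAt_quadratic _ _ _)

theorem fderiv_normSq₂ (z v : ℂ × ℂ) : fderiv ℝ normSq₂ z v = 2 * realInner z v := by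
  have h1 := hasDerivAt_comp_line (contDiff_normSq₂.differentiable (by simp) z) v
  simp only [normSq₂_add_smul] at h1
  exact h1.unique (hasDerivAt_quadratic _ _ _)

/-- The vector `iz` is tangent to the Hopf fibre. -/
theorem hopfDeriv_I_smul (z : ℂ × ℂ) : hopfDeriv z (Complex.I • z) = 0 := by
  ext i
  fin_cases i <;> simp [hopfDeriv] <;> ring

theorem hopfVec_smul {c : ℂ} (hc : Complex.normSq c = 1) (z : ℂ × ℂ) :
    hopfVec (c • z) = hopfVec z := by
  rw [Complex.normSq_apply] at hc
  ext i
  fin_cases i <;> simp [hopfVec, Complex.normSq_apply]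
  · linear_combination (z.1.re * z.1.re + z.1.im * z.1.im - z.2.re * z.2.re - z.2.im * z.2.im) * hc
  · linear_combination (z.1.re * z.2.im - z.1.im * z.2.re) * hc
  · linear_combination (z.1.re * z.2.re + z.1.im * z.2.im) * hc

theorem frame_one (z : ℂ × ℂ) : frame 1 z = Complex.I • frame 0 z := by
  simp [frame]

/-- The frame is conjugate linear: along `e^{iτ} z` it turns by `-τ`, whereas the round flow carries
vectors along by `+τ`. The difference `2τ` is the main term of every Conley–Zehnder index below. -/
theorem frame_smul (i : Fin 2) (c : ℂ) (z : ℂ × ℂ) : frame i (c • z) = conj c • frame i z := by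
  fin_cases i
  · simp [frame]
  · simp [frame]
    constructor <;> ring

theorem realInner_frame (i : Fin 2) (z : ℂ × ℂ) : realInner z (frame i z) = 0 := by
  fin_cases i <;> simp [frame, realInner] <;> ring

theorem realInner_I_smul (z : ℂ × ℂ) : realInner z (Complex.I • z) = 0 := by
  simp [realInner]; ring

theorem roundForm_apply (z v : ℂ × ℂ) :
    roundForm z v = (conj z.1 * v.1 + conj z.2 * v.2).im := by
  simp [roundForm]

/-- The vectors `z`, `iz`, `V₁`, `V₂` form an orthonormal basis of `ℝ⁴`, and `roundForm z` is the
inner product with `iz`. -/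
theorem eq_frame_combination {z : ℂ × ℂ} (hz : normSq₂ z = 1) (v : ℂ × ℂ) :
    v = realInner z v • z + roundForm z v • (Complex.I • z) + realInner (frame 0 z) v • frame 0 z +
      realInner (frame 1 z) v • frame 1 z := by
  rw [roundForm_apply]
  simp only [normSq₂, Complex.normSq_apply] at hz
  refine Prod.ext (Complex.ext ?_ ?_) (Complex.ext ?_ ?_) <;>
    simp [realInner, frame]
  · linear_combination -v.1.re * hz
  · linear_combination -v.1.im * hz
  · linear_combination -v.2.re * hz
  · linear_combination -v.2.im * hz

/-! ### The Reeb vector field -/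

/-- The pullback of `f` under the Hopf map. -/
def pull (f : (Fin 3 → ℝ) → ℝ) (z : ℂ × ℂ) : ℝ := f (hopfVec z)

/-- The derivative of the pullback of `f` in the direction of the frame vector `V_i`. -/
def frameDeriv (f : (Fin 3 → ℝ) → ℝ) (i : Fin 2) (z : ℂ × ℂ) : ℝ :=
  fderiv ℝ (pull f) z (frame i z)

/-- The conformal factor `1 + ε 𝔓^* f`. -/
def factor (f : (Fin 3 → ℝ) → ℝ) (ε : ℝ) (z : ℂ × ℂ) : ℝ := 1 + ε * pull f z

/-- A smooth vector field on `ℂ²` that restricts to the Reeb vector field on `S³`. -/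
def reebField (f : (Fin 3 → ℝ) → ℝ) (ε : ℝ) (z : ℂ × ℂ) : ℂ × ℂ :=
  (factor f ε z ^ 2 + (1 - normSq₂ z) ^ 2)⁻¹ • (factor f ε z • (Complex.I • z) +
    (ε / 2) • (frameDeriv f 1 z • frame 0 z - frameDeriv f 0 z • frame 1 z))

variable {f : (Fin 3 → ℝ) → ℝ} {ε : ℝ}

theorem contDiff_pull (hf : ContDiff ℝ ∞ f) : ContDiff ℝ ∞ (pull f) := hf.comp contDiff_hopfVec

theorem contDiff_factor (hf : ContDiff ℝ ∞ f) : ContDiff ℝ ∞ (factor f ε) :=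
  contDiff_const.add (contDiff_const.mul (contDiff_pull hf))

theorem contDiff_frameDeriv (hf : ContDiff ℝ ∞ f) (i : Fin 2) : ContDiff ℝ ∞ (frameDeriv f i) :=
  ((contDiff_pull hf).fderiv_right (m := ∞) (by simp)).clm_apply (contDiff_frame i)

theorem fderiv_pull (hf : ContDiff ℝ ∞ f) (z v : ℂ × ℂ) :
    fderiv ℝ (pull f) z v = fderiv ℝ f (hopfVec z) (hopfDeriv z v) := by
  have h := fderiv_comp z (g := f) (f := hopfVec) (hf.differentiable (by simp) _)
    (contDiff_hopfVec.differentiable (by simp) _)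
  have h' : pull f = f ∘ hopfVec := rfl
  rw [h', h, ContinuousLinearMap.comp_apply, fderiv_hopfVec]

theorem fderiv_pull_I_smul (hf : ContDiff ℝ ∞ f) (z : ℂ × ℂ) :
    fderiv ℝ (pull f) z (Complex.I • z) = 0 := by
  rw [fderiv_pull hf, hopfDeriv_I_smul, map_zero]

/-- The summand `(1 - normSq₂ z) ^ 2` of the denominator vanishes on the sphere and is positive off
it, so positivity of the factor on `S³` makes the field smooth on all of `ℂ²`. -/
theorem contDiff_reebField (hf : ContDiff ℝ ∞ f) (hpos : ∀ z : S3, 0 < factor f ε z.1) :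
    ContDiff ℝ ∞ (reebField f ε) := by
  have h0 := contDiff_factor (ε := ε) hf
  have h1 := contDiff_frameDeriv hf 0
  have h2 := contDiff_frameDeriv hf 1
  have h3 := contDiff_frame 0
  have h4 := contDiff_frame 1
  have h5 := contDiff_normSq₂
  have h7 : ContDiff ℝ ∞ (fun z => factor f ε z ^ 2 + (1 - normSq₂ z) ^ 2) := by fun_prop
  refine ContDiff.smul (h7.inv fun z hz => ?_) ?_
  · have ha : factor f ε z = 0 := by nlinarith [sq_nonneg (factor f ε z), sq_nonneg (1 - normSq₂ z)]
    have hb : 1 - normSq₂ z = 0 := by nlinarith [sq_nonneg (factor f ε z), sq_nonneg (1 - normSq₂ z)]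
    have := hpos ⟨z, by unfold normSq₂ at hb; linarith⟩
    exact this.ne' ha
  · have h6 : ContDiff ℝ ∞ (fun z : ℂ × ℂ => Complex.I • z) := contDiff_const_smul _
    fun_prop

theorem realInner_smul_right (a : ℝ) (z v : ℂ × ℂ) : realInner z (a • v) = a * realInner z v := by
  simp [realInner]; ring

theorem realInner_add_right (z v w : ℂ × ℂ) :
    realInner z (v + w) = realInner z v + realInner z w := by
  simp [realInner]; ring

theorem realInner_sub_right (z v w : ℂ × ℂ) :
    realInner z (v - w) = realInner z v - realInner z w := by
  simp [realInner]; ring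

theorem realInner_reebField (z : ℂ × ℂ) : realInner z (reebField f ε z) = 0 := by
  simp [reebField, realInner_smul_right, realInner_add_right, realInner_sub_right,
    realInner_frame, realInner_I_smul]

theorem realInner_frame_frame {z : ℂ × ℂ} (hz : normSq₂ z = 1) (i j : Fin 2) :
    realInner (frame i z) (frame j z) = if i = j then 1 else 0 := by
  simp only [normSq₂, Complex.normSq_apply] at hz
  fin_cases i <;> fin_cases j <;> simp [frame, realInner] <;> linarith

theorem roundForm_frame (i : Fin 2) (z : ℂ × ℂ) : roundForm z (frame i z) = 0 := by
  rw [roundForm_apply]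
  fin_cases i <;> simp [frame] <;> ring

theorem roundForm_I_smul {z : ℂ × ℂ} (hz : normSq₂ z = 1) : roundForm z (Complex.I • z) = 1 := by
  rw [roundForm_apply]
  simp only [normSq₂, Complex.normSq_apply] at hz
  simp; linarith

theorem reebField_sphere {z : ℂ × ℂ} (hz : normSq₂ z = 1) : reebField f ε z =
    (factor f ε z ^ 2)⁻¹ • (factor f ε z • (Complex.I • z) +
    (ε / 2) • (frameDeriv f 1 z • frame 0 z - frameDeriv f 0 z • frame 1 z)) := by
  simp [reebField, hz]

/-- The horizontal part of the field is a gradient turned by a right angle, so the pullback of `f`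
is a first integral. -/
theorem fderiv_pull_reebField (hf : ContDiff ℝ ∞ f) (z : ℂ × ℂ) :
    fderiv ℝ (pull f) z (reebField f ε z) = 0 := by
  simp only [reebField, map_smul, map_add, map_sub, fderiv_pull_I_smul hf]
  simp only [frameDeriv, smul_eq_mul]
  ring

/-- This is `d(hλ) = dh ∧ λ + h dλ`, with `dλ(v, w) = 2 Im (v̄₁ w₁ + v̄₂ w₂)`. -/
theorem dPerturbedForm_apply (hf : ContDiff ℝ ∞ f) (z v w : ℂ × ℂ) :
    dPerturbedForm f ε z ![v, w] = ε * fderiv ℝ (pull f) z v * roundForm z w -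
      ε * fderiv ℝ (pull f) z w * roundForm z v +
      factor f ε z * (2 * (conj v.1 * w.1 + conj v.2 * w.2).im) := by
  have hround : ∀ u : ℂ × ℂ, ContDiff ℝ ∞ (fun z => roundForm z u) := by
    intro u
    simp only [roundForm_apply, Complex.add_im, Complex.mul_im, Complex.conj_re, Complex.conj_im]
    have h1 : ContDiff ℝ ∞ (fun z : ℂ × ℂ => z.1.re) :=
      Complex.reCLM.contDiff.comp contDiff_fst
    have h2 : ContDiff ℝ ∞ (fun z : ℂ × ℂ => z.1.im) :=
      Complex.imCLM.contDiff.comp contDiff_fst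
    have h3 : ContDiff ℝ ∞ (fun z : ℂ × ℂ => z.2.re) :=
      Complex.reCLM.contDiff.comp contDiff_snd
    have h4 : ContDiff ℝ ∞ (fun z : ℂ × ℂ => z.2.im) :=
      Complex.imCLM.contDiff.comp contDiff_snd
    fun_prop
  have hform : ContDiff ℝ ∞ (perturbedForm f ε) := by
    refine ContDiff.smul (contDiff_factor hf) ?_
    exact contDiff_clm_apply_iff.2 hround
  have hdiff : DifferentiableAt ℝ (fun w => ContinuousAlternatingMap.ofSubsingleton ℝ (ℂ × ℂ) ℝ
      (0 : Fin 1) (perturbedForm f ε w)) z :=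
    (ContinuousAlternatingMap.ofSubsingletonLIE (𝕜 := ℝ) (E := ℂ × ℂ) (F := ℝ)
      (0 : Fin 1)).differentiable.differentiableAt.comp z (hform.differentiable (by simp) z)
  have hscalar : ∀ a b : ℂ × ℂ, fderiv ℝ (fun y => perturbedForm f ε y a) z b =
      ε * fderiv ℝ (pull f) z b * roundForm z a +
        factor f ε z * (conj b.1 * a.1 + conj b.2 * a.2).im := by
    intro a b
    have h1 := hasDerivAt_comp_line
      (((contDiff_clm_apply_iff.1 hform) a).differentiable (by simp) z) b
    have h2 := hasDerivAt_comp_line ((contDiff_pull hf).differentiable (by simp) z) b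
    have h3 : HasDerivAt (fun s : ℝ => roundForm (z + s • b) a)
        ((conj b.1 * a.1 + conj b.2 * a.2).im) 0 := by
      have h : ∀ s : ℝ, roundForm (z + s • b) a = roundForm z a +
          s * (conj b.1 * a.1 + conj b.2 * a.2).im := by
        intro s; simp only [roundForm_apply]; simp; ring
      simp only [h]
      simpa using ((hasDerivAt_id (0 : ℝ)).mul_const ((conj b.1 * a.1 + conj b.2 * a.2).im)).const_add
        (roundForm z a)
    have h4 := ((h2.const_mul ε).const_add 1).mul h3
    simp only [zero_smul, add_zero] at h4
    exact h1.unique h4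
  rw [dPerturbedForm, extDeriv_apply hdiff]
  refine (Fin.sum_univ_two _).trans ?_
  have e0 : (fun y => (ContinuousAlternatingMap.ofSubsingleton ℝ (ℂ × ℂ) ℝ (0 : Fin 1)
      (perturbedForm f ε y)) ((0 : Fin 2).removeNth ![v, w])) = fun y => perturbedForm f ε y w := rfl
  have e1 : (fun y => (ContinuousAlternatingMap.ofSubsingleton ℝ (ℂ × ℂ) ℝ (0 : Fin 1)
      (perturbedForm f ε y)) ((1 : Fin 2).removeNth ![v, w])) = fun y => perturbedForm f ε y v := rfl
  rw [e0, e1]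
  simp only [Matrix.cons_val_zero, Matrix.cons_val_one, hscalar]
  simp
  ring

/-- The Reeb conditions fix the four coordinates in the basis `z`, `iz`, `V₁`, `V₂`: tangency and
normalization fix the first two, and pairing `dλ_ε` with `V₁` and `V₂` fixes the `V₂`- and
`V₁`-components. -/
theorem isReebVector_iff (hf : ContDiff ℝ ∞ f) (z : S3) (hpos : 0 < factor f ε z.1) (v : ℂ × ℂ) :
    IsReebVector f ε z v ↔ v = reebField f ε z.1 := by
  have hz : normSq₂ z.1 = 1 := z.2
  have hflip : ∀ i, ∀ u : ℂ × ℂ, (conj u.1 * (frame i z.1).1 + conj u.2 * (frame i z.1).2).im =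
      ![-realInner (frame 1 z.1) u, realInner (frame 0 z.1) u] i := by
    intro i u
    fin_cases i <;> simp [frame, realInner] <;> ring
  have hpert : ∀ u, perturbedForm f ε z.1 u = factor f ε z.1 * roundForm z.1 u := fun u => rfl
  set h := factor f ε z.1 with hh
  have hne : h ≠ 0 := hpos.ne'
  have hX0 : realInner (frame 0 z.1) (reebField f ε z.1) =
      (h ^ 2)⁻¹ * ((ε / 2) * frameDeriv f 1 z.1) := by
    have := realInner_frame_frame hz
    have h2 : realInner (frame 0 z.1) (Complex.I • z.1) = 0 := by
      simp [realInner, frame]; ring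
    rw [reebField_sphere hz]
    simp [realInner_smul_right, realInner_add_right, realInner_sub_right, this, h2, ← hh]
  have hX1 : realInner (frame 1 z.1) (reebField f ε z.1) =
      -((h ^ 2)⁻¹ * ((ε / 2) * frameDeriv f 0 z.1)) := by
    have := realInner_frame_frame hz
    have h2 : realInner (frame 1 z.1) (Complex.I • z.1) = 0 := by
      simp [realInner, frame]; ring
    rw [reebField_sphere hz]
    simp [realInner_smul_right, realInner_add_right, realInner_sub_right, this, h2, ← hh]
  have hXr : roundForm z.1 (reebField f ε z.1) = h⁻¹ := by
    rw [reebField_sphere hz]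
    simp only [map_smul, map_add, map_sub, roundForm_frame, roundForm_I_smul hz, ← hh, smul_eq_mul]
    field_simp
    simp
  constructor
  · rintro ⟨h1, h2, h3⟩
    rw [hpert] at h2
    have hr : roundForm z.1 v = h⁻¹ := by field_simp; linarith
    have k0 := h3 (frame 0 z.1) (realInner_frame _ _)
    have k1 := h3 (frame 1 z.1) (realInner_frame _ _)
    rw [dPerturbedForm_apply hf, hflip, roundForm_frame, hr, ← hh] at k0 k1
    simp at k0 k1
    change -(ε * frameDeriv f 0 z.1 * h⁻¹) + -(h * (2 * realInner (frame 1 z.1) v)) = 0 at k0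
    change -(ε * frameDeriv f 1 z.1 * h⁻¹) + h * (2 * realInner (frame 0 z.1) v) = 0 at k1
    rw [eq_frame_combination hz v, eq_frame_combination hz (reebField f ε z.1), h1, hr, hX0, hX1,
      hXr, realInner_reebField]
    congr 2
    · congr 1
      field_simp at k1 ⊢
      linarith
    · field_simp at k0 ⊢
      linarith
  · rintro rfl
    refine ⟨realInner_reebField _, ?_, fun w hw => ?_⟩
    · rw [hpert, hXr]; field_simp
    -- On tangent vectors `dλ / 2` is the area form of the plane spanned by `V₁`, `V₂`, because `iz`
    -- pairs to zero with every tangent vector.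
    · have key : ∀ u w : ℂ × ℂ, realInner z.1 u = 0 → realInner z.1 w = 0 →
          (conj u.1 * w.1 + conj u.2 * w.2).im =
          realInner (frame 0 z.1) u * realInner (frame 1 z.1) w -
          realInner (frame 1 z.1) u * realInner (frame 0 z.1) w := by
        intro u w hu hw
        have e : w = roundForm z.1 w • (Complex.I • z.1) +
            realInner (frame 0 z.1) w • frame 0 z.1 + realInner (frame 1 z.1) w • frame 1 z.1 := by
          conv_lhs => rw [eq_frame_combination hz w, hw]
          simp
        have e3 : (conj u.1 * (Complex.I • z.1).1 + conj u.2 * (Complex.I • z.1).2).im = 0 := by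
          rw [← hu]; simp [realInner]; ring
        have f0 := hflip 0 u
        have f1 := hflip 1 u
        simp only [Matrix.cons_val_zero, Matrix.cons_val_one] at f0 f1
        have e4 : (conj u.1 * w.1 + conj u.2 * w.2).im =
            roundForm z.1 w * (conj u.1 * (Complex.I • z.1).1 + conj u.2 * (Complex.I • z.1).2).im +
            realInner (frame 0 z.1) w * (conj u.1 * (frame 0 z.1).1 + conj u.2 * (frame 0 z.1).2).im +
            realInner (frame 1 z.1) w * (conj u.1 * (frame 1 z.1).1 + conj u.2 * (frame 1 z.1).2).im := by
          generalize roundForm z.1 w = a at e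
          generalize realInner (frame 0 z.1) w = b at e
          generalize realInner (frame 1 z.1) w = c at e
          generalize Complex.I • z.1 = p at e
          generalize frame 0 z.1 = q at e
          generalize frame 1 z.1 = r at e
          subst e
          simp; ring
        rw [e4, e3, f0, f1]; ring
      have hdF : fderiv ℝ (pull f) z.1 w = realInner (frame 0 z.1) w * frameDeriv f 0 z.1 +
          realInner (frame 1 z.1) w * frameDeriv f 1 z.1 := by
        conv_lhs => rw [eq_frame_combination hz w, hw]
        simp only [map_add, map_smul, fderiv_pull_I_smul hf, frameDeriv, smul_eq_mul]
        ring
      rw [dPerturbedForm_apply hf, fderiv_pull_reebField hf, hXr, key _ _ (realInner_reebField _) hw,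
        hX0, hX1, hdF, ← hh]
      field_simp
      ring

end ReebField

/-! ### The Reeb flow and its projection to the two-sphere -/

section ReebFlow

variable {f : (Fin 3 → ℝ) → ℝ} {ε : ℝ}

/-- Compact support supplies the global Lipschitz constants and global integral curves of the first
part; the ball of radius `2` contains `S³`, so nothing changes there. -/
theorem exists_cutoff {E : Type*} [NormedAddCommGroup E] [NormedSpace ℝ E] [FiniteDimensional ℝ E]
    {X : E → E} (hX : ContDiff ℝ ∞ X) :
    ∃ χ : E → ℝ, ContDiff ℝ ∞ (fun z => χ z • X z) ∧ HasCompactSupport (fun z => χ z • X z) ∧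
      ∀ z ∈ Metric.ball (0 : E) 2, χ z = 1 := by
  let b : ContDiffBump (0 : E) := ⟨2, 3, by norm_num, by norm_num⟩
  exact ⟨b, b.contDiff.smul hX, b.hasCompactSupport.smul_right,
    fun z hz => b.one_of_mem_closedBall (Metric.ball_subset_closedBall hz)⟩

theorem S3.norm_le (z : S3) : ‖z.1‖ ≤ 1 := by
  have h := z.2
  rw [Complex.normSq_eq_norm_sq, Complex.normSq_eq_norm_sq] at h
  refine max_le ?_ ?_
  · nlinarith [norm_nonneg z.1.1, sq_nonneg ‖z.1.2‖]
  · nlinarith [norm_nonneg z.1.2, sq_nonneg ‖z.1.1‖]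

theorem S3.mem_ball (z : S3) : z.1 ∈ Metric.ball (0 : ℂ × ℂ) 2 := by
  rw [mem_ball_zero_iff]
  exact z.norm_le.trans_lt (by norm_num)

theorem isReebTrajectory_iff (hf : ContDiff ℝ ∞ f) (hpos : ∀ z : S3, 0 < factor f ε z.1)
    {c : ℝ → S3} : IsReebTrajectory f ε c ↔
      ∀ t, HasDerivAt (fun s => (c s).1) (reebField f ε (c t).1) t := by
  refine forall_congr' fun t => ?_
  simp only [isReebVector_iff hf _ (hpos _)]
  simp

theorem IsReebTrajectory.ext (hf : ContDiff ℝ ∞ f) (hpos : ∀ z : S3, 0 < factor f ε z.1)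
    {c c' : ℝ → S3} (hc : IsReebTrajectory f ε c) (hc' : IsReebTrajectory f ε c') {t₀ : ℝ}
    (h : c t₀ = c' t₀) : c = c' := by
  rw [isReebTrajectory_iff hf hpos] at hc hc'
  obtain ⟨χ, hχ, hcpt, hone⟩ := exists_cutoff (contDiff_reebField hf hpos)
  obtain ⟨K, hK⟩ := ContDiff.lipschitzWith_of_hasCompactSupport hcpt hχ (by simp)
  have key : ∀ {c : ℝ → S3}, (∀ t, HasDerivAt (fun s => (c s).1) (reebField f ε (c t).1) t) →
      ∀ t, HasDerivAt (fun s => (c s).1) (χ (c t).1 • reebField f ε (c t).1) t ∧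
        (c t).1 ∈ Set.univ := fun {c} hc t => by
    rw [hone _ (c t).mem_ball, one_smul]
    exact ⟨hc t, trivial⟩
  have := ODE_solution_unique_univ (v := fun _ z => χ z • reebField f ε z) (s := fun _ => Set.univ)
    (t₀ := t₀) (fun _ => hK.lipschitzOnWith) (key hc) (key hc') (congrArg Subtype.val h)
  exact funext fun t => Subtype.ext (congrFun this t)

theorem exists_isReebTrajectory (hf : ContDiff ℝ ∞ f) (hpos : ∀ z : S3, 0 < factor f ε z.1)
    (z : S3) : ∃ c : ℝ → S3, c 0 = z ∧ IsReebTrajectory f ε c := by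
  obtain ⟨χ, hχ, hcpt, hone⟩ := exists_cutoff (contDiff_reebField hf hpos)
  obtain ⟨c, h0, hc⟩ := exists_integralCurve (hχ.of_le (by simp)) hcpt z.1
  -- The extended field, and so its cutoff, is orthogonal to the position vector everywhere, so
  -- curves that start on the sphere stay on it.
  have hsq : ∀ t, normSq₂ (c t) = 1 := by
    have hd : ∀ t, HasDerivAt (fun t => normSq₂ (c t)) 0 t := by
      intro t
      have := ((contDiff_normSq₂.differentiable (by simp)) (c t)).hasFDerivAt.comp_hasDerivAt t (hc t)
      rw [fderiv_normSq₂, realInner_smul_right, realInner_reebField, mul_zero, mul_zero] at this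
      exact this
    intro t
    have := is_const_of_deriv_eq_zero (fun t => (hd t).differentiableAt) (fun t => (hd t).deriv) t 0
    rw [this, h0]
    exact z.2
  have hmem : ∀ t, Complex.normSq (c t).1 + Complex.normSq (c t).2 = 1 := hsq
  let c' : ℝ → S3 := fun t => ⟨c t, hmem t⟩
  refine ⟨c', Subtype.ext h0, (isReebTrajectory_iff hf hpos).2 fun t => ?_⟩
  have h := hc t
  rwa [hone _ (S3.mem_ball ⟨c t, hmem t⟩), one_smul] at h

theorem isReebFlow_reebFlow (hf : ContDiff ℝ ∞ f) (hpos : ∀ z : S3, 0 < factor f ε z.1) :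
    IsReebFlow f ε (reebFlow f ε) := by
  have h : ∃ φ, IsReebFlow f ε φ := by
    choose c h0 hc using exists_isReebTrajectory hf hpos
    exact ⟨fun t z => c z t, fun z => ⟨h0 z, hc z⟩⟩
  rw [reebFlow, dif_pos h]
  exact h.choose_spec

/-! ### Fibres over critical points -/

/-- The round Reeb flow `z ↦ e^{iτ} z`. -/
def S3.rot (τ : ℝ) (z : S3) : S3 :=
  ⟨Complex.exp (τ * Complex.I) • z.1, by
    have h : Complex.normSq (Complex.exp (τ * Complex.I)) = 1 := by
      rw [Complex.normSq_eq_norm_sq, Complex.norm_exp_ofReal_mul_I, one_pow]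
    have hz := z.2
    simp only [Prod.smul_fst, Prod.smul_snd, smul_eq_mul, Complex.normSq_mul, h, one_mul]
    exact hz⟩

theorem normSq_exp (τ : ℝ) : Complex.normSq (Complex.exp (τ * Complex.I)) = 1 := by
  rw [Complex.normSq_eq_norm_sq, Complex.norm_exp_ofReal_mul_I, one_pow]

theorem S3.rot_zero (z : S3) : z.rot 0 = z := Subtype.ext (by simp [S3.rot])

theorem S3.rot_rot (a b : ℝ) (z : S3) : (z.rot b).rot a = z.rot (a + b) :=
  Subtype.ext (by simp [S3.rot, smul_smul, ← Complex.exp_add, add_mul])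

theorem hopf_rot (τ : ℝ) (z : S3) : hopf (z.rot τ) = hopf z :=
  Subtype.ext (hopfVec_smul (normSq_exp τ) z.1)

theorem hopfVec_dotProduct_hopfDeriv {z : ℂ × ℂ} (v : ℂ × ℂ) :
    hopfVec z ⬝ᵥ hopfDeriv z v = 2 * normSq₂ z * realInner z v := by
  simp [hopfVec, hopfDeriv, dotProduct, Fin.sum_univ_three, normSq₂, realInner,
    Complex.normSq_apply]
  ring

theorem frameDeriv_eq_zero (hf : ContDiff ℝ ∞ f) {z : S3} (hz : IsCritical f (hopf z)) (i : Fin 2) :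
    frameDeriv f i z.1 = 0 := by
  rw [frameDeriv, fderiv_pull hf]
  refine hz _ ?_
  change hopfVec z.1 ⬝ᵥ _ = 0
  rw [hopfVec_dotProduct_hopfDeriv, realInner_frame, mul_zero]

theorem factor_smul {c : ℂ} (hc : Complex.normSq c = 1) (z : ℂ × ℂ) :
    factor f ε (c • z) = factor f ε z := by
  simp [factor, pull, hopfVec_smul hc]

theorem fderiv_pull_smul (hf : ContDiff ℝ ∞ f) {c : ℂ} (hc : Complex.normSq c = 1) (z v : ℂ × ℂ) :
    fderiv ℝ (pull f) (c • z) v = fderiv ℝ (pull f) z (conj c • v) := by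
  have h1 := hasDerivAt_comp_line ((contDiff_pull hf).differentiable (by simp) (c • z)) v
  have h2 := hasDerivAt_comp_line ((contDiff_pull hf).differentiable (by simp) z) (conj c • v)
  refine h1.unique (h2.congr_of_eventuallyEq (Filter.Eventually.of_forall fun s => ?_))
  have : c • z + s • v = c • (z + s • (conj c • v)) := by
    rw [smul_add, smul_comm c s, smul_smul c, Complex.mul_conj, hc]
    simp
  simp only [pull, this, hopfVec_smul hc]

/-- The pullback of `f` is invariant under the round flow. The pair of frame derivatives turns by
the square of `c̄` and the frame by `c̄`; together these turn the horizontal part by `c² c̄ = c`. -/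
theorem reebField_smul (hf : ContDiff ℝ ∞ f) {c : ℂ} (hc : Complex.normSq c = 1) (z : ℂ × ℂ) :
    reebField f ε (c • z) = c • reebField f ε z := by
  have hn : normSq₂ (c • z) = normSq₂ z := by
    simp [normSq₂, hc]
  have hb : conj c * conj c = ((c.re ^ 2 - c.im ^ 2 : ℝ) : ℂ) - (2 * c.re * c.im : ℝ) * Complex.I := by
    apply Complex.ext <;> simp [pow_two] <;> ring
  have h0 : frameDeriv f 0 (c • z) = (c.re ^ 2 - c.im ^ 2) * frameDeriv f 0 z -
      (2 * c.re * c.im) * frameDeriv f 1 z := by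
    rw [frameDeriv, fderiv_pull_smul hf hc, frame_smul, smul_smul, hb, sub_smul, mul_smul,
      ← frame_one, map_sub, Complex.coe_smul, Complex.coe_smul, map_smul, map_smul]
    rfl
  have h1 : frameDeriv f 1 (c • z) = (c.re ^ 2 - c.im ^ 2) * frameDeriv f 1 z +
      (2 * c.re * c.im) * frameDeriv f 0 z := by
    have hI : Complex.I • frame 1 z = -frame 0 z := by
      rw [frame_one, smul_smul, Complex.I_mul_I, neg_one_smul]
    rw [frameDeriv, fderiv_pull_smul hf hc, frame_smul, smul_smul, hb, sub_smul, mul_smul,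
      hI, map_sub, Complex.coe_smul, Complex.coe_smul, map_smul, map_smul, map_neg]
    simp only [frameDeriv, smul_eq_mul]
    ring
  rw [reebField, reebField, factor_smul hc, hn, h0, h1, frame_smul, frame_smul, frame_one]
  rw [Complex.normSq_apply] at hc
  generalize frameDeriv f 0 z = a
  generalize frameDeriv f 1 z = b
  generalize frame 0 z = V
  rw [smul_comm c (_ : ℝ), smul_add c, smul_comm c (factor f ε z), smul_comm c (ε / 2),
    smul_comm c Complex.I]
  congr 3
  have hab : ∀ W : ℂ, ((c.re ^ 2 - c.im ^ 2) * b + 2 * c.re * c.im * a : ℝ) * (conj c * W) -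
      ((c.re ^ 2 - c.im ^ 2) * a - 2 * c.re * c.im * b : ℝ) * (conj c * (Complex.I * W)) =
      c * (b * W - a * (Complex.I * W)) := by
    intro W
    have e1 : (((c.re ^ 2 - c.im ^ 2) * b + 2 * c.re * c.im * a : ℝ) : ℂ) -
        ((c.re ^ 2 - c.im ^ 2) * a - 2 * c.re * c.im * b : ℝ) * Complex.I =
        c * c * (b - a * Complex.I) := by
      apply Complex.ext <;> simp [pow_two] <;> first | ring1 | (ring_nf; simp)
    have e2 : conj c * c = 1 := by
      apply Complex.ext <;> simp <;> linarith
    linear_combination (conj c * W) * e1 + (c * (b - a * Complex.I) * W) * e2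
  refine Prod.ext ?_ ?_
  · simpa using hab V.1
  · simpa using hab V.2

theorem reebField_critical (hf : ContDiff ℝ ∞ f) {z : S3} (hpos : 0 < factor f ε z.1)
    (hz : IsCritical f (hopf z)) :
    reebField f ε z.1 = (factor f ε z.1)⁻¹ • (Complex.I • z.1) := by
  rw [reebField_sphere z.2, frameDeriv_eq_zero hf hz, frameDeriv_eq_zero hf hz]
  simp only [zero_smul, sub_zero, smul_zero, add_zero]
  rw [smul_smul]
  congr 1
  field_simp

theorem hasDerivAt_exp_smul (a : ℝ) (z : ℂ × ℂ) (t : ℝ) :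
    HasDerivAt (fun t : ℝ => Complex.exp ((t / a : ℝ) * Complex.I) • z)
      (a⁻¹ • (Complex.I • (Complex.exp ((t / a : ℝ) * Complex.I) • z))) t := by
  have h1 : HasDerivAt (fun t : ℝ => ((t / a : ℝ) : ℂ) * Complex.I) ((a⁻¹ : ℝ) * Complex.I) t := by
    have := ((hasDerivAt_id t).div_const a).ofReal_comp.mul_const Complex.I
    simpa [one_div] using this
  have h2 := (h1.cexp).smul_const z
  have e : (Complex.exp ((t / a : ℝ) * Complex.I) * ((a⁻¹ : ℝ) * Complex.I)) • z =
      a⁻¹ • (Complex.I • (Complex.exp ((t / a : ℝ) * Complex.I) • z)) := by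
    rw [smul_smul, ← Complex.coe_smul a⁻¹, smul_smul]
    congr 1
    ring
  exact e ▸ h2

/-- Over a critical point the horizontal part vanishes and the factor is constant on the fibre, so
the flow is the round one with rescaled time. -/
theorem isReebTrajectory_rot (hf : ContDiff ℝ ∞ f) (hpos : ∀ z : S3, 0 < factor f ε z.1) {z : S3}
    (hz : IsCritical f (hopf z)) :
    IsReebTrajectory f ε (fun t => z.rot (t / factor f ε z.1)) := by
  rw [isReebTrajectory_iff hf hpos]
  intro t
  have h1 : reebField f ε (z.rot (t / factor f ε z.1)).1 =
      (factor f ε z.1)⁻¹ • (Complex.I • (z.rot (t / factor f ε z.1)).1) := by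
    rw [reebField_critical hf (hpos _) (by rwa [hopf_rot])]
    rw [S3.rot, factor_smul (normSq_exp _)]
  rw [h1]
  exact hasDerivAt_exp_smul _ _ _

/-! ### Trajectories with short periods -/

/-- The vector field on `S²` to which the Reeb vector field projects, up to a factor that is constant
along each trajectory. -/
def sphereField (f : (Fin 3 → ℝ) → ℝ) (x : Fin 3 → ℝ) : Fin 3 → ℝ :=
  (4 : ℝ) • ![x 1 * fderiv ℝ f x (Pi.single 2 1) - x 2 * fderiv ℝ f x (Pi.single 1 1),
    x 2 * fderiv ℝ f x (Pi.single 0 1) - x 0 * fderiv ℝ f x (Pi.single 2 1),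
    x 0 * fderiv ℝ f x (Pi.single 1 1) - x 1 * fderiv ℝ f x (Pi.single 0 1)]

theorem clm_apply_fin_three (L : (Fin 3 → ℝ) →L[ℝ] ℝ) (v : Fin 3 → ℝ) :
    L v = v 0 * L (Pi.single 0 1) + v 1 * L (Pi.single 1 1) + v 2 * L (Pi.single 2 1) := by
  conv_lhs => rw [← Finset.univ_sum_single v]
  rw [map_sum, Fin.sum_univ_three]
  have : ∀ i, (Pi.single i (v i) : Fin 3 → ℝ) = v i • Pi.single i 1 := by
    intro i; rw [← Pi.single_smul]; simp
  simp [this]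

theorem contDiff_sphereField (hf : ContDiff ℝ ∞ f) : ContDiff ℝ ∞ (sphereField f) := by
  have h : ∀ v, ContDiff ℝ ∞ (fun x => fderiv ℝ f x v) := fun v =>
    (hf.fderiv_right (m := ∞) (by simp)).clm_apply contDiff_const
  have h0 := h (Pi.single 0 1)
  have h1 := h (Pi.single 1 1)
  have h2 := h (Pi.single 2 1)
  have h3 : ContDiff ℝ ∞ (fun x : Fin 3 → ℝ => x 0) := contDiff_apply ℝ ℝ 0
  have h4 : ContDiff ℝ ∞ (fun x : Fin 3 → ℝ => x 1) := contDiff_apply ℝ ℝ 1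
  have h5 : ContDiff ℝ ∞ (fun x : Fin 3 → ℝ => x 2) := contDiff_apply ℝ ℝ 2
  rw [contDiff_pi]
  intro i
  fin_cases i
  · exact contDiff_const.mul ((h4.mul h2).sub (h5.mul h1))
  · exact contDiff_const.mul ((h5.mul h0).sub (h3.mul h2))
  · exact contDiff_const.mul ((h3.mul h1).sub (h4.mul h0))

/-- `sphereField f` is `4 x × ∇f`. The images of `V₁`, `V₂` under the derivative of the Hopf map are
orthogonal tangent vectors of length `2`, which accounts for the factor `4`. -/
theorem sphereField_hopfVec (hf : ContDiff ℝ ∞ f) {z : ℂ × ℂ} (hz : normSq₂ z = 1) :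
    sphereField f (hopfVec z) = frameDeriv f 1 z • hopfDeriv z (frame 0 z) -
      frameDeriv f 0 z • hopfDeriv z (frame 1 z) := by
  rw [frameDeriv, frameDeriv, fderiv_pull hf, fderiv_pull hf, sphereField]
  generalize fderiv ℝ f (hopfVec z) = L
  rw [clm_apply_fin_three L (hopfDeriv z (frame 0 z)), clm_apply_fin_three L (hopfDeriv z (frame 1 z))]
  generalize L (Pi.single 0 1) = d0
  generalize L (Pi.single 1 1) = d1
  generalize L (Pi.single 2 1) = d2
  simp only [normSq₂, Complex.normSq_apply] at hz
  obtain ⟨⟨a, b⟩, ⟨c, d⟩⟩ := z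
  simp only at hz
  ext i
  fin_cases i <;> simp [hopfVec, hopfDeriv, frame, Complex.normSq_apply]
  · linear_combination (-4 * (-2 * (a * d - b * c) * d2 + 2 * (a * c + b * d) * d1)) * hz
  · linear_combination (-4 * (-2 * (a * c + b * d) * d0 -
      (a * a + b * b - (c * c + d * d)) * d2)) * hz
  · linear_combination (-4 * ((a * a + b * b - (c * c + d * d)) * d1 +
      2 * (a * d - b * c) * d0)) * hz

/-- If `x × ∇f = 0`, then the gradient is normal to the sphere. -/
theorem isCritical_of_sphereField_eq_zero {x : S2} (h : sphereField f x.1 = 0) :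
    IsCritical f x := by
  intro v hv
  have h0 := congrFun h 0
  have h1 := congrFun h 1
  have h2 := congrFun h 2
  simp [sphereField] at h0 h1 h2
  have hx := x.2
  rw [clm_apply_fin_three]
  simp only [dotProduct, Fin.sum_univ_three] at hv hx
  generalize fderiv ℝ f x.1 (Pi.single 0 1) = d0 at *
  generalize fderiv ℝ f x.1 (Pi.single 1 1) = d1 at *
  generalize fderiv ℝ f x.1 (Pi.single 2 1) = d2 at *
  generalize x.1 0 = a at *
  generalize x.1 1 = b at *
  generalize x.1 2 = c at *
  generalize v 0 = v0 at *
  generalize v 1 = v1 at *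
  generalize v 2 = v2 at *
  linear_combination (-(v0 * d0 + v1 * d1 + v2 * d2)) * hx + (a * d0 + b * d1 + c * d2) * hv +
    (b * v2 - c * v1) * h0 + (c * v0 - a * v2) * h1 + (a * v1 - b * v0) * h2

/-- Since `h` is conserved, the Hopf image solves the autonomous equation `x' = ε / (2h²) ·
sphereField f x` with a constant coefficient, and `deriv_eq_zero_of_periodic` applies. -/
theorem isCritical_of_periodic (hf : ContDiff ℝ ∞ f) (hpos : ∀ z : S3, 1 / 2 ≤ factor f ε z.1)
    (hε : 0 < ε) {K : NNReal} (hK : LipschitzOnWith K (sphereField f) {x | x ⬝ᵥ x = 1})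
    {c : ℝ → S3} (hc : IsReebTrajectory f ε c) {T : ℝ} (hT : 0 < T)
    (hper : Function.Periodic (fun t => hopf (c t)) T) (hsmall : 2 * ε * K * T < 1) :
    IsCritical f (hopf (c 0)) := by
  have hpos' : ∀ z : S3, 0 < factor f ε z.1 := fun z => by linarith [hpos z]
  rw [isReebTrajectory_iff hf hpos'] at hc
  have hd : ∀ t, HasDerivAt (fun t => factor f ε (c t).1) 0 t := by
    intro t
    have h1 := ((contDiff_pull hf).differentiable (by simp) (c t).1).hasFDerivAt.comp_hasDerivAt t (hc t)
    rw [fderiv_pull_reebField hf] at h1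
    have h2 := (h1.const_mul ε).const_add 1
    rw [mul_zero] at h2
    exact h2
  have hconst : ∀ t, factor f ε (c t).1 = factor f ε (c 0).1 := fun t =>
    is_const_of_deriv_eq_zero (fun t => (hd t).differentiableAt) (fun t => (hd t).deriv) t 0
  set h := factor f ε (c 0).1 with hh
  have hh2 : 1 / 2 ≤ h := hpos _
  have hx : ∀ t, HasDerivAt (fun t => hopfVec (c t).1)
      ((ε / (2 * h ^ 2)) • sphereField f (hopfVec (c t).1)) t := by
    intro t
    have h1 := (contDiff_hopfVec.differentiable (by simp) (c t).1).hasFDerivAt.comp_hasDerivAt t (hc t)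
    have e : fderiv ℝ hopfVec (c t).1 (reebField f ε (c t).1) =
        (ε / (2 * h ^ 2)) • sphereField f (hopfVec (c t).1) := by
      rw [sphereField_hopfVec hf (c t).2, reebField_sphere (c t).2, hconst t]
      simp only [map_smul, map_add, map_sub, fderiv_hopfVec, hopfDeriv_I_smul, smul_zero, zero_add]
      rw [smul_smul]
      congr 1
      field_simp
    rw [e] at h1
    exact h1
  have hz := deriv_eq_zero_of_periodic hK hx (fun t => (hopf (c t)).2) hT
    (fun t => congrArg Subtype.val (hper t)) (by
      -- This is where the lower bound `1 / 2` for the factor enters.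
      have h1 : |ε / (2 * h ^ 2)| ≤ 2 * ε := by
        rw [abs_of_nonneg (by positivity), div_le_iff₀ (by positivity)]
        nlinarith [mul_nonneg hε.le (sub_nonneg.2 hh2)]
      refine lt_of_le_of_lt ?_ hsmall
      gcongr) 0
  refine isCritical_of_sphereField_eq_zero (x := hopf (c 0)) ?_
  refine (smul_eq_zero.1 hz).resolve_left ?_
  positivity

end ReebFlow

/-! ### The linearized flow along a critical fibre -/

section Linearization

variable {f : (Fin 3 → ℝ) → ℝ} {ε : ℝ}

/-- The Hessian of the pullback of `f` in the frame `(V₁, V₂)`: the derivative of `V_i F` in the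
direction `V_j`. -/
def frameHess (f : (Fin 3 → ℝ) → ℝ) (i j : Fin 2) (z : ℂ × ℂ) : ℝ :=
  fderiv ℝ (frameDeriv f i) z (frame j z)

/-- The generator of the linearized Reeb flow along a critical fibre, in a rotating frame. -/
def generator (f : (Fin 3 → ℝ) → ℝ) (ε : ℝ) (z : ℂ × ℂ) : Matrix (Fin 2) (Fin 2) ℝ :=
  (ε / (2 * factor f ε z ^ 2)) • !![frameHess f 1 0 z, frameHess f 1 1 z;
    -frameHess f 0 0 z, -frameHess f 0 1 z]

/-- The rotation of the plane by the angle `α`. -/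
def rotMat (α : ℝ) : Matrix (Fin 2) (Fin 2) ℝ :=
  !![Real.cos α, -Real.sin α; Real.sin α, Real.cos α]

/-- At a critical point the frame derivatives of the pullback vanish, so only their own derivatives,
the Hessian entries, survive; the factor and the denominator are stationary in the frame directions.
-/
theorem fderiv_reebField_frame (hf : ContDiff ℝ ∞ f) {z : S3} (hpos : ∀ z : S3, 0 < factor f ε z.1)
    (hz : IsCritical f (hopf z)) (j : Fin 2) :
    fderiv ℝ (reebField f ε) z.1 (frame j z.1) =
      (factor f ε z.1)⁻¹ • (Complex.I • frame j z.1) + (ε / (2 * factor f ε z.1 ^ 2)) •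
        (frameHess f 1 j z.1 • frame 0 z.1 - frameHess f 0 j z.1 • frame 1 z.1) := by
  set V := frame j z.1 with hV
  have hn : normSq₂ z.1 = 1 := z.2
  have hne : factor f ε z.1 ≠ 0 := (hpos z).ne'
  have h1 := hasDerivAt_comp_line ((contDiff_reebField hf hpos).differentiable (by simp) z.1) V
  have hF := hasDerivAt_comp_line ((contDiff_factor (ε := ε) hf).differentiable (by simp) z.1) V
  have hF0 : fderiv ℝ (factor f ε) z.1 V = 0 := by
    have e := ((hasDerivAt_comp_line ((contDiff_pull hf).differentiable (by simp) z.1) V).const_mul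
      ε).const_add 1
    have h0 : fderiv ℝ (pull f) z.1 V = 0 := frameDeriv_eq_zero hf hz j
    rw [h0, mul_zero] at e
    exact hF.unique e
  rw [hF0] at hF
  have hN := hasDerivAt_comp_line (contDiff_normSq₂.differentiable (by simp) z.1) V
  rw [fderiv_normSq₂, realInner_frame, mul_zero] at hN
  have hD0 := hasDerivAt_comp_line ((contDiff_frameDeriv hf 0).differentiable (by simp) z.1) V
  have hD1 := hasDerivAt_comp_line ((contDiff_frameDeriv hf 1).differentiable (by simp) z.1) V
  have hV0 := hasDerivAt_comp_line ((contDiff_frame 0).differentiable (by simp) z.1) V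
  have hV1 := hasDerivAt_comp_line ((contDiff_frame 1).differentiable (by simp) z.1) V
  have hI : HasDerivAt (fun s : ℝ => Complex.I • (z.1 + s • V)) (Complex.I • V) 0 :=
    (hasDerivAt_line z.1 V 0).const_smul Complex.I
  have hden : HasDerivAt (fun s : ℝ => (factor f ε (z.1 + s • V) ^ 2 +
      (1 - normSq₂ (z.1 + s • V)) ^ 2)⁻¹) 0 0 := by
    have h2 := ((hF.pow 2).add ((hN.const_sub 1).pow 2)).inv (by
      simp [hn, hne])
    exact h2.congr_deriv (by simp)
  have h2 := hden.smul ((hF.smul hI).add (((hD1.smul hV0).sub (hD0.smul hV1)).const_smul (ε / 2)))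
  have h3 := h1.unique h2
  rw [h3]
  simp only [Pi.add_apply, Pi.smul_apply, Pi.sub_apply, Pi.smul_apply', zero_smul, add_zero,
    frameDeriv_eq_zero hf hz, hn, sub_self, zero_add, smul_zero]
  rw [smul_add, smul_smul, smul_smul]
  congr 2
  · field_simp
    simp
  · field_simp
    simp

theorem fderiv_reebField_smul (hf : ContDiff ℝ ∞ f) (hpos : ∀ z : S3, 0 < factor f ε z.1)
    {c : ℂ} (hc : Complex.normSq c = 1) (z v : ℂ × ℂ) :
    fderiv ℝ (reebField f ε) (c • z) (c • v) = c • fderiv ℝ (reebField f ε) z v := by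
  have hd := (contDiff_reebField hf hpos).differentiable (by simp)
  have h1 := hasDerivAt_comp_line (hd (c • z)) (c • v)
  have h2 := (hasDerivAt_comp_line (hd z) v).const_smul c
  refine h1.unique (h2.congr_of_eventuallyEq (Filter.Eventually.of_forall fun s => ?_))
  simp only [Pi.smul_apply]
  rw [← reebField_smul hf hc, smul_add, smul_comm c s]

/-- Second-order contact of the great circle with its tangent line, which is the initial hypothesis
of `hasDerivAt_integralCurve_initial`. -/
theorem greatCircle_sub_le (i : Fin 2) (z : S3) {s : ℝ} (hs : |s| ≤ 1) :
    ‖(greatCircle i z s).1 - z.1 - s • frame i z.1‖ ≤ 2 * s ^ 2 := by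
  have hV : ‖frame i z.1‖ ≤ 1 := by
    have h := realInner_frame_frame (z := z.1) z.2 i i
    simp only [if_true] at h
    have hn : Complex.normSq (frame i z.1).1 + Complex.normSq (frame i z.1).2 = 1 := by
      simp only [realInner, Complex.add_re, Complex.mul_re, Complex.conj_re, Complex.conj_im] at h
      rw [Complex.normSq_apply, Complex.normSq_apply]
      linarith
    exact S3.norm_le ⟨frame i z.1, hn⟩
  have e : (greatCircle i z s).1 - z.1 - s • frame i z.1 =
      (Real.cos s - 1) • z.1 + (Real.sin s - s) • frame i z.1 := by
    change Real.cos s • z.1 + Real.sin s • frame i z.1 - z.1 - s • frame i z.1 = _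
    module
  have h1 : |Real.cos s - 1| ≤ s ^ 2 := by
    rw [abs_le]
    constructor <;> nlinarith [Real.one_sub_sq_div_two_le_cos (x := s), Real.cos_le_one s, sq_nonneg s]
  have h2 : |Real.sin s - s| ≤ s ^ 2 := by
    have h3 := Real.sin_bound hs
    have h4 : |s| ^ 5 ≤ s ^ 2 := by
      rw [← sq_abs s, show 5 = 2 + 3 from rfl, pow_add]
      exact mul_le_of_le_one_right (sq_nonneg _) (pow_le_one₀ (abs_nonneg s) hs)
    have h5 : |s ^ 3| ≤ s ^ 2 := by
      rw [abs_pow, ← sq_abs s, pow_succ]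
      exact mul_le_of_le_one_right (sq_nonneg _) hs
    rw [abs_le] at h3 h5 ⊢
    constructor <;> nlinarith [sq_nonneg s, h3.1, h3.2, h5.1, h5.2]
  rw [e]
  refine (norm_add_le _ _).trans ?_
  rw [norm_smul, norm_smul, Real.norm_eq_abs, Real.norm_eq_abs]
  nlinarith [mul_le_mul h1 z.norm_le (norm_nonneg _) (sq_nonneg s),
    mul_le_mul h2 hV (norm_nonneg _) (sq_nonneg s)]

/-- Compares two frames at `e^{iτ} z`: the one carried along by the round flow and the
left-invariant one. They differ by the angle `2τ`. -/
theorem realInner_frame_exp {z : ℂ × ℂ} (hz : normSq₂ z = 1) (τ : ℝ) (i : Fin 2) (a b : ℝ) :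
    realInner (frame i (Complex.exp (τ * Complex.I) • z))
      (Complex.exp (τ * Complex.I) • (a • frame 0 z + b • frame 1 z)) =
      rotMat (2 * τ) i 0 * a + rotMat (2 * τ) i 1 * b := by
  have hre : (Complex.exp (τ * Complex.I)).re = Real.cos τ := Complex.exp_ofReal_mul_I_re τ
  have him : (Complex.exp (τ * Complex.I)).im = Real.sin τ := Complex.exp_ofReal_mul_I_im τ
  have hcos : Real.cos (2 * τ) = Real.cos τ ^ 2 - Real.sin τ ^ 2 := Real.cos_two_mul' τ
  simp only [normSq₂, Complex.normSq_apply] at hz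
  rw [frame_smul]
  simp only [rotMat, hcos, Real.sin_two_mul]
  generalize Complex.exp (τ * Complex.I) = e at *
  generalize Real.cos τ = p at *
  generalize Real.sin τ = q at *
  fin_cases i <;> simp [frame, realInner, hre, him]
  · linear_combination (a * (p ^ 2 - q ^ 2) - 2 * p * q * b) * hz
  · linear_combination (b * (p ^ 2 - q ^ 2) + 2 * p * q * a) * hz

/-- The Reeb field commutes with the round flow, so in the frame carried along by that flow the
linearized equation has the constant matrix `generator`. Passing to the left-invariant frame
contributes the rotation. -/
theorem linearizedFlow_critical (hf : ContDiff ℝ ∞ f) (hpos : ∀ z : S3, 0 < factor f ε z.1) {z : S3}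
    (hz : IsCritical f (hopf z)) {M : ℝ → Matrix (Fin 2) (Fin 2) ℝ}
    (hM : ∀ t i j, HasDerivAt (fun t => M t i j) ((generator f ε z.1 * M t) i j) t) (hM0 : M 0 = 1)
    {t : ℝ} (ht : 0 ≤ t) :
    linearizedFlow f ε z t = rotMat (2 * (t / factor f ε z.1)) * M t := by
  set h := factor f ε z.1 with hh
  have hφ := isReebFlow_reebFlow hf hpos
  have hrot : ∀ t, reebFlow f ε t z = z.rot (t / h) := fun t =>
    congrFun (IsReebTrajectory.ext (t₀ := 0) hf hpos (hφ z).2 (isReebTrajectory_rot hf hpos hz)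
      ((hφ z).1.trans (by rw [zero_div, S3.rot_zero]))) t
  obtain ⟨χ, hχ, hcpt, hone⟩ := exists_cutoff (contDiff_reebField hf hpos)
  set X : ℂ × ℂ → ℂ × ℂ := fun z => χ z • reebField f ε z with hX
  have hXeq : ∀ w : S3, X =ᶠ[𝓝 w.1] reebField f ε := fun w => by
    filter_upwards [Metric.isOpen_ball.mem_nhds w.mem_ball] with y hy
    change χ y • reebField f ε y = reebField f ε y
    rw [hone y hy, one_smul]
  have hderiv : ∀ j, HasDerivAt (fun s : ℝ => (reebFlow f ε t (greatCircle j z s)).1)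
      (Complex.exp ((t / h : ℝ) * Complex.I) • (M t 0 j • frame 0 z.1 + M t 1 j • frame 1 z.1)) 0 := by
    intro j
    have hg0 : greatCircle j z 0 = z := Subtype.ext (by simp [greatCircle])
    -- The chosen `w` is the solution of the variational equation built from column `j` of `M`,
    -- written in the transported frame.
    refine hasDerivAt_integralCurve_initial (X := X) (hχ.of_le ENat.LEInfty.out) hcpt
      (c := fun s t => (reebFlow f ε t (greatCircle j z s)).1) (T := t)
      (w := fun t => Complex.exp ((t / h : ℝ) * Complex.I) •
        (M t 0 j • frame 0 z.1 + M t 1 j • frame 1 z.1)) ?_ ?_ ⟨2, fun s hs => ?_⟩ ht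
    · intro s t
      rw [(hXeq _).self_of_nhds]
      exact (isReebTrajectory_iff hf hpos).1 (hφ (greatCircle j z s)).2 t
    · intro t
      simp only [hg0, hrot]
      rw [(hXeq _).fderiv_eq, S3.rot, fderiv_reebField_smul hf hpos (normSq_exp _), map_add, map_smul,
        map_smul, fderiv_reebField_frame hf hpos hz, fderiv_reebField_frame hf hpos hz]
      have h1 : HasDerivAt (fun t : ℝ => Complex.exp ((t / h : ℝ) * Complex.I))
          ((h⁻¹ : ℝ) * Complex.I * Complex.exp ((t / h : ℝ) * Complex.I)) t := by
        have h2 : HasDerivAt (fun t : ℝ => ((t / h : ℝ) : ℂ) * Complex.I) ((h⁻¹ : ℝ) * Complex.I) t := by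
          have := ((hasDerivAt_id t).div_const h).ofReal_comp.mul_const Complex.I
          simpa [one_div] using this
        rw [mul_comm]
        exact h2.cexp
      have h3 := h1.smul (((hM t 0 j).smul_const (frame 0 z.1)).add
        ((hM t 1 j).smul_const (frame 1 z.1)))
      refine h3.congr_deriv ?_
      simp only [generator, Matrix.mul_apply, Fin.sum_univ_two, Matrix.smul_apply, ← hh]
      simp only [Matrix.of_apply, Matrix.cons_val', Matrix.cons_val_zero, Matrix.cons_val_one,
        Matrix.cons_val_fin_one, smul_eq_mul]
      generalize Complex.exp ((t / h : ℝ) * Complex.I) = e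
      generalize frame 0 z.1 = V
      generalize frame 1 z.1 = W
      refine Prod.ext ?_ ?_ <;> simp <;> ring
    · simp only [(hφ _).1, hg0, zero_div, Complex.ofReal_zero, zero_mul, Complex.exp_zero, one_smul,
        hM0]
      have : ((1 : Matrix (Fin 2) (Fin 2) ℝ) 0 j • frame 0 z.1 +
          (1 : Matrix (Fin 2) (Fin 2) ℝ) 1 j • frame 1 z.1) = frame j z.1 := by
        revert j
        rw [Fin.forall_fin_two]
        simp
      rw [this]
      exact greatCircle_sub_le j z hs
  ext i j
  rw [linearizedFlow, Matrix.of_apply, (hderiv j).deriv, hrot, S3.rot, realInner_frame_exp z.2,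
    Matrix.mul_apply, Fin.sum_univ_two]

end Linearization

/-! ### Rotation sets and Conley–Zehnder indices of explicit paths -/

section Rotation

open Real Set

theorem rotMat_mulVec (α β r : ℝ) :
    rotMat α *ᵥ (r • ![cos β, sin β]) = r • ![cos (α + β), sin (α + β)] := by
  ext i
  fin_cases i <;> simp [rotMat, Matrix.mulVec, dotProduct, Fin.sum_univ_two, cos_add, sin_add] <;> ring

theorem exists_polar {u : Fin 2 → ℝ} (hu : u ≠ 0) :
    ∃ r β : ℝ, 0 < r ∧ u = r • ![cos β, sin β] := by
  set w : ℂ := ⟨u 0, u 1⟩ with hw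
  have hw0 : w ≠ 0 := by
    intro h
    apply hu
    ext i
    fin_cases i
    · exact congrArg Complex.re h
    · exact congrArg Complex.im h
  refine ⟨‖w‖, Complex.arg w, norm_pos_iff.2 hw0, ?_⟩
  ext i
  fin_cases i <;> simp [hw]

theorem dotProduct_self_pos_of_ne_zero {u : Fin 2 → ℝ} (hu : u ≠ 0) : 0 < u ⬝ᵥ u := by
  refine lt_of_le_of_ne ?_ (Ne.symm (dotProduct_self_eq_zero.not.2 hu))
  rw [dotProduct, Fin.sum_univ_two]
  nlinarith [mul_self_nonneg (u 0), mul_self_nonneg (u 1)]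

/-- A continuous function that starts at `0` and whose cosine stays above `cos η` is less than `η` in
absolute value. -/
theorem abs_lt_of_cos_lt {ψ : ℝ → ℝ} {T η : ℝ} (hT : 0 ≤ T) (hη : 0 < η)
    (hψ : ContinuousOn ψ (Icc 0 T)) (h0 : ψ 0 = 0) (hcos : ∀ t ∈ Icc 0 T, cos η < cos (ψ t)) :
    |ψ T| < η := by
  by_contra! hcon
  have hc : ContinuousOn (fun t => |ψ t|) (Icc 0 T) := hψ.abs
  obtain ⟨t, ht, hte⟩ := intermediate_value_Icc hT hc
    (show η ∈ Icc (|ψ 0|) (|ψ T|) from ⟨by rw [h0, abs_zero]; exact hη.le, hcon⟩)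
  have := hcos t ht
  rw [← cos_abs (ψ t)] at this
  simp only at hte
  rw [hte] at this
  exact lt_irrefl _ this

/-- The rotation set of a path `t ↦ Rot(a t) E_t`, where the angles between `u` and `E_t u` are less
than `η`, lies within `η / 2π` of `a T / 2π`. -/
theorem abs_sub_lt_of_mem_rotationSet {M E : ℝ → Matrix (Fin 2) (Fin 2) ℝ} {a T η : ℝ} (hT : 0 ≤ T)
    (hη : 0 < η) (hM : ∀ t ∈ Icc 0 T, M t = rotMat (a * t) * E t) (hE0 : E 0 = 1)
    (hE : ∀ t ∈ Icc 0 T, ∀ u : Fin 2 → ℝ, u ≠ 0 →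
      cos η * (√(u ⬝ᵥ u) * √((E t *ᵥ u) ⬝ᵥ (E t *ᵥ u))) < u ⬝ᵥ (E t *ᵥ u)) {Δ : ℝ}
    (hΔ : Δ ∈ rotationSet M T) : |Δ - a * T / (2 * π)| < η / (2 * π) := by
  obtain ⟨u, hu, θ, hθ, hlift, rfl⟩ := hΔ
  have h0 : (0 : ℝ) ∈ Icc 0 T := ⟨le_rfl, hT⟩
  have hinv : ∀ t ∈ Icc 0 T, ∃ r : ℝ, 0 < r ∧
      E t *ᵥ u = r • ![cos (θ t - a * t), sin (θ t - a * t)] := by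
    intro t ht
    obtain ⟨r, hr, hr'⟩ := hlift t ht
    refine ⟨r, hr, ?_⟩
    -- Undoing the rotation shows that `θ t - a * t` is a continuous angle of `E t *ᵥ u`.
    have h1 : rotMat (-(a * t)) *ᵥ (M t *ᵥ u) = E t *ᵥ u := by
      rw [hM t ht, Matrix.mulVec_mulVec, ← mul_assoc]
      have : rotMat (-(a * t)) * rotMat (a * t) = 1 := by
        ext i j
        fin_cases i <;> fin_cases j <;> simp [rotMat, Matrix.mul_apply, Fin.sum_univ_two] <;>
          nlinarith [sin_sq_add_cos_sq (a * t)]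
      rw [this, one_mul]
    rw [← h1, hr', rotMat_mulVec, neg_add_eq_sub]
  obtain ⟨r₀, hr₀, hu₀⟩ := hinv 0 h0
  rw [hE0, Matrix.one_mulVec, mul_zero, sub_zero] at hu₀
  -- The angle between `u` and `E t *ᵥ u` starts at `0`, and by `hE` its cosine stays above `cos η`.
  have key := abs_lt_of_cos_lt (ψ := fun t => θ t - a * t - θ 0) hT hη
    ((hθ.sub (by fun_prop)).sub continuousOn_const) (by simp) (fun t ht => by
      obtain ⟨r, hr, hr'⟩ := hinv t ht
      have h1 := hE t ht u hu
      have e1 : u ⬝ᵥ u = r₀ ^ 2 := by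
        rw [hu₀]; simp [dotProduct, Fin.sum_univ_two]
        linear_combination r₀ ^ 2 * sin_sq_add_cos_sq (θ 0)
      have e2 : (E t *ᵥ u) ⬝ᵥ (E t *ᵥ u) = r ^ 2 := by
        rw [hr']; simp [dotProduct, Fin.sum_univ_two]
        linear_combination r ^ 2 * sin_sq_add_cos_sq (θ t - a * t)
      have e3 : u ⬝ᵥ (E t *ᵥ u) = r₀ * r * cos (θ t - a * t - θ 0) := by
        rw [hr', cos_sub (θ t - a * t) (θ 0)]
        conv_lhs => rw [hu₀]
        simp [dotProduct, Fin.sum_univ_two]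
        ring
      rw [e1, e2, e3, sqrt_sq hr₀.le, sqrt_sq hr.le, mul_comm] at h1
      exact lt_of_mul_lt_mul_left h1 (by positivity))
  have e : (θ T - θ 0) / (2 * π) - a * T / (2 * π) = (θ T - a * T - θ 0) / (2 * π) := by ring
  rw [e, abs_div, abs_of_pos (by positivity : (0 : ℝ) < 2 * π)]
  exact div_lt_div_of_pos_right key (by positivity)

/-- A common eigenvector of all `E t` with positive eigenvalues is turned by the rotation factor
alone. -/
theorem mem_rotationSet {M E : ℝ → Matrix (Fin 2) (Fin 2) ℝ} {a T : ℝ}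
    (hM : ∀ t ∈ Icc 0 T, M t = rotMat (a * t) * E t) {u : Fin 2 → ℝ} (hu : u ≠ 0)
    (hE : ∀ t ∈ Icc 0 T, ∃ r : ℝ, 0 < r ∧ E t *ᵥ u = r • u) :
    a * T / (2 * π) ∈ rotationSet M T := by
  obtain ⟨r₀, β, hr₀, hβ⟩ := exists_polar hu
  refine ⟨u, hu, fun t => a * t + β, by fun_prop, fun t ht => ?_, by ring⟩
  obtain ⟨r, hr, hr'⟩ := hE t ht
  refine ⟨r * r₀, by positivity, ?_⟩
  rw [hM t ht, ← Matrix.mulVec_mulVec, hr', hβ, smul_smul, rotMat_mulVec]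

/-- The bound excludes every other integer, so the choice in the definition has to return `k`. -/
theorem conleyZehnder_eq_two_mul {M : ℝ → Matrix (Fin 2) (Fin 2) ℝ} {T : ℝ} {k : ℤ}
    (hk : (k : ℝ) ∈ rotationSet M T) (hall : ∀ Δ ∈ rotationSet M T, |Δ - k| < 1) :
    conleyZehnder M T = 2 * k := by
  have h : ∃ k : ℤ, (k : ℝ) ∈ rotationSet M T := ⟨k, hk⟩
  rw [conleyZehnder, dif_pos h]
  have h1 := hall _ h.choose_spec
  rw [← Int.cast_sub, ← Int.cast_abs, ← Int.cast_one, Int.cast_lt, Int.abs_lt_one_iff] at h1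
  rw [sub_eq_zero.1 h1]

/-- The strict margins keep integers out and put the infimum in `[k, k + 1)`. Nonemptiness matters
because `sInf ∅ = 0`. -/
theorem conleyZehnder_eq_two_mul_add_one {M : ℝ → Matrix (Fin 2) (Fin 2) ℝ} {T lo hi : ℝ} {k : ℤ}
    (hne : (rotationSet M T).Nonempty) (hlo : (k : ℝ) < lo) (hhi : hi < k + 1)
    (hall : ∀ Δ ∈ rotationSet M T, lo ≤ Δ ∧ Δ ≤ hi) : conleyZehnder M T = 2 * k + 1 := by
  have h : ¬ ∃ k : ℤ, (k : ℝ) ∈ rotationSet M T := by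
    rintro ⟨m, hm⟩
    have h1 : (k : ℝ) < m := hlo.trans_le (hall _ hm).1
    have h2 : (m : ℝ) < k + 1 := (hall _ hm).2.trans_lt hhi
    norm_cast at h1 h2
    omega
  rw [conleyZehnder, dif_neg h]
  have hfl : ⌊sInf (rotationSet M T)⌋ = k := by
    rw [Int.floor_eq_iff]
    obtain ⟨x, hx⟩ := hne
    exact ⟨hlo.le.trans (le_csInf ⟨x, hx⟩ fun Δ h => (hall Δ h).1),
      ((csInf_le ⟨lo, fun Δ h => (hall Δ h).1⟩ hx).trans (hall x hx).2).trans_lt hhi⟩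
  rw [hfl]

/-! ### Elliptic and hyperbolic generators -/

/-- The Conley–Zehnder index of an orbit over a critical point of type `s` with `θ = T / h`. -/
def expectedIndex (θ : ℝ) (s : ℤ) : ℤ :=
  if θ / π = ⌊θ / π⌋ then 2 * ⌊θ / π⌋ + s else 2 * ⌊θ / π⌋ + 1

/-- A fraction with denominator `n` that is not an integer is at least `1 / n` away from the
integers. -/
theorem floor_margin {n : ℕ} (hn : 0 < n) {θ : ℝ} {j : ℤ} (hθ : n * θ = 2 * π * j)
    (hint : θ / π ≠ ⌊θ / π⌋) :
    (⌊θ / π⌋ : ℝ) + 1 / n ≤ θ / π ∧ θ / π + 1 / n ≤ ⌊θ / π⌋ + 1 := by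
  have hn' : (0 : ℝ) < n := by exact_mod_cast hn
  set m := ⌊θ / π⌋ with hm
  have e : n * (θ / π) = 2 * j := by
    field_simp
    linarith
  have h1 : (m : ℝ) < θ / π := lt_of_le_of_ne (Int.floor_le _) (Ne.symm hint)
  have h2 : θ / π < m + 1 := Int.lt_floor_add_one _
  have h3 : (n * m : ℝ) < 2 * j := by rw [← e]; gcongr
  have h4 : (2 * j : ℝ) < n * (m + 1) := by rw [← e]; gcongr
  have h5 : (n * m : ℤ) + 1 ≤ 2 * j := by
    have : ((n * m : ℤ) : ℝ) < ((2 * j : ℤ) : ℝ) := by push_cast; exact h3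
    exact_mod_cast this
  have h6 : (2 * j : ℤ) + 1 ≤ n * (m + 1) := by
    have : ((2 * j : ℤ) : ℝ) < ((n * (m + 1) : ℤ) : ℝ) := by push_cast; exact h4
    exact_mod_cast this
  have h5' : (n * m : ℝ) + 1 ≤ 2 * j := by exact_mod_cast h5
  have h6' : (2 * j : ℝ) + 1 ≤ n * (m + 1) := by exact_mod_cast h6
  rw [← e] at h5' h6'
  constructor
  · rw [← mul_le_mul_iff_right₀ hn', mul_add, mul_one_div_cancel hn'.ne']; exact h5'
  · rw [← mul_le_mul_iff_right₀ hn', mul_add (n : ℝ) (θ / π), mul_one_div_cancel hn'.ne']; exact h6'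

theorem det_rotMat_sub_one (α : ℝ) : (rotMat α - 1).det = 2 - 2 * cos α := by
  rw [Matrix.det_fin_two]
  simp [rotMat]
  linear_combination sin_sq_add_cos_sq α

/-- The path rotates with speed `a + c`, so its rotation set is one number: `θ / π`, where `θ = a T
/ 2`, plus a correction below `1 / (2n)`. The correction cannot reach an integer if `θ / π` is not
one; otherwise its sign decides the side of that integer. -/
theorem elliptic_index {M : ℝ → Matrix (Fin 2) (Fin 2) ℝ} {a c T : ℝ} {n : ℕ} {j s : ℤ} (hT : 0 < T)
    (hn : 0 < n) (hM : ∀ t ∈ Icc 0 T, M t = rotMat (a * t) * rotMat (c * t))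
    (hj : n * (a * T / 2) = 2 * π * j) (hs : (0 < c ∧ s = 1) ∨ (c < 0 ∧ s = -1))
    (hc : |c| * T < π / n) :
    (M T - 1).det ≠ 0 ∧ conleyZehnder M T = expectedIndex (a * T / 2) s := by
  have hn' : (1 : ℝ) ≤ n := by exact_mod_cast hn
  have hM' : ∀ t ∈ Icc 0 T, M t = rotMat ((a + c) * t) * (1 : Matrix (Fin 2) (Fin 2) ℝ) := by
    intro t ht
    rw [hM t ht, mul_one]
    ext i j
    fin_cases i <;> fin_cases j <;>
      simp [rotMat, Matrix.mul_apply, Fin.sum_univ_two, add_mul, cos_add, sin_add] <;> ring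
  set ρ := (a + c) * T / (2 * π) with hρ
  have hset : rotationSet M T = {ρ} := by
    refine Set.eq_singleton_iff_unique_mem.2 ⟨?_, fun Δ hΔ => ?_⟩
    · exact mem_rotationSet hM' (u := ![1, 0]) (by simp) fun t _ => ⟨1, one_pos, by simp⟩
    · by_contra hne
      have hpos : 0 < |Δ - ρ| := abs_pos.2 (sub_ne_zero.2 hne)
      -- With `E = 1` the estimate holds for every small `η > 0`. This `η` would put `Δ` closer to
      -- `ρ` than it is.
      set η := min (π / 2) (|Δ - ρ| * (2 * π)) with hη
      have hη0 : 0 < η := lt_min (by positivity) (by positivity)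
      have := abs_sub_lt_of_mem_rotationSet (E := fun _ => 1) hT.le hη0 hM' rfl (fun t _ u hu => by
        have hu' := dotProduct_self_pos_of_ne_zero hu
        have hcos : cos η < 1 := by
          rw [← cos_zero]
          exact cos_lt_cos_of_nonneg_of_le_pi_div_two le_rfl (min_le_left _ _) hη0
        rw [Matrix.one_mulVec, mul_self_sqrt hu'.le]
        nlinarith) hΔ
      rw [← hρ, lt_div_iff₀ (by positivity)] at this
      exact absurd this (not_lt.2 (min_le_right _ _))
  have hθ : a * T / 2 / π + c * T / (2 * π) = ρ := by rw [hρ]; field_simp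
  have hsmall : |c * T / (2 * π)| < 1 / (2 * n) := by
    rw [abs_div, abs_mul, abs_of_pos hT, abs_of_pos (by positivity : (0 : ℝ) < 2 * π)]
    rw [div_lt_div_iff₀ (by positivity) (by positivity)]
    rw [lt_div_iff₀ (by positivity)] at hc
    linarith
  have h2n : (1 : ℝ) / (2 * n) ≤ 1 / n / 2 := by rw [div_div, mul_comm]
  have h1n : (1 : ℝ) / n ≤ 1 := by rw [div_le_one (by positivity)]; exact hn'
  have hdet : ∀ k : ℤ, (k : ℝ) < ρ → ρ < k + 1 → (M T - 1).det ≠ 0 := by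
    intro k hk1 hk2 h0
    rw [hM' T ⟨hT.le, le_rfl⟩, mul_one, det_rotMat_sub_one] at h0
    have h1 : cos ((a + c) * T) = 1 := by linarith
    rw [cos_eq_one_iff] at h1
    obtain ⟨m, hm⟩ := h1
    have h2 : ρ = m := by rw [hρ, ← hm]; field_simp
    rw [h2] at hk1 hk2
    norm_cast at hk1 hk2
    omega
  have hcz : ∀ k : ℤ, (k : ℝ) < ρ → ρ < k + 1 → conleyZehnder M T = 2 * k + 1 := by
    intro k hk1 hk2
    refine conleyZehnder_eq_two_mul_add_one (lo := ρ) (hi := ρ) ?_ hk1 hk2 ?_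
    · rw [hset]; exact singleton_nonempty _
    · rw [hset]; rintro Δ rfl; exact ⟨le_rfl, le_rfl⟩
  rw [abs_lt] at hsmall
  by_cases hint : a * T / 2 / π = ⌊a * T / 2 / π⌋
  · rw [expectedIndex, if_pos hint]
    rcases hs with ⟨hc0, rfl⟩ | ⟨hc0, rfl⟩
    · have h1 : 0 < c * T / (2 * π) := by positivity
      have k1 : (⌊a * T / 2 / π⌋ : ℝ) < ρ := by linarith
      have k2 : ρ < (⌊a * T / 2 / π⌋ : ℝ) + 1 := by linarith
      exact ⟨hdet _ k1 k2, hcz _ k1 k2⟩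
    · have h1 : c * T / (2 * π) < 0 := div_neg_of_neg_of_pos (mul_neg_of_neg_of_pos hc0 hT) (by positivity)
      -- For a minimum the rotation number lies just below the integer `k`, so the index is `2 (k -
      -- 1) + 1 = 2k - 1`.
      have k1 : ((⌊a * T / 2 / π⌋ - 1 : ℤ) : ℝ) < ρ := by push_cast; linarith
      have k2 : ρ < ((⌊a * T / 2 / π⌋ - 1 : ℤ) : ℝ) + 1 := by push_cast; linarith
      refine ⟨hdet _ k1 k2, ?_⟩
      rw [hcz _ k1 k2]; ring
  · rw [expectedIndex, if_neg hint]
    obtain ⟨m1, m2⟩ := floor_margin hn hj hint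
    have h0n : (0 : ℝ) < 1 / n := by positivity
    have k1 : (⌊a * T / 2 / π⌋ : ℝ) < ρ := by linarith
    have k2 : ρ < (⌊a * T / 2 / π⌋ : ℝ) + 1 := by linarith
    exact ⟨hdet _ k1 k2, hcz _ k1 k2⟩

/-- The path of positive definite symmetric matrices `exp(t K)`, where `K = (p q; q -p)`. -/
def hyperbolicPath (p q : ℝ) (t : ℝ) : Matrix (Fin 2) (Fin 2) ℝ :=
  cosh (√(p ^ 2 + q ^ 2) * t) • 1 +
    (sinh (√(p ^ 2 + q ^ 2) * t) / √(p ^ 2 + q ^ 2)) • !![p, q; q, -p]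

theorem hyperbolicPath_mulVec (p q t : ℝ) (u : Fin 2 → ℝ) :
    hyperbolicPath p q t *ᵥ u = cosh (√(p ^ 2 + q ^ 2) * t) • u +
      (sinh (√(p ^ 2 + q ^ 2) * t) / √(p ^ 2 + q ^ 2)) •
        ![p * u 0 + q * u 1, q * u 0 - p * u 1] := by
  rw [hyperbolicPath, Matrix.add_mulVec, Matrix.smul_mulVec, Matrix.smul_mulVec, Matrix.one_mulVec]
  congr 2
  ext i
  fin_cases i <;> simp [Matrix.mulVec, dotProduct, Fin.sum_univ_two]
  ring

/-- The matrix is symmetric with eigenvalues `e^{±kt}`, where `k = √(p² + q²)`. Hence `⟨u, Eu⟩ ≥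
e^{-kt} |u|²` and `|Eu| ≤ e^{kt} |u|`, and the cosine of the angle is at least `e^{-2kt}`. -/
theorem hyperbolicPath_angle {p q t T η : ℝ} (ht : t ∈ Icc 0 T) (hpq : 0 < p ^ 2 + q ^ 2)
    (hsmall : cos η < exp (-(2 * √(p ^ 2 + q ^ 2) * T))) {u : Fin 2 → ℝ} (hu : u ≠ 0) :
    cos η * (√(u ⬝ᵥ u) * √((hyperbolicPath p q t *ᵥ u) ⬝ᵥ (hyperbolicPath p q t *ᵥ u))) <
        u ⬝ᵥ (hyperbolicPath p q t *ᵥ u) := by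
  have hpath := hyperbolicPath_mulVec p q
  set k := √(p ^ 2 + q ^ 2) with hk
  have hk0 : 0 < k := sqrt_pos.2 hpq
  have hk2 : k ^ 2 = p ^ 2 + q ^ 2 := sq_sqrt hpq.le
  have hU := dotProduct_self_pos_of_ne_zero hu
  set U := u ⬝ᵥ u with hUdef
  set Q := p * (u 0 * u 0 - u 1 * u 1) + 2 * q * (u 0 * u 1) with hQdef
  have hUe : U = u 0 * u 0 + u 1 * u 1 := by rw [hUdef, dotProduct, Fin.sum_univ_two]
  have hQ : |Q| ≤ k * U := by
    -- `Q` is `⟨u, Ku⟩` and `|Ku| = k |u|`; this is Cauchy–Schwarz through Lagrange's identity.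
    refine abs_le_of_sq_le_sq ?_ (by positivity)
    have : (k * U) ^ 2 - Q ^ 2 = (u 0 * (q * u 0 - p * u 1) - u 1 * (p * u 0 + q * u 1)) ^ 2 := by
      rw [mul_pow, hk2, hUe, hQdef]; ring
    nlinarith [sq_nonneg (u 0 * (q * u 0 - p * u 1) - u 1 * (p * u 0 + q * u 1))]
  have hQk : |Q / k| ≤ U := by
    rw [abs_div, abs_of_pos hk0, div_le_iff₀ hk0]
    linarith
  have hS : 0 ≤ sinh (k * t) := sinh_nonneg_iff.2 (mul_nonneg hk0.le ht.1)
  have hC : 0 < cosh (k * t) := cosh_pos _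
  have e1 : u ⬝ᵥ (hyperbolicPath p q t *ᵥ u) = cosh (k * t) * U + sinh (k * t) * (Q / k) := by
    rw [hpath, hUe, hQdef]
    simp [dotProduct, Fin.sum_univ_two]
    field_simp
    ring
  have e2 : (hyperbolicPath p q t *ᵥ u) ⬝ᵥ (hyperbolicPath p q t *ᵥ u) =
      cosh (k * t) ^ 2 * U + 2 * cosh (k * t) * sinh (k * t) * (Q / k) + sinh (k * t) ^ 2 * U := by
    rw [hpath, hUe, hQdef]
    simp [dotProduct, Fin.sum_univ_two]
    field_simp
    linear_combination (-sinh (k * t) ^ 2 * (u 0 ^ 2 + u 1 ^ 2)) * hk2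
  rw [abs_le] at hQk
  have h1 : U * exp (-(k * t)) ≤ u ⬝ᵥ (hyperbolicPath p q t *ᵥ u) := by
    rw [e1, ← cosh_sub_sinh]
    nlinarith [mul_nonneg hS (by linarith [hQk.1] : (0 : ℝ) ≤ U + Q / k)]
  have h2 : √((hyperbolicPath p q t *ᵥ u) ⬝ᵥ (hyperbolicPath p q t *ᵥ u)) ≤ √U * exp (k * t) := by
    rw [← sqrt_sq (exp_pos (k * t)).le, ← sqrt_mul hU.le]
    refine sqrt_le_sqrt ?_
    rw [e2, ← cosh_add_sinh]
    nlinarith [mul_nonneg (mul_nonneg hC.le hS) (by linarith [hQk.2] : (0 : ℝ) ≤ U - Q / k)]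
  refine lt_of_lt_of_le ?_ h1
  -- The upper bound `h2` can be multiplied by `cos η` only if that is positive; otherwise the left
  -- side is nonpositive.
  rcases le_or_gt (cos η) 0 with hneg | hpos
  · exact lt_of_le_of_lt (mul_nonpos_of_nonpos_of_nonneg hneg (by positivity)) (by positivity)
  · calc cos η * (√U * √((hyperbolicPath p q t *ᵥ u) ⬝ᵥ (hyperbolicPath p q t *ᵥ u)))
        ≤ cos η * (√U * (√U * exp (k * t))) := by gcongr
      _ = U * (cos η * exp (k * t)) := by
        rw [← mul_assoc (√U), mul_self_sqrt hU.le]; ring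
      _ < U * (exp (-(2 * k * T)) * exp (k * t)) := by gcongr
      _ ≤ U * exp (-(k * t)) := by
        rw [← exp_add]
        gcongr
        nlinarith [mul_le_mul_of_nonneg_left ht.2 hk0.le]

/-- The vector `(p + k, q)` works unless it vanishes, which happens exactly for `q = 0`, `p < 0`;
then `(0, 1)` does. -/
theorem exists_eigenvector {p q : ℝ} (hpq : 0 < p ^ 2 + q ^ 2) : ∃ u : Fin 2 → ℝ, u ≠ 0 ∧
    ![p * u 0 + q * u 1, q * u 0 - p * u 1] = √(p ^ 2 + q ^ 2) • u := by
  set k := √(p ^ 2 + q ^ 2) with hk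
  have hk0 : 0 < k := sqrt_pos.2 hpq
  have hk2 : k ^ 2 = p ^ 2 + q ^ 2 := sq_sqrt hpq.le
  by_cases hq : q = 0 ∧ p < 0
  · refine ⟨![0, 1], by simp, ?_⟩
    have : k = -p := by
      rw [hk, hq.1, zero_pow two_ne_zero, add_zero, sqrt_sq_eq_abs, abs_of_neg hq.2]
    ext i; fin_cases i <;> simp [hq.1, this]
  · refine ⟨![p + k, q], fun h => hq ?_, ?_⟩
    · have h0 := congrFun h 0
      have h1 := congrFun h 1
      simp at h0 h1
      exact ⟨h1, by linarith⟩
    · ext i; fin_cases i <;> simp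
      · linear_combination -hk2
      · ring

/-- For determinant one, `det (A - 1) = 2 - tr A`; the symmetric trace-free part contributes nothing
to the trace after a rotation. -/
theorem det_rotMat_mul_hyperbolicPath_sub_one {p q : ℝ} (hpq : 0 < p ^ 2 + q ^ 2) (α t : ℝ) :
    (rotMat α * hyperbolicPath p q t - 1).det = 2 - 2 * cos α * cosh (√(p ^ 2 + q ^ 2) * t) := by
  have hk2 : √(p ^ 2 + q ^ 2) ^ 2 = p ^ 2 + q ^ 2 := sq_sqrt hpq.le
  have h1 := sin_sq_add_cos_sq α
  have h2 := cosh_sq_sub_sinh_sq (√(p ^ 2 + q ^ 2) * t)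
  rw [hyperbolicPath]
  set k := √(p ^ 2 + q ^ 2) with hk
  have hk0 : k ≠ 0 := (sqrt_pos.2 hpq).ne'
  obtain ⟨D, hD⟩ : ∃ D, sinh (k * t) = D * k := ⟨sinh (k * t) / k, by field_simp⟩
  rw [hD] at h2 ⊢
  rw [mul_div_cancel_right₀ _ hk0]
  generalize cosh (k * t) = C at *
  have e : rotMat α * (C • 1 + D • !![p, q; q, -p]) - 1 =
      !![cos α * (C + D * p) - sin α * (D * q) - 1, cos α * (D * q) - sin α * (C - D * p);
        sin α * (C + D * p) + cos α * (D * q), sin α * (D * q) + cos α * (C - D * p) - 1] := by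
    have e' : C • 1 + D • !![p, q; q, -p] = !![C + D * p, D * q; D * q, C - D * p] := by
      ext i j
      fin_cases i <;> fin_cases j <;> simp [sub_eq_add_neg]
    rw [e']
    ext i j
    fin_cases i <;> fin_cases j <;> simp [rotMat] <;> ring
  rw [e, Matrix.det_fin_two_of]
  rw [mul_pow, hk2] at h2
  linear_combination (C ^ 2 - D ^ 2 * (p ^ 2 + q ^ 2)) * h1 + h2

theorem cos_le_of_floor_margin {n : ℕ} (hn : 0 < n) {θ : ℝ} (m : ℤ) (m1 : (m : ℝ) + 1 / n ≤ θ / π)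
    (m2 : θ / π + 1 / n ≤ m + 1) : cos (2 * θ) ≤ cos (π / n) := by
  have hn' : (0 : ℝ) < n := by exact_mod_cast hn
  have hr : ∀ r, π / n ≤ r → r ≤ π → cos r ≤ cos (π / n) := fun r h1 h2 =>
    cos_le_cos_of_nonneg_of_le_pi (by positivity) h2 h1
  have e : 2 * θ = 2 * π * (θ / π) := by field_simp
  have hd : 2 * π * (1 / n) = π / n + π / n := by ring
  have hp : 0 < π / n := by positivity
  have k1 : 2 * π * (m + 1 / n) ≤ 2 * θ := by rw [e]; gcongr
  have k2 : 2 * θ + 2 * π * (1 / n) ≤ 2 * π * (m + 1) := by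
    rw [e, ← mul_add]; gcongr
  rw [mul_add] at k1
  rw [← cos_sub_int_mul_two_pi _ m]
  rcases le_total (2 * θ - m * (2 * π)) π with h | h
  · exact hr _ (by linarith) h
  · rw [← cos_neg, ← cos_add_two_pi]
    exact hr _ (by linarith) (by linarith)

/-- An eigenvector puts `θ / π`, with `θ = a T / 2`, into the rotation set, and the angle estimate
keeps the set within `1 / (2n)` of it. So an integral `θ / π = k` gives the index `2k`, and a
nonintegral one leaves no room for an integer. -/
theorem hyperbolic_index {M : ℝ → Matrix (Fin 2) (Fin 2) ℝ} {a p q T : ℝ} {n : ℕ} {j : ℤ}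
    (hT : 0 < T) (hn : 0 < n) (hM : ∀ t ∈ Icc 0 T, M t = rotMat (a * t) * hyperbolicPath p q t)
    (hj : n * (a * T / 2) = 2 * π * j) (hpq : 0 < p ^ 2 + q ^ 2)
    (hsmall : cos (π / n) < exp (-(2 * √(p ^ 2 + q ^ 2) * T))) :
    (M T - 1).det ≠ 0 ∧ conleyZehnder M T = expectedIndex (a * T / 2) 0 := by
  have hn' : (1 : ℝ) ≤ n := by exact_mod_cast hn
  set k := √(p ^ 2 + q ^ 2) with hk
  have hk0 : 0 < k := sqrt_pos.2 hpq
  have hk2 : k ^ 2 = p ^ 2 + q ^ 2 := sq_sqrt hpq.le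
  have hpath := hyperbolicPath_mulVec p q
  rw [← hk] at hpath
  have hE0 : hyperbolicPath p q 0 = 1 := by simp [hyperbolicPath]
  have hbound : ∀ Δ ∈ rotationSet M T, |Δ - a * T / 2 / π| < 1 / n / 2 := by
    intro Δ hΔ
    have := abs_sub_lt_of_mem_rotationSet hT.le (by positivity : 0 < π / n) hM hE0
      (fun t ht u hu => hyperbolicPath_angle ht hpq hsmall hu) hΔ
    have e1 : a * T / (2 * π) = a * T / 2 / π := by field_simp
    have e2 : π / n / (2 * π) = 1 / n / 2 := by field_simp
    rwa [e1, e2] at this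
  have hmem : a * T / 2 / π ∈ rotationSet M T := by
    have e1 : a * T / (2 * π) = a * T / 2 / π := by field_simp
    rw [← e1]
    obtain ⟨u, hu, hKu⟩ := exists_eigenvector hpq
    refine mem_rotationSet hM hu fun t _ => ⟨exp (k * t), exp_pos _, ?_⟩
    rw [hpath, hKu, smul_smul, div_mul_cancel₀ _ hk0.ne', ← add_smul, cosh_add_sinh]
  have h1n : (1 : ℝ) / n ≤ 1 := by rw [div_le_one (by positivity)]; exact hn'
  have h0n : (0 : ℝ) < 1 / n := by positivity
  have hdet : (M T - 1).det = 2 - 2 * cos (a * T) * cosh (k * T) := by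
    rw [hM T ⟨hT.le, le_rfl⟩, det_rotMat_mul_hyperbolicPath_sub_one hpq]
  have hcosh : 1 < cosh (k * T) := one_lt_cosh.2 (by positivity)
  by_cases hint : a * T / 2 / π = ⌊a * T / 2 / π⌋
  · constructor
    · have : cos (a * T) = 1 := by
        rw [cos_eq_one_iff]
        refine ⟨⌊a * T / 2 / π⌋, ?_⟩
        rw [← hint]; field_simp
      rw [hdet, this]
      intro h; linarith
    · rw [expectedIndex, if_pos hint, add_zero]
      refine conleyZehnder_eq_two_mul (by rwa [← hint]) fun Δ hΔ => ?_
      rw [← hint]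
      linarith [hbound Δ hΔ]
  · obtain ⟨m1, m2⟩ := floor_margin hn hj hint
    constructor
    · have hcos : cos (a * T) ≤ cos (π / n) := by
        have := cos_le_of_floor_margin hn _ m1 m2
        rwa [mul_div_cancel₀ (a * T) two_ne_zero] at this
      rw [hdet]
      intro h
      have h1 : cos (a * T) * cosh (k * T) = 1 := by linarith
      -- Degeneracy would mean `cos (2θ) = 1 / cosh (kT) ≥ e^{-2kT}`, but `cos (2θ) ≤ cos (π / n) <
      -- e^{-2kT}`.
      have h2 : cosh (k * T) ≤ exp (2 * k * T) := by
        rw [cosh_eq]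
        have : exp (-(k * T)) ≤ exp (k * T) := exp_le_exp.2 (by nlinarith)
        have : exp (k * T) ≤ exp (2 * k * T) := exp_le_exp.2 (by nlinarith)
        linarith
      have h3 : exp (-(2 * k * T)) * exp (2 * k * T) = 1 := by rw [← exp_add]; simp
      have h4 : 0 < cos (a * T) := by
        by_contra! hneg
        nlinarith
      nlinarith [exp_pos (2 * k * T)]
    · rw [expectedIndex, if_neg hint]
      refine conleyZehnder_eq_two_mul_add_one (lo := a * T / 2 / π - 1 / n / 2)
        (hi := a * T / 2 / π + 1 / n / 2) ⟨_, hmem⟩ (by linarith) (by linarith) fun Δ hΔ => ?_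
      have := abs_lt.1 (hbound Δ hΔ)
      constructor <;> linarith

end Rotation

/-! ### The index of an orbit over a critical point, and Hessians in the frame -/

section CriticalIndex

variable {f : (Fin 3 → ℝ) → ℝ} {ε : ℝ}

/-- The Hessian of the pullback of `f` at `z` is that of a nondegenerate maximum (`s = 1`), minimum
(`s = -1`) or saddle (`s = 0`) that is isotropic, respectively trace-free, and at most `4`. -/
def HessType (f : (Fin 3 → ℝ) → ℝ) (z : ℂ × ℂ) (s : ℤ) : Prop :=
  (∃ a : ℝ, 0 < a ∧ a ≤ 4 ∧ (s = 1 ∨ s = -1) ∧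
    frameHess f 0 0 z = -(a * s) ∧ frameHess f 0 1 z = 0 ∧
    frameHess f 1 0 z = 0 ∧ frameHess f 1 1 z = -(a * s)) ∨
  (s = 0 ∧ ∃ p q : ℝ, p ^ 2 + q ^ 2 = 1 ∧
    frameHess f 0 0 z = p ∧ frameHess f 0 1 z = q ∧ frameHess f 1 0 z = q ∧ frameHess f 1 1 z = -p)

theorem hasDerivAt_rotMat (c t : ℝ) (i j : Fin 2) :
    HasDerivAt (fun t => rotMat (c * t) i j) ((c • !![0, -1; 1, 0] * rotMat (c * t) : Matrix (Fin 2) (Fin 2) ℝ) i j) t := by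
  have h : HasDerivAt (fun t => c * t) c t := by simpa using (hasDerivAt_id t).const_mul c
  fin_cases i <;> fin_cases j
  · exact h.cos.congr_deriv (by simp [rotMat]; ring)
  · exact h.sin.neg.congr_deriv (by simp [rotMat]; ring)
  · exact h.sin.congr_deriv (by simp [rotMat]; ring)
  · exact h.cos.congr_deriv (by simp [rotMat]; ring)

theorem hasDerivAt_hyperbolicPath {p q : ℝ} (hpq : 0 < p ^ 2 + q ^ 2) (t : ℝ) (i j : Fin 2) :
    HasDerivAt (fun t => hyperbolicPath p q t i j)
      ((!![p, q; q, -p] * hyperbolicPath p q t) i j) t := by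
  have hk2 : √(p ^ 2 + q ^ 2) ^ 2 = p ^ 2 + q ^ 2 := Real.sq_sqrt hpq.le
  have hk0 : √(p ^ 2 + q ^ 2) ≠ 0 := (Real.sqrt_pos.2 hpq).ne'
  simp only [hyperbolicPath]
  generalize √(p ^ 2 + q ^ 2) = k at hk2 hk0
  have h : HasDerivAt (fun t => k * t) k t := by simpa using (hasDerivAt_id t).const_mul k
  have hc := h.cosh
  have hs := h.sinh.div_const k
  have key : ∀ x y : ℝ, HasDerivAt (fun t => Real.cosh (k * t) * x + Real.sinh (k * t) / k * y)
      (Real.sinh (k * t) * k * x + Real.cosh (k * t) * y) t := fun x y =>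
    ((hc.mul_const x).add (hs.mul_const y)).congr_deriv (by field_simp)
  have hS : Real.sinh (k * t) * k = Real.sinh (k * t) / k * (p ^ 2 + q ^ 2) := by
    rw [← hk2]; field_simp
  have e' : ∀ C D : ℝ, C • (1 : Matrix (Fin 2) (Fin 2) ℝ) + D • !![p, q; q, -p] =
      !![C + D * p, D * q; D * q, C - D * p] := by
    intro C D
    ext i j
    fin_cases i <;> fin_cases j <;> simp [sub_eq_add_neg]
  refine (key ((1 : Matrix (Fin 2) (Fin 2) ℝ) i j) (!![p, q; q, -p] i j)).congr_deriv ?_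
  rw [e', hS]
  fin_cases i <;> fin_cases j <;> simp <;> ring

/-- For an extremum the generator is a multiple of the quarter turn, with the sign of `s`; for a
saddle it is symmetric and trace-free. These are the elliptic and the hyperbolic path, with `a = 2 /
h` in both cases. -/
theorem critical_index (hf : ContDiff ℝ ∞ f) (hpos : ∀ z : S3, 1 / 2 ≤ factor f ε z.1) (hε : 0 < ε)
    {z : S3} (hz : IsCritical f (hopf z)) {s : ℤ} (hs : HessType f z.1 s) {T : ℝ} (hT : 0 < T)
    {n : ℕ} (hn : 0 < n) {j : ℤ} (hj : n * (T / factor f ε z.1) = 2 * Real.pi * j)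
    (hsmall : 8 * ε * T < Real.pi / n) (hsmall' : 4 * ε * T < 1 - Real.cos (Real.pi / n)) :
    (linearizedFlow f ε z T - 1).det ≠ 0 ∧
      conleyZehnder (linearizedFlow f ε z) T = expectedIndex (T / factor f ε z.1) s := by
  have hpos' : ∀ z : S3, 0 < factor f ε z.1 := fun z => by linarith [hpos z]
  have hh := hpos z
  have hh0 := hpos' z
  have hgen : generator f ε z.1 = (ε / (2 * factor f ε z.1 ^ 2)) •
      !![frameHess f 1 0 z.1, frameHess f 1 1 z.1; -frameHess f 0 0 z.1, -frameHess f 0 1 z.1] := rfl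
  have hlin := fun M hM hM0 t (ht : 0 ≤ t) => linearizedFlow_critical hf hpos' hz (M := M) hM hM0 ht
  set h := factor f ε z.1 with hh_def
  set κ := ε / (2 * h ^ 2) with hκ
  have hκ0 : 0 < κ := by positivity
  have hκ1 : κ ≤ 2 * ε := by
    rw [hκ, div_le_iff₀ (by positivity)]
    nlinarith [mul_nonneg hε.le (sub_nonneg.2 hh)]
  have hθ : 2 / h * T / 2 = T / h := by field_simp
  rw [← hθ] at hj ⊢
  rcases hs with ⟨a, ha0, ha4, hs, h00, h01, h10, h11⟩ | ⟨rfl, p, q, hpq, h00, h01, h10, h11⟩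
  · have hgen' : generator f ε z.1 = (κ * a * s) • !![0, -1; 1, 0] := by
      rw [hgen, h00, h01, h10, h11]
      ext i j
      fin_cases i <;> fin_cases j <;> simp <;> ring
    have hM := hlin (fun t => rotMat (κ * a * s * t)) (fun t i j => by
      rw [hgen']; exact hasDerivAt_rotMat _ t i j) (by
        ext i j; fin_cases i <;> fin_cases j <;> simp [rotMat])
    refine elliptic_index (c := κ * a * s) hT hn (fun t ht => ?_) hj ?_ ?_
    · rw [hM t ht.1]
      congr 2
      ring
    · rcases hs with rfl | rfl
      · left; simp; positivity
      · right; simp; positivity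
    · have : |κ * a * s| = κ * a := by
        rcases hs with rfl | rfl
        · simp [abs_of_pos hκ0, abs_of_pos ha0]
        · simp [abs_of_pos hκ0, abs_of_pos ha0]
      rw [this]
      refine lt_of_le_of_lt ?_ hsmall
      calc κ * a * T ≤ 2 * ε * 4 * T := by gcongr
        _ = 8 * ε * T := by ring
  -- Composing with the quarter turn exchanges the roles of the entries: the path has parameters
  -- `κq` and `-κp`, of norm `κ`.
  · have hgen' : generator f ε z.1 = !![κ * q, -(κ * p); -(κ * p), -(κ * q)] := by
      rw [hgen, h00, h01, h10, h11]
      ext i j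
      fin_cases i <;> fin_cases j <;> simp
    have hsum : (κ * q) ^ 2 + (-(κ * p)) ^ 2 = κ ^ 2 := by
      linear_combination κ ^ 2 * hpq
    have hM := hlin (hyperbolicPath (κ * q) (-(κ * p))) (fun t i j => by
      rw [hgen']
      exact hasDerivAt_hyperbolicPath (by rw [hsum]; positivity) t i j) (by simp [hyperbolicPath])
    refine hyperbolic_index (p := κ * q) (q := -(κ * p)) hT hn (fun t ht => ?_) hj
      (by rw [hsum]; positivity) ?_
    · rw [hM t ht.1]
      congr 2
      ring
    · rw [hsum, Real.sqrt_sq hκ0.le]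
      -- As `κ ≤ 2ε`, one has `e^{-2κT} ≥ 1 - 4εT > cos (π / n)`.
      have h1 := Real.add_one_le_exp (-(2 * κ * T))
      nlinarith

/-! ### Hessians from normal forms -/

theorem hasDerivAt_greatCircle (i : Fin 2) (z : S3) :
    HasDerivAt (fun s => (greatCircle i z s).1) (frame i z.1) 0 := by
  have h := ((Real.hasDerivAt_cos 0).smul_const z.1).add
    ((Real.hasDerivAt_sin 0).smul_const (frame i z.1))
  exact h.congr_deriv (by simp)

/-- Frame vectors are velocities of great circles, so an identity valid only on `S³` may be
differentiated along them. -/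
theorem fderiv_frame_eq_zero {u : ℂ × ℂ → ℝ} {z : S3} (hu : DifferentiableAt ℝ u z.1)
    (h0 : ∀ᶠ w in 𝓝 z.1, normSq₂ w = 1 → u w = 0) (i : Fin 2) :
    fderiv ℝ u z.1 (frame i z.1) = 0 := by
  have hg := hasDerivAt_greatCircle i z
  have hg0 : (greatCircle i z 0).1 = z.1 := by simp [greatCircle]
  have h1 := hu.hasFDerivAt.comp_hasDerivAt_of_eq 0 hg hg0.symm
  have h2 : ∀ᶠ s in 𝓝 (0 : ℝ), u (greatCircle i z s).1 = 0 := by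
    have hc : Filter.Tendsto (fun s => (greatCircle i z s).1) (𝓝 0) (𝓝 z.1) := by
      have := hg.continuousAt.tendsto
      rwa [hg0] at this
    filter_upwards [hc.eventually h0] with s hs
    exact hs (greatCircle i z s).2
  exact h1.unique ((hasDerivAt_const (0 : ℝ) (0 : ℝ)).congr_of_eventuallyEq h2)

/-- Onto the unit sphere `S²`, the Hopf map doubles the lengths of horizontal vectors. -/
theorem hopfDeriv_frame_dotProduct {z : ℂ × ℂ} (hz : normSq₂ z = 1) :
    hopfDeriv z (frame 0 z) ⬝ᵥ hopfDeriv z (frame 0 z) = 4 ∧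
    hopfDeriv z (frame 0 z) ⬝ᵥ hopfDeriv z (frame 1 z) = 0 ∧
    hopfDeriv z (frame 1 z) ⬝ᵥ hopfDeriv z (frame 1 z) = 4 := by
  simp only [normSq₂, Complex.normSq_apply] at hz
  obtain ⟨⟨a, b⟩, ⟨c, d⟩⟩ := z
  simp only at hz
  refine ⟨?_, ?_, ?_⟩ <;> simp [hopfDeriv, frame, dotProduct, Fin.sum_univ_three]
  · linear_combination 4 * (a * a + b * b + (c * c + d * d) + 1) * hz
  · ring
  · linear_combination 4 * (a * a + b * b + (c * c + d * d) + 1) * hz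

/-- The function `f` is `s + (a y₁² + b y₂²) / (1 + y₃)ᵏ` near `p` on `S²`, in the coordinates of an
oriented orthonormal frame whose third vector is `p`. -/
def HasQuadraticForm (f : (Fin 3 → ℝ) → ℝ) (p : Fin 3 → ℝ) (s a b : ℝ) (k : ℕ) : Prop :=
  ∃ R : SO3, R.1 *ᵥ ![0, 0, 1] = p ∧ ∀ᶠ y in 𝓝 (![0, 0, 1] : Fin 3 → ℝ), y ⬝ᵥ y = 1 →
    (f (R.1 *ᵥ y) - s) * (1 + y 2) ^ k = a * y 0 ^ 2 + b * y 1 ^ 2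

/-- The defining identity of the quadratic form is pulled back to `S³` and differentiated twice
along the frame. At `z` the coordinates are `(0, 0, 1)`, so only the Hessian times `2 ^ k` and
products of first derivatives of `y₀`, `y₁` remain. -/
theorem frameHess_of_hasQuadraticForm (hf : ContDiff ℝ ∞ f) {z : S3} (hz : IsCritical f (hopf z))
    {s a b : ℝ} {k : ℕ} (h : HasQuadraticForm f (hopf z).1 s a b k) :
    ∃ N : Matrix (Fin 2) (Fin 2) ℝ, N * Nᵀ = (4 : ℝ) • 1 ∧ ∀ i j,
      2 ^ k * frameHess f i j z.1 = 2 * a * N i 0 * N j 0 + 2 * b * N i 1 * N j 1 := by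
  obtain ⟨R, hRp, hR⟩ := h
  have hRR : R.1 * R.1ᵀ = 1 :=
    (Matrix.mem_orthogonalGroup_iff _ _).1 (Matrix.mem_specialOrthogonalGroup_iff.1 R.2).1
  have hRR' : R.1ᵀ * R.1 = 1 :=
    (Matrix.mem_orthogonalGroup_iff' _ _).1 (Matrix.mem_specialOrthogonalGroup_iff.1 R.2).1
  set y : ℂ × ℂ → Fin 3 → ℝ := fun w => R.1ᵀ *ᵥ hopfVec w with hy
  set ν : Fin 2 → ℂ × ℂ → Fin 3 → ℝ := fun i w => R.1ᵀ *ᵥ hopfDeriv w (frame i w) with hν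
  have hy0 : y z.1 = ![0, 0, 1] := by
    have h1 : hopfVec z.1 = R.1 *ᵥ ![0, 0, 1] := hRp.symm
    rw [hy]; simp only [h1, Matrix.mulVec_mulVec, hRR', Matrix.one_mulVec]
  have hysm : ∀ l, ContDiff ℝ ∞ (fun w => y w l) := fun l =>
    contDiff_pi.1 ((Matrix.mulVecLin R.1ᵀ).toContinuousLinearMap.contDiff.comp contDiff_hopfVec) l
  have hyd : ∀ w l i, fderiv ℝ (fun w => y w l) w (frame i w) = ν i w l := by
    intro w l i
    have h1 := (Matrix.mulVecLin R.1ᵀ).toContinuousLinearMap.hasFDerivAt.comp w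
      (contDiff_hopfVec.differentiable (by simp) w).hasFDerivAt
    have h2 := hasFDerivAt_pi'.1 h1 l
    have h3 : HasFDerivAt (fun w => y w l) _ w := h2
    rw [h3.fderiv]
    simp [hν, fderiv_hopfVec, Matrix.mulVec_transpose]
  have hdot : ∀ u v : Fin 3 → ℝ, (R.1ᵀ *ᵥ u) ⬝ᵥ (R.1ᵀ *ᵥ v) = u ⬝ᵥ v := by
    intro u v
    rw [Matrix.dotProduct_mulVec, Matrix.vecMul_transpose, Matrix.mulVec_mulVec, hRR, Matrix.one_mulVec]
  -- the relation between `f` and the quadratic form on `S³` near `z`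
  set u : ℂ × ℂ → ℝ := fun w => (pull f w - s) * (1 + y w 2) ^ k -
    (a * y w 0 ^ 2 + b * y w 1 ^ 2) with hu
  have hpull := contDiff_pull hf
  have husm : ContDiff ℝ ∞ u := by
    have := hysm 0; have := hysm 1; have := hysm 2
    rw [hu]; fun_prop
  have hu0 : ∀ᶠ w in 𝓝 z.1, normSq₂ w = 1 → u w = 0 := by
    have hyc : Filter.Tendsto y (𝓝 z.1) (𝓝 ![0, 0, 1]) := by
      rw [← hy0]
      exact (contDiff_pi.2 hysm).continuous.tendsto _
    filter_upwards [hyc.eventually hR] with w hw hw1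
    have h1 : R.1 *ᵥ y w = hopfVec w := by
      simp only [hy, Matrix.mulVec_mulVec, hRR, Matrix.one_mulVec]
    have h2 := hw (by
      simp only [hy, hdot]
      exact (hopf ⟨w, hw1⟩).2)
    rw [h1] at h2
    simp only [hu, pull]
    linarith
  set g : Fin 2 → ℂ × ℂ → ℝ := fun i w => fderiv ℝ u w (frame i w) with hg
  have hgsm : ∀ i, ContDiff ℝ ∞ (g i) := fun i =>
    (husm.fderiv_right (m := ∞) (by simp)).clm_apply (contDiff_frame i)
  -- The first frame derivatives vanish at all nearby points of `S³`, not only at `z`; this permits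
  -- the second differentiation.
  have hg0 : ∀ i, ∀ᶠ w in 𝓝 z.1, normSq₂ w = 1 → g i w = 0 := by
    intro i
    filter_upwards [hu0.eventually_nhds] with w hw hw1
    exact fderiv_frame_eq_zero (z := ⟨w, hw1⟩) (husm.differentiable (by simp) w) hw i
  have hgform : ∀ i w, g i w = frameDeriv f i w * (1 + y w 2) ^ k +
      (pull f w - s) * fderiv ℝ (fun w => (1 + y w 2) ^ k) w (frame i w) -
      (2 * a * y w 0 * ν i w 0 + 2 * b * y w 1 * ν i w 1) := by
    intro i w
    have hl := fun {φ : ℂ × ℂ → ℝ} (hφ : ContDiff ℝ ∞ φ) =>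
      hasDerivAt_comp_line (hφ.differentiable (by simp) w) (frame i w)
    have k1 := hl husm
    have kF := hl hpull
    have kP := hl ((contDiff_const.add (hysm 2)).pow k : ContDiff ℝ ∞ (fun w => (1 + y w 2) ^ k))
    have k0 := hl (hysm 0)
    have k1' := hl (hysm 1)
    rw [hyd] at k0 k1'
    have h2 := ((kF.sub_const s).mul kP).sub
      (((k0.pow 2).const_mul a).add ((k1'.pow 2).const_mul b))
    have h3 := k1.unique h2
    simp only [hg, h3]
    simp [frameDeriv]
    ring
  refine ⟨Matrix.of fun i l => ν i z.1 l.castSucc, ?_, fun i j => ?_⟩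
  -- The derivative of the Hopf map is tangent to `S²` at `(0, 0, 1)`, so the two remaining
  -- components carry all of its length.
  · have hν2 : ∀ i, ν i z.1 2 = 0 := by
      intro i
      have h1 : y z.1 ⬝ᵥ ν i z.1 = 0 := by
        simp only [hy, hν, hdot, hopfVec_dotProduct_hopfDeriv, realInner_frame, mul_zero]
      rw [hy0] at h1
      simpa [dotProduct, Fin.sum_univ_three] using h1
    obtain ⟨d0, d1, d2⟩ := hopfDeriv_frame_dotProduct (z := z.1) z.2
    rw [← hdot] at d0 d1 d2
    change ν 0 z.1 ⬝ᵥ ν 0 z.1 = 4 at d0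
    change ν 0 z.1 ⬝ᵥ ν 1 z.1 = 0 at d1
    change ν 1 z.1 ⬝ᵥ ν 1 z.1 = 4 at d2
    simp only [dotProduct, Fin.sum_univ_three, hν2] at d0 d1 d2
    ext i j
    fin_cases i <;> fin_cases j <;> simp [Matrix.mul_apply, Fin.sum_univ_two] <;> linarith
  · have hl := fun {φ : ℂ × ℂ → ℝ} (hφ : DifferentiableAt ℝ φ z.1) =>
      hasDerivAt_comp_line hφ (frame j z.1)
    have hνd : ∀ l, DifferentiableAt ℝ (fun w => ν i w l) z.1 := by
      intro l
      have e : (fun w => ν i w l) = fun w => fderiv ℝ (fun w => y w l) w (frame i w) := by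
        funext w; rw [hyd]
      rw [e]
      exact (((hysm l).fderiv_right (m := ∞) (by simp)).clm_apply (contDiff_frame i)).differentiable
        (by simp) _
    have hPsm : ContDiff ℝ ∞ (fun w => (1 + y w 2) ^ k) := (contDiff_const.add (hysm 2)).pow k
    have hPd : DifferentiableAt ℝ (fun w => fderiv ℝ (fun w => (1 + y w 2) ^ k) w (frame i w)) z.1 :=
      ((hPsm.fderiv_right (m := ∞) (by simp)).clm_apply (contDiff_frame i)).differentiable (by simp) _
    have k0 := hl ((hysm 0).differentiable (by simp) _)
    have k1 := hl ((hysm 1).differentiable (by simp) _)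
    rw [hyd] at k0 k1
    have kg := hl ((hgsm i).differentiable (by simp) _)
    rw [fderiv_frame_eq_zero ((hgsm i).differentiable (by simp) _) (hg0 i)] at kg
    have kF := hl (hpull.differentiable (by simp) _)
    have hF0 : fderiv ℝ (pull f) z.1 (frame j z.1) = 0 := frameDeriv_eq_zero hf hz j
    rw [hF0] at kF
    have h2 := (((hl ((contDiff_frameDeriv hf i).differentiable (by simp) _)).mul
      (hl (hPsm.differentiable (by simp) _))).add ((kF.sub_const s).mul (hl hPd))).sub
      (((k0.const_mul (2 * a)).mul (hl (hνd 0))).add ((k1.const_mul (2 * b)).mul (hl (hνd 1))))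
    have h3 := kg.unique (h2.congr_of_eventuallyEq (Filter.Eventually.of_forall fun s => hgform i _))
    have hs : pull f z.1 = s := by
      have h4 := hu0.self_of_nhds z.2
      simp only [hu, hy0] at h4
      simp at h4
      linarith
    simp only [zero_smul, add_zero, hy0, frameDeriv_eq_zero hf hz, hs] at h3
    simp at h3
    rw [show frameHess f i j z.1 = fderiv ℝ (frameDeriv f i) z.1 (frame j z.1) from rfl]
    simp
    norm_num at h3
    linarith

end CriticalIndex

/-! ### Extrema and saddles from quadratic forms -/

section HessianTypes

variable {f : (Fin 3 → ℝ) → ℝ}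

/-- With equal coefficients the Hessian is a multiple of `N Nᵀ = 4`, which is insensitive to the
position of the frame; the hypothesis `ha'` is the bound `4` of `HessType`. -/
theorem hessType_elliptic (hf : ContDiff ℝ ∞ f) {z : S3} (hz : IsCritical f (hopf z)) {s : ℤ}
    (hs : s = 1 ∨ s = -1) {a : ℝ} {k : ℕ} (ha : 0 < a) (ha' : 8 * a ≤ 4 * 2 ^ k)
    (h : HasQuadraticForm f (hopf z).1 s (-(a * s)) (-(a * s)) k) : HessType f z.1 s := by
  obtain ⟨N, hN, hH⟩ := frameHess_of_hasQuadraticForm hf hz h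
  have h2 : (0 : ℝ) < 2 ^ k := by positivity
  have hNe : ∀ i j, N i 0 * N j 0 + N i 1 * N j 1 = if i = j then 4 else 0 := by
    intro i j
    have := congrFun (congrFun hN i) j
    simpa [Matrix.mul_apply, Fin.sum_univ_two, Matrix.one_apply] using this
  have key : ∀ i j, frameHess f i j z.1 = -((8 * a / 2 ^ k) * s) * if i = j then 1 else 0 := by
    intro i j
    have e : 2 ^ k * frameHess f i j z.1 = -(2 * a * s) * (if i = j then 4 else 0) := by
      rw [hH, ← hNe]; ring
    rw [← mul_right_inj' h2.ne', e]
    field_simp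
    split_ifs <;> ring
  refine Or.inl ⟨8 * a / 2 ^ k, by positivity, by rw [div_le_iff₀ h2]; exact ha', hs, ?_, ?_, ?_, ?_⟩ <;>
    rw [key] <;> simp

/-- The Hessian is `diag(-1, 1)` conjugated by the orthogonal matrix `N / 2`, so it is symmetric,
trace-free and of determinant `-1`. -/
theorem hessType_saddle (hf : ContDiff ℝ ∞ f) {z : S3} (hz : IsCritical f (hopf z))
    (h : HasQuadraticForm f (hopf z).1 0 (-(1 / 2)) (1 / 2) 2) : HessType f z.1 0 := by
  obtain ⟨N, hN, hH⟩ := frameHess_of_hasQuadraticForm hf hz h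
  have hN' : Nᵀ * N = (4 : ℝ) • 1 := by
    have h1 : ((1 / 4 : ℝ) • Nᵀ) * N = 1 := by
      apply mul_eq_one_comm.1
      rw [Matrix.mul_smul, hN, smul_smul]
      norm_num
    calc Nᵀ * N = (4 : ℝ) • (((1 / 4 : ℝ) • Nᵀ) * N) := by rw [Matrix.smul_mul, smul_smul]; norm_num
      _ = _ := by rw [h1]
  have e00 := congrFun (congrFun hN' 0) 0
  have e01 := congrFun (congrFun hN' 0) 1
  have e11 := congrFun (congrFun hN' 1) 1
  have d00 := congrFun (congrFun hN 0) 0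
  have d01 := congrFun (congrFun hN 0) 1
  simp [Matrix.mul_apply, Fin.sum_univ_two] at e00 e01 e11 d00 d01
  have h00 := hH 0 0
  have h01 := hH 0 1
  have h10 := hH 1 0
  have h11 := hH 1 1
  norm_num at h00 h01 h10 h11
  refine Or.inr ⟨rfl, frameHess f 0 0 z.1, frameHess f 0 1 z.1, ?_, rfl, rfl, ?_, ?_⟩
  · have e1 : frameHess f 0 0 z.1 = (N 0 1 * N 0 1 - N 0 0 * N 0 0) / 4 := by linarith
    have e2 : frameHess f 0 1 z.1 = (N 0 1 * N 1 1 - N 0 0 * N 1 0) / 4 := by linarith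
    have d11 := congrFun (congrFun hN 1) 1
    simp [Matrix.mul_apply, Fin.sum_univ_two] at d11
    rw [e1, e2]
    have k1 : N 0 1 * N 1 1 = -(N 0 0 * N 1 0) := by linarith
    have k2 : (N 0 1 * N 1 1) ^ 2 = (N 0 0 * N 1 0) ^ 2 := by rw [k1]; ring
    have k3 : N 1 0 * N 1 0 = N 0 1 * N 0 1 := by linarith
    rw [k1]
    have : (N 0 0 * N 1 0) ^ 2 = (N 0 0 * N 0 0) * (N 0 1 * N 0 1) := by rw [← k3]; ring
    have k4 : N 0 1 * N 0 1 = 4 - N 0 0 * N 0 0 := by linarith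
    linear_combination (1 / 4 : ℝ) * this + (1 / 16 : ℝ) * (N 0 1 * N 0 1 + 4 + N 0 0 * N 0 0) * k4
  · linarith
  · linarith

end HessianTypes

section Algebra

/-! ### The action of `SU(2)` on fibres -/

theorem SU2.smul_val (g : SU2) (z : S3) : (g • z).1 =
    (g.1 0 0 * z.1.1 - conj (g.1 1 0) * z.1.2, g.1 1 0 * z.1.1 + conj (g.1 0 0) * z.1.2) := by
  change (g.1 0 0 * z.1.1 + g.1 0 1 * z.1.2, g.1 1 0 * z.1.1 + g.1 1 1 * z.1.2) = _
  rw [SU2.apply_zero_one, SU2.apply_one_one]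
  ring_nf

theorem SU2.ext_col {g h : SU2} (h0 : g.1 0 0 = h.1 0 0) (h1 : g.1 1 0 = h.1 1 0) : g = h := by
  apply Subtype.ext
  ext i j
  fin_cases i <;> fin_cases j
  · exact h0
  · change g.1 0 1 = h.1 0 1
    rw [SU2.apply_zero_one, SU2.apply_zero_one, h1]
  · exact h1
  · change g.1 1 1 = h.1 1 1
    rw [SU2.apply_one_one, SU2.apply_one_one, h0]

theorem S3.mul_conj_add (z : S3) : z.1.1 * conj z.1.1 + z.1.2 * conj z.1.2 = 1 := by
  rw [Complex.mul_conj, Complex.mul_conj, ← Complex.ofReal_add, z.2, Complex.ofReal_one]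

/-- Identifying `S³` with `SU(2)`, this is `g = (gz) z⁻¹`; in particular the action is free. -/
theorem SU2.col_eq (g : SU2) (z : S3) :
    g.1 0 0 = (g • z).1.1 * conj z.1.1 + conj (g • z).1.2 * z.1.2 ∧
    g.1 1 0 = (g • z).1.2 * conj z.1.1 - conj (g • z).1.1 * z.1.2 := by
  have hz := z.mul_conj_add
  rw [SU2.smul_val]
  simp only [map_add, map_sub, map_mul, Complex.conj_conj]
  constructor
  · linear_combination -g.1 0 0 * hz
  · linear_combination -g.1 1 0 * hz

theorem SU2.eq_of_smul_eq {g h : SU2} {z : S3} (e : g • z = h • z) : g = h := by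
  refine SU2.ext_col ?_ ?_
  · rw [(SU2.col_eq g z).1, (SU2.col_eq h z).1, e]
  · rw [(SU2.col_eq g z).2, (SU2.col_eq h z).2, e]

theorem smul_rot (g : SU2) (z : S3) (τ : ℝ) : g • z.rot τ = (g • z).rot τ := by
  apply Subtype.ext
  have e : (g • z.rot τ).1 = _ := SU2.smul_val g (z.rot τ)
  refine e.trans ?_
  change _ = Complex.exp (τ * Complex.I) • (g • z).1
  have e' : (g • z).1 = _ := SU2.smul_val g z
  refine Eq.trans ?_ (congrArg (Complex.exp (τ * Complex.I) • ·) e').symm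
  refine Prod.ext ?_ ?_ <;> simp [S3.rot] <;> ring

/-- An element of `SU(2)` that acts on the fibre of `z` as the rotation by `θ` is determined by `θ` and
the Hopf image of `z`. -/
theorem col_of_smul_eq_rot {g : SU2} {z : S3} {θ : ℝ} (e : g • z = z.rot θ) :
    (g.1 0 0).re = Real.cos θ ∧ (g.1 0 0).im = Real.sin θ * (hopf z).1 0 ∧
    (g.1 1 0).re = Real.sin θ * (hopf z).1 1 ∧ (g.1 1 0).im = -(Real.sin θ * (hopf z).1 2) := by
  obtain ⟨h0, h1⟩ := SU2.col_eq g z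
  have hz := z.2
  rw [Complex.normSq_apply, Complex.normSq_apply] at hz
  rw [e] at h0 h1
  have hre : (Complex.exp (θ * Complex.I)).re = Real.cos θ := Complex.exp_ofReal_mul_I_re θ
  have him : (Complex.exp (θ * Complex.I)).im = Real.sin θ := Complex.exp_ofReal_mul_I_im θ
  simp only [S3.rot, Prod.smul_fst, Prod.smul_snd, smul_eq_mul] at h0 h1
  rw [h0, h1]
  simp only [hopf, hopfVec, Complex.normSq_apply]
  simp [hre, him]
  refine ⟨?_, ?_, ?_, ?_⟩
  · linear_combination Real.cos θ * hz
  · ring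
  · ring
  · ring

/-- If `sin θ ≠ 0`, the eigenvalues `e^{±iθ}` of `g` are distinct, so the eigenline for `e^{iθ}`, a
point of `S²`, is unique. -/
theorem hopf_eq_of_smul_eq_rot {g : SU2} {z z' : S3} {θ : ℝ} (h : g • z = z.rot θ)
    (h' : g • z' = z'.rot θ) (hθ : Real.sin θ ≠ 0) : hopf z = hopf z' := by
  obtain ⟨-, a0, a1, a2⟩ := col_of_smul_eq_rot h
  obtain ⟨-, b0, b1, b2⟩ := col_of_smul_eq_rot h'
  apply Subtype.ext
  ext i
  apply mul_left_cancel₀ hθ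
  fin_cases i
  · exact a0.symm.trans b0
  · exact a1.symm.trans b1
  · exact neg_injective (a2.symm.trans b2)

theorem exists_rot_of_hopf_eq {z z' : S3} (h : hopf z = hopf z') : ∃ τ, z' = z.rot τ := by
  have hv : hopfVec z.1 = hopfVec z'.1 := congrArg Subtype.val h
  have h0 := congrFun hv 0
  have h1 := congrFun hv 1
  have h2 := congrFun hv 2
  simp only [hopfVec, Matrix.cons_val_zero, Matrix.cons_val_one, Matrix.cons_val_two,
    Matrix.tail_cons, Matrix.head_cons] at h0 h1 h2
  have hz := z.2
  have hz' := z'.2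
  have n1 : Complex.normSq z'.1.1 = Complex.normSq z.1.1 := by linarith
  have n2 : Complex.normSq z'.1.2 = Complex.normSq z.1.2 := by linarith
  have n1' : z'.1.1 * conj z'.1.1 = z.1.1 * conj z.1.1 := by
    rw [Complex.mul_conj, Complex.mul_conj, n1]
  have n2' : z'.1.2 * conj z'.1.2 = z.1.2 * conj z.1.2 := by
    rw [Complex.mul_conj, Complex.mul_conj, n2]
  have m : conj z'.1.1 * z'.1.2 = conj z.1.1 * z.1.2 := by
    apply Complex.ext <;> linarith
  have m' : z'.1.1 * conj z'.1.2 = z.1.1 * conj z.1.2 := by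
    have := congrArg (starRingEnd ℂ) m
    simpa using this
  have one := z.mul_conj_add
  -- The only candidate for the phase is the Hermitian product of `z` and `z'`.
  set c := conj z.1.1 * z'.1.1 + conj z.1.2 * z'.1.2 with hc
  have e1 : z'.1.1 = c * z.1.1 := by
    rw [hc]; linear_combination (-z'.1.1) * one - z'.1.1 * n2' + z'.1.2 * m'
  have e2 : z'.1.2 = c * z.1.2 := by
    rw [hc]; linear_combination (-z'.1.2) * one - z'.1.2 * n1' + z'.1.1 * m
  have hcn : Complex.normSq c = 1 := by
    rw [e1, e2, Complex.normSq_mul, Complex.normSq_mul, ← mul_add, hz, mul_one] at hz'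
    exact hz'
  refine ⟨Complex.arg c, Subtype.ext ?_⟩
  have hcexp : Complex.exp (Complex.arg c * Complex.I) = c := by
    have hn : ‖c‖ = 1 := by
      rw [Complex.normSq_eq_norm_sq] at hcn
      nlinarith [norm_nonneg c]
    have := Complex.norm_mul_exp_arg_mul_I c
    rwa [hn, Complex.ofReal_one, one_mul] at this
  simp only [S3.rot, hcexp]
  exact Prod.ext e1 e2

theorem exp_eq_one_of_rot_eq {z : S3} {τ : ℝ} (h : z.rot τ = z) :
    ∃ j : ℤ, τ = 2 * Real.pi * j := by
  obtain ⟨h1, h2⟩ := Prod.ext_iff.1 (congrArg Subtype.val h)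
  simp only [S3.rot, Prod.smul_fst, Prod.smul_snd, smul_eq_mul] at h1 h2
  have h3 : Complex.exp (τ * Complex.I) = 1 := by
    have hz := z.mul_conj_add
    linear_combination (Complex.exp (τ * Complex.I) - 1) * (-hz) + conj z.1.1 * h1 + conj z.1.2 * h2
  obtain ⟨j, hj⟩ := Complex.exp_eq_one_iff.1 h3
  refine ⟨j, ?_⟩
  have h4 := congrArg Complex.im hj
  simp at h4
  linarith

theorem pow_smul_rot {g : SU2} {z : S3} {θ : ℝ} (e : g • z = z.rot θ) (m : ℕ) :
    g ^ m • z = z.rot (m * θ) := by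
  induction m with
  | zero => simp [S3.rot_zero]
  | succ m ih =>
    rw [pow_succ, mul_smul, e, smul_rot, ih, S3.rot_rot]
    congr 1
    push_cast
    ring

variable {G : Subgroup SU2}

/-- From `g ^ |G| = 1` follows `e^{i|G|θ} = 1`. This quantization of angles provides all the gaps
used below. -/
theorem exists_card_mul_eq [Finite G] {g : SU2} (hg : g ∈ G) {z : S3} {θ : ℝ}
    (e : g • z = z.rot θ) : ∃ j : ℤ, Nat.card G * θ = 2 * Real.pi * j := by
  have h1 : g ^ Nat.card G = 1 := by
    exact congrArg Subtype.val (pow_card_eq_one' (x := (⟨g, hg⟩ : G)))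
  refine exp_eq_one_of_rot_eq (z := z) ?_
  rw [← pow_smul_rot e, h1, one_smul]

/-- The group of angles by which elements of `G` rotate the fibre through `z`. -/
def fibreAngles (G : Subgroup SU2) (z : S3) : AddSubgroup ℝ where
  carrier := {τ | ∃ g ∈ G, g • z = z.rot τ}
  zero_mem' := ⟨1, G.one_mem, by rw [one_smul, S3.rot_zero]⟩
  add_mem' := by
    rintro a b ⟨g, hg, ha⟩ ⟨g', hg', hb⟩
    exact ⟨g * g', G.mul_mem hg hg', by rw [mul_smul, hb, smul_rot, ha, S3.rot_rot, add_comm]⟩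
  neg_mem' := by
    rintro a ⟨g, hg, ha⟩
    refine ⟨g⁻¹, G.inv_mem hg, ?_⟩
    rw [inv_smul_eq_iff, smul_rot, ha, S3.rot_rot, neg_add_cancel, S3.rot_zero]

/-- The group lies in `(2π / |G|) ℤ`, hence is discrete, and contains `2π`. Its generator is the
angle of the embedded orbit over the fibre. -/
theorem exists_fibreAngles_eq_zmultiples [Finite G] (z : S3) :
    ∃ τ : ℝ, 0 < τ ∧ fibreAngles G z = AddSubgroup.zmultiples τ := by
  have hn : 0 < (Nat.card G : ℝ) := by exact_mod_cast Nat.card_pos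
  have hpi := Real.pi_pos
  obtain ⟨b, hb⟩ := AddSubgroup.cyclic_of_isolated_zero (H := fibreAngles G z)
    (a := 2 * Real.pi / Nat.card G) (by positivity) (by
      rw [Set.disjoint_left]
      rintro τ ⟨g, hg, e⟩ ⟨h1, h2⟩
      obtain ⟨j, hj⟩ := exists_card_mul_eq hg e
      rw [lt_div_iff₀ hn] at h2
      have h3 : 0 < Nat.card G * τ := by positivity
      rw [hj] at h3
      rw [mul_comm, hj] at h2
      have h4 : (0 : ℝ) < j := by
        by_contra! hcon
        nlinarith
      have h5 : (j : ℝ) < 1 := by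
        by_contra! hcon
        nlinarith
      norm_cast at h4 h5
      omega)
  rw [← AddSubgroup.zmultiples_eq_closure] at hb
  have hne : b ≠ 0 := by
    rintro rfl
    have h2 : 2 * Real.pi ∈ fibreAngles G z := ⟨1, G.one_mem, by
      apply Subtype.ext
      rw [one_smul]
      simp [S3.rot, Complex.exp_two_pi_mul_I]⟩
    rw [hb, AddSubgroup.zmultiples_zero_eq_bot, AddSubgroup.mem_bot] at h2
    linarith
  refine ⟨|b|, abs_pos.2 hne, ?_⟩
  rw [hb]
  rcases abs_choice b with h | h
  · rw [h]
  · rw [h, AddSubgroup.zmultiples_neg]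

theorem fibreAngles_le {z z' : S3} {k : SU2} (hk : k ∈ G) (h : cover k • hopf z = hopf z') :
    fibreAngles G z ≤ fibreAngles G z' := by
  rw [← hopf_smul] at h
  obtain ⟨σ, rfl⟩ := exists_rot_of_hopf_eq h
  rintro τ ⟨g, hg, e⟩
  refine ⟨k * g * k⁻¹, G.mul_mem (G.mul_mem hk hg) (G.inv_mem hk), ?_⟩
  rw [smul_rot, mul_smul, inv_smul_smul, mul_smul, e, smul_rot, S3.rot_rot, S3.rot_rot, add_comm]

theorem fibreAngles_eq {z z' : S3} {k : SU2} (hk : k ∈ G) (h : cover k • hopf z = hopf z') :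
    fibreAngles G z = fibreAngles G z' :=
  le_antisymm (fibreAngles_le hk h)
    (fibreAngles_le (G.inv_mem hk) (by rw [map_inv, ← h, inv_smul_smul]))

end Algebra

section Topology

/-! ### The covering `S³ → S³/G` -/

variable {G : Subgroup SU2}

theorem toLink_eq_iff {z w : S3} : toLink G z = toLink G w ↔ ∃ g ∈ G, g • w = z := by
  rw [toLink, toLink, Quotient.eq'', MulAction.orbitRel_apply]
  constructor
  · rintro ⟨g, hg⟩
    exact ⟨g.1, g.2, hg⟩
  · rintro ⟨g, hg, e⟩
    exact ⟨⟨g, hg⟩, e⟩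

theorem isCompact_sphere : IsCompact {z : ℂ × ℂ | Complex.normSq z.1 + Complex.normSq z.2 = 1} := by
  refine Metric.isCompact_of_isClosed_isBounded ?_ ?_
  · exact isClosed_eq contDiff_normSq₂.continuous continuous_const
  · exact (Metric.isBounded_ball (x := (0 : ℂ × ℂ)) (r := 2)).subset fun z hz => S3.mem_ball ⟨z, hz⟩

instance : CompactSpace S3 := isCompact_iff_compactSpace.1 isCompact_sphere

instance : T2Space S3 := inferInstanceAs (T2Space (Subtype _))

instance : ContinuousConstSMul SU2 S3 where
  continuous_const_smul g := by
    have h : Continuous fun z : S3 => z.1 := continuous_subtype_val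
    refine Continuous.subtype_mk (f := fun z : S3 => (g • z).1) ?_ fun z => (g • z).2
    simp only [SU2.smul_val]
    fun_prop

instance : ContinuousConstSMul G S3 where
  continuous_const_smul g := continuous_const_smul (g.1 : SU2)

instance : IsCancelSMul G S3 where
  left_cancel' g _ _ h := (smul_left_cancel_iff g).1 h
  right_cancel' _ _ _ h := Subtype.ext (SU2.eq_of_smul_eq h)

theorem isCoveringMap_toLink [Finite G] : IsCoveringMap (toLink G) := by
  have : ProperlyDiscontinuousSMul G S3 := ⟨fun _ _ => Set.toFinite _⟩
  have h : IsQuotientCoveringMap (Quotient.mk (MulAction.orbitRel G S3)) G :=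
    isQuotientCoveringMap_quotientMk_of_properlyDiscontinuousSMul
  exact h.isCoveringMap

/-- A deck transformation that matches two lifts at one point matches them everywhere, by uniqueness
of lifts. -/
theorem exists_deck [Finite G] {A : Type*} [TopologicalSpace A] [PreconnectedSpace A] [Nonempty A]
    {c c' : A → S3} (hc : Continuous c) (hc' : Continuous c')
    (h : ∀ a, toLink G (c a) = toLink G (c' a)) : ∃ g ∈ G, ∀ a, c a = g • c' a := by
  obtain ⟨a⟩ := ‹Nonempty A›
  obtain ⟨g, hg, e⟩ := toLink_eq_iff.1 (h a)
  refine ⟨g, hg, congrFun ((isCoveringMap_toLink (G := G)).eq_of_comp_eq hc (hc'.const_smul g) ?_ a e.symm)⟩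
  funext b
  rw [Function.comp_apply, h b]
  exact (toLink_eq_iff.2 ⟨g, hg, rfl⟩).symm

open scoped unitInterval in
/-- The deck transformations of lifts of freely homotopic loops are conjugate. -/
theorem exists_conj_of_homotopic [Finite G] {γ γ' : C(AddCircle (1 : ℝ), LinkSpace G)}
    (hγ : γ.Homotopic γ') {c c' : ℝ → S3} (hc : Continuous c) (hc' : Continuous c')
    (hcγ : ∀ s : ℝ, γ (s : AddCircle (1 : ℝ)) = toLink G (c s))
    (hcγ' : ∀ s : ℝ, γ' (s : AddCircle (1 : ℝ)) = toLink G (c' s)) {g g' : SU2} (hg : g ∈ G)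
    (h : c 1 = g • c 0) (h' : c' 1 = g' • c' 0) : ∃ k ∈ G, k * g' = g * k := by
  obtain ⟨F⟩ := hγ
  have cov := isCoveringMap_toLink (G := G)
  let pr : C(I, AddCircle (1 : ℝ)) :=
    ⟨fun s => ((s : ℝ) : AddCircle (1 : ℝ)), (AddCircle.continuous_mk' 1).comp continuous_subtype_val⟩
  let H : C(I × I, LinkSpace G) := F.toContinuousMap.comp ((ContinuousMap.id I).prodMap pr)
  let f : C(I, S3) := ⟨fun s => c s, hc.comp continuous_subtype_val⟩
  have H0 : ∀ a, H (0, a) = toLink G (f a) := fun a => by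
    change F (0, pr a) = _
    rw [F.apply_zero]
    exact hcγ a
  let L := cov.liftHomotopy H f H0
  have hL : ∀ s a, toLink G (L (s, a)) = F (s, pr a) := fun s a =>
    congrFun (cov.liftHomotopy_lifts H f H0) (s, a)
  have hL0 : ∀ a, L (0, a) = c a := cov.liftHomotopy_zero H f H0
  have hpr : pr 1 = pr 0 := by
    change (((1 : I) : ℝ) : AddCircle (1 : ℝ)) = ((0 : I) : ℝ)
    simp [AddCircle.coe_period]
  -- The homotopy is free, so the ends of the lifted paths move; but they stay related by the same
  -- `g` as at time `0`. At time `1` the lifted path is `k • c'`, whence `g k = k g'`.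
  have hends : (fun s => L (s, 1)) = fun s => g • L (s, 0) := by
    refine cov.eq_of_comp_eq (by fun_prop)
      ((by fun_prop : Continuous fun s => L (s, 0)).const_smul g) ?_ 0 ?_
    · funext s
      change toLink G (L (s, 1)) = toLink G (g • L (s, 0))
      rw [hL, hpr, ← hL]
      exact (toLink_eq_iff.2 ⟨g, hg, rfl⟩).symm
    · rw [hL0, hL0]
      exact h
  obtain ⟨k, hk, hk'⟩ := exists_deck (G := G) (A := I) (c := fun a => L (1, a)) (c' := fun a => c' a)
    (by fun_prop) (hc'.comp continuous_subtype_val) (fun a => by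
      rw [hL, F.apply_one]
      exact hcγ' a)
  refine ⟨k, hk, SU2.eq_of_smul_eq (z := c' 0) ?_⟩
  have e1 := hk' 1
  have e0 := hk' 0
  have e2 := congrFun hends 1
  change L (1, 1) = g • L (1, 0) at e2
  change L (1, 1) = k • c' 1 at e1
  change L (1, 0) = k • c' 0 at e0
  rw [mul_smul, ← h', ← e1, e2, e0, mul_smul]

end Topology

/-- The properties of the group and of the Morse function on which the description of the Reeb orbits
relies. -/
structure Admissible (G : Subgroup SU2) (f : (Fin 3 → ℝ) → ℝ) : Prop where
  finite : Finite G
  smooth : ContDiff ℝ ∞ f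
  hess : ∀ z : S3, IsCritical f (hopf z) → ∃ s : ℤ, f (hopf z).1 = s ∧ HessType f z.1 s
  transitive : ∀ p q : S2, IsCritical f p → IsCritical f q → f p.1 = f q.1 →
    ∃ g ∈ G, cover g • p = q

/-- The parameter `ε` is small enough to control the Reeb orbits of period less than `L`. -/
structure SmallParameter (f : (Fin 3 → ℝ) → ℝ) (n : ℕ) (K : NNReal) (ε L : ℝ) : Prop where
  pos : 0 < ε
  factor_ge : ∀ z : S3, 1 / 2 ≤ factor f ε z.1
  lipschitz : 2 * ε * K * (n * L) < 1
  rotation : 8 * ε * L < Real.pi / n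
  shear : 4 * ε * L < 1 - Real.cos (Real.pi / n)

theorem HessType.abs_le {f : (Fin 3 → ℝ) → ℝ} {z : ℂ × ℂ} {s : ℤ} (h : HessType f z s) :
    s = 0 ∨ s = 1 ∨ s = -1 := by
  rcases h with ⟨-, -, -, h, -⟩ | ⟨h, -⟩
  · exact Or.inr h
  · exact Or.inl h

/-! ### Short Reeb orbits are fibre orbits -/

section Orbits

variable {G : Subgroup SU2} {f : (Fin 3 → ℝ) → ℝ} {K : NNReal} {ε L : ℝ}

/-- `γ` runs over the fibre through `z` with total rotation angle `θ`, where the deck transformation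
`g` closes it up and `s` is the critical value. -/
structure IsFibreOrbit (γ : ReebOrbit G f ε) (z : S3) (g : SU2) (θ : ℝ) (s : ℤ) : Prop where
  critical : IsCritical f (hopf z)
  value : f (hopf z).1 = s
  sign : s = 0 ∨ s = 1 ∨ s = -1
  factor_pos : 0 < 1 + ε * s
  lift_eq : ∀ t, γ.lift t = z.rot (t / (1 + ε * s))
  mem : g ∈ G
  smul_eq : g • z = z.rot θ
  angle_pos : 0 < θ
  period_eq : γ.period = (1 + ε * s) * θ

theorem IsFibreOrbit.toFun_eq {γ : ReebOrbit G f ε} {z : S3} {g : SU2} {θ : ℝ} {s : ℤ}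
    (h : IsFibreOrbit γ z g θ s) (t : ℝ) : γ.toFun t = toLink G (z.rot (t / (1 + ε * s))) := by
  rw [γ.lift_spec.2, h.lift_eq]

/-- The lift closes up after `|G|` periods because the deck transformation has order dividing `|G|`;
its Hopf image is then too short a periodic curve to move. -/
theorem exists_isFibreOrbit (hG : Admissible G f) (hε : SmallParameter f (Nat.card G) K ε L)
    (hK : LipschitzOnWith K (sphereField f) {x | x ⬝ᵥ x = 1}) (γ : ReebOrbit G f ε)
    (hL : γ.period < L) :
    ∃ z g θ s, IsFibreOrbit γ z g θ s ∧ γ.Nondegenerate ∧ γ.czIndex = expectedIndex θ s := by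
  have := hG.finite
  have hn : 0 < Nat.card G := Nat.card_pos
  have hn' : (0 : ℝ) < Nat.card G := by exact_mod_cast hn
  have hT := γ.period_pos
  have hε0 := hε.pos
  have hc := γ.lift_spec.1
  have hpos : ∀ z : S3, 0 < factor f ε z.1 := fun z => by linarith [hε.factor_ge z]
  obtain ⟨g, hg, hdeck⟩ := exists_deck (G := G) (c := fun t => γ.lift (t + γ.period)) (c' := γ.lift)
    (hc.continuous.comp (continuous_id.add continuous_const)) hc.continuous (fun t => by
      rw [← γ.lift_spec.2, ← γ.lift_spec.2, γ.periodic])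
  have hiter : ∀ (m : ℕ) t, γ.lift (t + m * γ.period) = g ^ m • γ.lift t := by
    intro m
    induction m with
    | zero => intro t; simp
    | succ m ih =>
      intro t
      rw [pow_succ', mul_smul, ← ih, ← hdeck]
      congr 1
      push_cast
      ring
  have hcard : g ^ Nat.card G = 1 :=
    congrArg Subtype.val (pow_card_eq_one' (x := (⟨g, hg⟩ : G)))
  have hcrit : IsCritical f (hopf (γ.lift 0)) := by
    refine isCritical_of_periodic hG.smooth hε.factor_ge hε0 hK hc (T := Nat.card G * γ.period)
      (by positivity) ?_ ?_
    · intro t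
      change hopf (γ.lift (t + Nat.card G * γ.period)) = hopf (γ.lift t)
      rw [hiter, hcard, one_smul]
    · refine lt_of_le_of_lt ?_ hε.lipschitz
      gcongr
  obtain ⟨s, hs, hess⟩ := hG.hess _ hcrit
  have hfac : factor f ε (γ.lift 0).1 = 1 + ε * s := congrArg (fun y => 1 + ε * y) hs
  have hfpos : 0 < 1 + ε * (s : ℝ) := hfac ▸ hpos (γ.lift 0)
  have hlift : γ.lift = fun t => (γ.lift 0).rot (t / (1 + ε * s)) := by
    have h := isReebTrajectory_rot hG.smooth hpos hcrit
    rw [hfac] at h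
    exact hc.ext hG.smooth hpos h (t₀ := 0) (by rw [zero_div, S3.rot_zero])
  have hgz : g • γ.lift 0 = (γ.lift 0).rot (γ.period / (1 + ε * s)) := by
    rw [← hdeck, zero_add]
    exact congrFun hlift _
  obtain ⟨j, hj⟩ := exists_card_mul_eq hg hgz
  have hidx := critical_index hG.smooth hε.factor_ge hε0 hcrit hess hT hn (j := j)
    (by rw [hfac]; exact hj)
    (lt_of_le_of_lt (by gcongr) hε.rotation) (lt_of_le_of_lt (by gcongr) hε.shear)
  rw [hfac] at hidx
  refine ⟨γ.lift 0, g, γ.period / (1 + ε * s), s, ⟨hcrit, hs, hess.abs_le, hfpos, congrFun hlift, hg,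
    hgz, by positivity, by field_simp⟩, hidx.1, hidx.2⟩

/-- Points of the fibre are identified in `S³/G` exactly when their angles differ by a multiple of
`τ`, so the embedded orbit has angle `τ` and period `(1 + εs) τ`. -/
theorem IsFibreOrbit.exists_multiplicity {γ : ReebOrbit G f ε} {z : S3} {g : SU2} {θ : ℝ} {s : ℤ}
    (h : IsFibreOrbit γ z g θ s) {τ : ℝ} (hτ : 0 < τ)
    (hz : fibreAngles G z = AddSubgroup.zmultiples τ) {m : ℕ} (hm : θ = m * τ) :
    γ.HasMultiplicity m := by
  have hθ := h.angle_pos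
  have hfac := h.factor_pos
  have hm0 : 0 < m := by
    rcases Nat.eq_zero_or_pos m with h0 | h0
    · rw [h0, Nat.cast_zero, zero_mul] at hm
      exact absurd hm hθ.ne'
    · exact h0
  have hm1 : (0 : ℝ) < m := by exact_mod_cast hm0
  have hper : γ.period / m = (1 + ε * s) * τ := by
    rw [h.period_eq, hm]
    field_simp
  refine ⟨hm0, ?_, ?_⟩
  · intro t
    have hmem : τ ∈ fibreAngles G z := hz ▸ AddSubgroup.mem_zmultiples τ
    obtain ⟨k, hk, e⟩ := hmem
    rw [hper, h.toFun_eq, h.toFun_eq]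
    refine toLink_eq_iff.2 ⟨k, hk, ?_⟩
    rw [smul_rot, e, S3.rot_rot]
    congr 1
    field_simp
  · intro a ha b hb hab
    rw [hper] at ha hb
    rw [h.toFun_eq, h.toFun_eq, toLink_eq_iff] at hab
    obtain ⟨k, hk, e⟩ := hab
    have e2 : k • z = z.rot (a / (1 + ε * s) - b / (1 + ε * s)) := by
      have e3 := congrArg (fun w => S3.rot (-(b / (1 + ε * s))) w) e
      beta_reduce at e3
      rw [← smul_rot, S3.rot_rot, S3.rot_rot, neg_add_cancel, S3.rot_zero] at e3
      rw [e3]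
      congr 1
      ring
    have hmem : a / (1 + ε * s) - b / (1 + ε * s) ∈ fibreAngles G z := ⟨k, hk, e2⟩
    rw [hz, AddSubgroup.mem_zmultiples_iff] at hmem
    obtain ⟨i, hi⟩ := hmem
    rw [zsmul_eq_mul] at hi
    have ha2 : a / (1 + ε * s) < τ := by rw [div_lt_iff₀ hfac, mul_comm]; exact ha.2
    have hb2 : b / (1 + ε * s) < τ := by rw [div_lt_iff₀ hfac, mul_comm]; exact hb.2
    have ha1 : 0 ≤ a / (1 + ε * s) := div_nonneg ha.1 hfac.le
    have hb1 : 0 ≤ b / (1 + ε * s) := div_nonneg hb.1 hfac.le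
    -- Two numbers in `[0, τ)` that differ by a multiple of `τ` are equal.
    have hi1 : (i : ℝ) < 1 := by
      by_contra! hcon
      nlinarith
    have hi2 : (-1 : ℝ) < i := by
      by_contra! hcon
      nlinarith
    have hi3 : i = 0 := by
      have h1 : i < 1 := by exact_mod_cast hi1
      have h2 : -1 < i := by exact_mod_cast hi2
      omega
    rw [hi3, Int.cast_zero, zero_mul, eq_comm, sub_eq_zero, div_left_inj' hfac.ne'] at hi
    exact hi

/-- Fibres over one `G`-orbit in `S²` have the same group of angles, so the common `θ` gives the
same multiplicity for both. -/
theorem IsFibreOrbit.equivalent {ε' : ℝ} [Finite G] {γ : ReebOrbit G f ε} {γ' : ReebOrbit G f ε'}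
    {z z' : S3} {g g' : SU2} {θ : ℝ} {s s' : ℤ} (h : IsFibreOrbit γ z g θ s)
    (h' : IsFibreOrbit γ' z' g' θ s') {k : SU2} (hk : k ∈ G) (e : cover k • hopf z' = hopf z) :
    Equivalent γ γ' := by
  refine ⟨⟨hopf z, h.critical, fun t => ?_, fun t => ?_⟩, ?_⟩
  · rw [h.toFun_eq]
    change toOrbitSphere G (hopf _) = _
    rw [hopf_rot]
  · rw [h'.toFun_eq]
    change toOrbitSphere G (hopf _) = _
    rw [hopf_rot]
    have hr : (MulAction.orbitRel (G.map cover) S2).r (hopf z) (hopf z') :=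
      ⟨⟨cover k, Subgroup.mem_map_of_mem cover hk⟩, e⟩
    exact (Quotient.sound hr).symm
  · obtain ⟨τ, hτ, hz⟩ := exists_fibreAngles_eq_zmultiples (G := G) z
    have hz' : fibreAngles G z' = AddSubgroup.zmultiples τ := (fibreAngles_eq hk e).trans hz
    have hmem : θ ∈ fibreAngles G z := ⟨g, h.mem, h.smul_eq⟩
    rw [hz, AddSubgroup.mem_zmultiples_iff] at hmem
    obtain ⟨i, hi⟩ := hmem
    rw [zsmul_eq_mul] at hi
    have hi0 : 0 ≤ i := by
      have := h.angle_pos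
      rw [← hi] at this
      have h1 : (0 : ℝ) < i := pos_of_mul_pos_left this hτ.le
      exact_mod_cast h1.le
    lift i to ℕ using hi0
    rw [Int.cast_natCast] at hi
    exact ⟨i, h.exists_multiplicity hτ hz hi.symm, h'.exists_multiplicity hτ hz' hi.symm⟩

/-- Freely homotopic fibre orbits have conjugate deck transformations. -/
theorem IsFibreOrbit.exists_conj {ε' : ℝ} [Finite G] {γ : ReebOrbit G f ε} {γ' : ReebOrbit G f ε'}
    {z z' : S3} {g g' : SU2} {θ θ' : ℝ} {s s' : ℤ} (h : IsFibreOrbit γ z g θ s)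
    (h' : IsFibreOrbit γ' z' g' θ' s') (hγ : γ.loop.Homotopic γ'.loop) :
    ∃ k ∈ G, k * g' = g * k := by
  have aux : ∀ {ε : ℝ} {γ : ReebOrbit G f ε} {z : S3} {g : SU2} {θ : ℝ} {s : ℤ},
      IsFibreOrbit γ z g θ s → γ.lift (γ.period * 1) = g • γ.lift (γ.period * 0) := by
    intro ε γ z g θ s h
    have hfac := h.factor_pos
    rw [h.lift_eq, h.lift_eq, mul_one, mul_zero, zero_div, S3.rot_zero, h.smul_eq, h.period_eq,
      mul_div_cancel_left₀ _ hfac.ne']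
  exact exists_conj_of_homotopic hγ (c := fun s => γ.lift (γ.period * s))
    (c' := fun s => γ'.lift (γ'.period * s))
    (γ.lift_spec.1.continuous.comp (continuous_const.mul continuous_id))
    (γ'.lift_spec.1.continuous.comp (continuous_const.mul continuous_id))
    (fun s => γ.lift_spec.2 _) (fun s => γ'.lift_spec.2 _) h.mem (aux h) (aux h')

end Orbits

/-! ### Comparison of indices and periods -/

section Comparison

theorem expectedIndex_of_eq {θ : ℝ} {s k : ℤ} (h : θ = Real.pi * k) :
    expectedIndex θ s = 2 * k + s := by
  have e : θ / Real.pi = k := by rw [h]; field_simp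
  rw [expectedIndex, e, Int.floor_intCast, if_pos rfl]

theorem exists_expectedIndex_of_sin_ne_zero {θ : ℝ} (s : ℤ) (h : Real.sin θ ≠ 0) :
    ∃ k : ℤ, expectedIndex θ s = 2 * k + 1 ∧ Real.pi * k < θ ∧ θ < Real.pi * (k + 1) := by
  have hpi := Real.pi_pos
  have hne : θ / Real.pi ≠ ⌊θ / Real.pi⌋ := by
    intro e
    apply h
    rw [Real.sin_eq_zero_iff]
    refine ⟨⌊θ / Real.pi⌋, ?_⟩
    rw [← e]
    field_simp
  refine ⟨⌊θ / Real.pi⌋, by rw [expectedIndex, if_neg hne], ?_, ?_⟩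
  · have := lt_of_le_of_ne (Int.floor_le (θ / Real.pi)) hne.symm
    rwa [lt_div_iff₀ hpi, mul_comm] at this
  · have := Int.lt_floor_add_one (θ / Real.pi)
    rwa [div_lt_iff₀ hpi, mul_comm] at this

theorem eq_of_cos_eq_of_floor {θ θ' : ℝ} {k : ℤ} (h : Real.cos θ = Real.cos θ')
    (h1 : Real.pi * k < θ) (h2 : θ < Real.pi * (k + 1)) (h1' : Real.pi * k < θ')
    (h2' : θ' < Real.pi * (k + 1)) : θ = θ' := by
  have hpi := Real.pi_pos
  obtain ⟨m, hm | hm⟩ := Real.cos_eq_cos_iff.1 h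
  · have : m = 0 := by
      have a : (m : ℝ) < 1 := by nlinarith
      have b : (-1 : ℝ) < m := by nlinarith
      have a' : m < 1 := by exact_mod_cast a
      have b' : -1 < m := by exact_mod_cast b
      omega
    rw [this] at hm
    simpa using hm.symm
  · exfalso
    have a : 2 * (m : ℝ) < 2 * (k + 1) := by nlinarith
    have b : 2 * (k : ℝ) < 2 * m := by nlinarith
    have a' : m < k + 1 := by exact_mod_cast (by linarith : (m : ℝ) < k + 1)
    have b' : k < m := by exact_mod_cast (by linarith : (k : ℝ) < m)
    omega

/-- If `sin θ = 0`, then `θ = kπ` and `θ' = k'π` with `k ≡ k'` mod `2`. The numbers `2k` and `2k'`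
are then equal or at least `4` apart, more than `s` and `s'` can compensate. If `sin θ ≠ 0`, the
index names the interval `(kπ, (k + 1)π)`, on which the cosine is injective. -/
theorem index_comparison {θ θ' : ℝ} {s s' : ℤ} (hs : s = 0 ∨ s = 1 ∨ s = -1)
    (hs' : s' = 0 ∨ s' = 1 ∨ s' = -1) (hcos : Real.cos θ = Real.cos θ') :
    (expectedIndex θ s = expectedIndex θ' s' →
      θ = θ' ∧ (Real.sin θ ≠ 0 ∨ s = s')) ∧
    (expectedIndex θ s < expectedIndex θ' s' → θ < θ' ∨ θ = θ' ∧ s < s') := by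
  have hpi := Real.pi_pos
  have hsin : Real.sin θ = 0 ↔ Real.sin θ' = 0 := by
    have h1 := Real.sin_sq_add_cos_sq θ
    have h2 := Real.sin_sq_add_cos_sq θ'
    rw [hcos] at h1
    rw [← sq_eq_zero_iff, ← sq_eq_zero_iff (a := Real.sin θ')]
    constructor <;> intro h <;> linarith
  by_cases h : Real.sin θ = 0
  · have h' := hsin.1 h
    obtain ⟨k, hk⟩ := Real.sin_eq_zero_iff.1 h
    obtain ⟨k', hk'⟩ := Real.sin_eq_zero_iff.1 h'
    rw [mul_comm] at hk hk'
    have hmod : ∃ m : ℤ, k' = k + 2 * m := by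
      obtain ⟨m, hm | hm⟩ := Real.cos_eq_cos_iff.1 hcos
      · refine ⟨m, ?_⟩
        have : Real.pi * k' = Real.pi * (k + 2 * m) := by rw [hk', hm, ← hk]; ring
        exact_mod_cast mul_left_cancel₀ hpi.ne' this
      · refine ⟨m - k, ?_⟩
        have : Real.pi * k' = Real.pi * (k + 2 * (m - k)) := by rw [hk', hm, ← hk]; ring
        exact_mod_cast mul_left_cancel₀ hpi.ne' this
    obtain ⟨m, hm⟩ := hmod
    rw [expectedIndex_of_eq hk.symm, expectedIndex_of_eq hk'.symm]
    constructor
    · intro e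
      have e1 : k = k' := by omega
      exact ⟨by rw [← hk, ← hk', e1], Or.inr (by omega)⟩
    · intro e
      rcases lt_trichotomy k k' with hlt | heq | hgt
      · left
        rw [← hk, ← hk']
        exact mul_lt_mul_of_pos_left (by exact_mod_cast hlt) hpi
      · right
        exact ⟨by rw [← hk, ← hk', heq], by omega⟩
      · omega
  · have h' := fun e => h (hsin.2 e)
    obtain ⟨k, e, h1, h2⟩ := exists_expectedIndex_of_sin_ne_zero s h
    obtain ⟨k', e', h1', h2'⟩ := exists_expectedIndex_of_sin_ne_zero s' h'
    rw [e, e']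
    constructor
    · intro he
      have : k' = k := by omega
      subst this
      exact ⟨eq_of_cos_eq_of_floor hcos h1 h2 h1' h2', Or.inl h⟩
    · intro hlt
      have hkk : k + 1 ≤ k' := by omega
      have : (k : ℝ) + 1 ≤ k' := by exact_mod_cast hkk
      left
      nlinarith

theorem orbit_comparison {G : Subgroup SU2} {f : (Fin 3 → ℝ) → ℝ} {K : NNReal} (hG : Admissible G f)
    (hK : LipschitzOnWith K (sphereField f) {x | x ⬝ᵥ x = 1}) {ε ε' L L' : ℝ}
    (hε : SmallParameter f (Nat.card G) K ε L) (hε' : SmallParameter f (Nat.card G) K ε' L')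
    (γ : ReebOrbit G f ε) (γ' : ReebOrbit G f ε') (hL : γ.period < L) (hL' : γ'.period < L')
    (hγ : γ.loop.Homotopic γ'.loop) :
    (γ.czIndex = γ'.czIndex → Equivalent γ γ') ∧
      (γ.czIndex < γ'.czIndex → γ.period < γ'.period) := by
  have := hG.finite
  have hn : (0 : ℝ) < Nat.card G := by exact_mod_cast Nat.card_pos
  have hpi := Real.pi_pos
  obtain ⟨z, g, θ, s, h, -, hi⟩ := exists_isFibreOrbit hG hε hK γ hL
  obtain ⟨z', g', θ', s', h', -, hi'⟩ := exists_isFibreOrbit hG hε' hK γ' hL'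
  obtain ⟨k, hk, hconj⟩ := h.exists_conj h' hγ
  -- Moving the second fibre by `k` makes the same `g` rotate both fibres; the real part of its
  -- first entry is then both `cos θ` and `cos θ'`.
  have hgk : g • (k • z') = (k • z').rot θ' := by
    rw [← mul_smul, ← hconj, mul_smul, h'.smul_eq, smul_rot]
  have hcos : Real.cos θ = Real.cos θ' :=
    (col_of_smul_eq_rot h.smul_eq).1.symm.trans (col_of_smul_eq_rot hgk).1
  obtain ⟨ha, hb⟩ := index_comparison h.sign h'.sign hcos
  rw [hi, hi']
  constructor
  · intro e
    obtain ⟨e1, e2⟩ := ha e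
    subst e1
    rcases e2 with e2 | e2
    · refine h.equivalent h' hk ?_
      rw [← hopf_smul]
      exact (hopf_eq_of_smul_eq_rot h.smul_eq hgk e2).symm
    · obtain ⟨k₁, hk₁, e3⟩ := hG.transitive _ _ h'.critical h.critical (by
        rw [h.value, h'.value, e2])
      exact h.equivalent h' hk₁ e3
  · intro hlt
    have est : ∀ {ε L : ℝ} {γ : ReebOrbit G f ε} {z : S3} {g : SU2} {θ : ℝ} {s : ℤ},
        SmallParameter f (Nat.card G) K ε L → γ.period < L → IsFibreOrbit γ z g θ s →
        -- The difference is `ε |s| θ`, and `θ ≤ 2 * L` because the factor is at least `1 / 2`.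
        |γ.period - θ| < Real.pi / Nat.card G := by
      intro ε L γ z g θ s hε hL h
      have h0 := h.angle_pos
      have hε0 := hε.pos
      have hh : 1 / 2 ≤ 1 + ε * (s : ℝ) := by
        have := hε.factor_ge z
        have e : factor f ε z.1 = 1 + ε * s := congrArg (fun y => 1 + ε * y) h.value
        rwa [e] at this
      have hs : |(s : ℝ)| ≤ 1 := by
        rcases h.sign with h | h | h <;> rw [h] <;> simp
      have hθ : θ ≤ 2 * L := by
        have := h.period_eq
        nlinarith
      rw [h.period_eq, show (1 + ε * (s : ℝ)) * θ - θ = ε * s * θ by ring, abs_mul, abs_mul,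
        abs_of_pos hε0, abs_of_pos h0]
      refine lt_of_le_of_lt ?_ hε.rotation
      have h1 : ε * |(s : ℝ)| * θ ≤ ε * 1 * θ := by gcongr
      have h2 : ε * 1 * θ ≤ ε * 1 * (2 * L) := by gcongr
      nlinarith
    rcases hb hlt with hθ | ⟨hθ, hs⟩
    · obtain ⟨j, hj⟩ := exists_card_mul_eq h.mem h.smul_eq
      obtain ⟨j', hj'⟩ := exists_card_mul_eq h'.mem h'.smul_eq
      -- Both angles lie in `(2π / |G|) ℤ`, so distinct ones differ by at least `2π / |G|`, twice
      -- the error bound.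
      have hjj : j + 1 ≤ j' := by
        have h1 : 2 * Real.pi * j < 2 * Real.pi * j' := by
          rw [← hj, ← hj']
          exact mul_lt_mul_of_pos_left hθ hn
        have h2 : (j : ℝ) < j' := lt_of_mul_lt_mul_left h1 (by positivity)
        have h3 : j < j' := by exact_mod_cast h2
        omega
      have hgap : θ + 2 * (Real.pi / Nat.card G) ≤ θ' := by
        have h1 : (j : ℝ) + 1 ≤ j' := by exact_mod_cast hjj
        rw [← mul_le_mul_iff_right₀ hn, hj', mul_add, hj]
        have h2 : (Nat.card G : ℝ) * (2 * (Real.pi / Nat.card G)) = 2 * Real.pi := by field_simp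
        rw [h2]
        nlinarith
      have h1 := abs_lt.1 (est hε hL h)
      have h2 := abs_lt.1 (est hε' hL' h')
      linarith
    · subst hθ
      rw [h.period_eq, h'.period_eq]
      refine mul_lt_mul_of_pos_right ?_ h.angle_pos
      have h1 := hε.pos
      have h2 := hε'.pos
      -- For `s < s'` in `{-1, 0, 1}` the inequality `εs < ε's'` needs only positivity of both
      -- parameters, not their order.
      rcases h.sign with e | e | e <;> rcases h'.sign with e' | e' | e' <;> rw [e, e'] at hs ⊢ <;>
        first
        | (exfalso; omega)
        | (push_cast; linarith)

end Comparison

/-! ### Choice of the thresholds for the perturbation parameter -/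

section Parameters

variable {f : (Fin 3 → ℝ) → ℝ}

theorem isCompact_unitSphere : IsCompact {x : Fin 3 → ℝ | x ⬝ᵥ x = 1} := by
  refine Metric.isCompact_of_isClosed_isBounded
    (isClosed_eq (continuous_id.dotProduct continuous_id) continuous_const) ?_
  refine (Metric.isBounded_closedBall (x := (0 : Fin 3 → ℝ)) (r := 1)).subset fun x hx => ?_
  rw [mem_closedBall_zero_iff, pi_norm_le_iff_of_nonneg zero_le_one]
  intro i
  rw [Real.norm_eq_abs]
  apply (sq_le_one_iff_abs_le_one _).1
  have hx' : x 0 * x 0 + x 1 * x 1 + x 2 * x 2 = 1 := by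
    simpa [dotProduct, Fin.sum_univ_three] using hx
  fin_cases i <;> dsimp <;> nlinarith [sq_nonneg (x 0), sq_nonneg (x 1), sq_nonneg (x 2)]

theorem exists_lipschitz_sphereField (hf : ContDiff ℝ ∞ f) :
    ∃ K : NNReal, LipschitzOnWith K (sphereField f) {x | x ⬝ᵥ x = 1} := by
  -- The sphere is not convex, so the Lipschitz constant is taken on a ball that contains it.
  obtain ⟨r, hr⟩ := isCompact_unitSphere.isBounded.subset_closedBall 0
  obtain ⟨K, hK⟩ := ((contDiff_sphereField hf).contDiffOn (s := Metric.closedBall 0 r)).of_le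
    (show (1 : WithTop ℕ∞) ≤ ∞ by simp) |>.exists_lipschitzOnWith (by simp)
    (convex_closedBall 0 r) (isCompact_closedBall 0 r)
  exact ⟨K, hK.mono hr⟩

theorem exists_bound_on_sphere (hf : Continuous f) : ∃ B : ℝ, 0 < B ∧ ∀ x : S2, |f x.1| ≤ B := by
  obtain ⟨B, hB⟩ := isCompact_unitSphere.exists_bound_of_continuousOn hf.continuousOn
  exact ⟨max B 1, lt_max_of_lt_right one_pos, fun x => (hB x.1 x.2).trans (le_max_left _ _)⟩

theorem exists_smallParameter (hf : ContDiff ℝ ∞ f) {n : ℕ} (hn : 0 < n) (K : NNReal) (L : ℝ) :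
    ∃ δ > 0, ∀ ε, 0 < ε → ε ≤ δ →
      SmallParameter f n K ε L ∧ ∀ x : S2, 0 < 1 + ε * f x.1 := by
  obtain ⟨B, hB, hfB⟩ := exists_bound_on_sphere hf.continuous
  have hn' : (0 : ℝ) < n := by exact_mod_cast hn
  have hpi := Real.pi_pos
  have hangle : 0 < Real.pi / n := by positivity
  have hangle' : Real.pi / n ≤ Real.pi :=
    div_le_self hpi.le (by exact_mod_cast hn)
  have hcos : 0 < 1 - Real.cos (Real.pi / n) := by
    have := Real.cos_lt_cos_of_nonneg_of_le_pi le_rfl hangle' hangle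
    rw [Real.cos_zero] at this
    linarith
  -- All conditions are strict at `ε = 0` and continuous in `ε`.
  have ev : ∀ᶠ ε in 𝓝 (0 : ℝ), ε * B < 1 / 2 ∧ 2 * ε * K * (n * L) < 1 ∧ 8 * ε * L < Real.pi / n ∧
      4 * ε * L < 1 - Real.cos (Real.pi / n) := by
    refine Filter.Eventually.and ?_ (Filter.Eventually.and ?_ (Filter.Eventually.and ?_ ?_)) <;>
    · refine ContinuousAt.eventually_lt (by fun_prop) (by fun_prop) ?_
      simp [hangle, sub_pos.1 hcos]
  obtain ⟨δ, hδ, h⟩ := Metric.eventually_nhds_iff.1 ev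
  refine ⟨δ / 2, by positivity, fun ε hε hle => ?_⟩
  have hd : dist ε 0 < δ := by
    rw [Real.dist_eq, sub_zero, abs_of_pos hε]
    linarith
  obtain ⟨h1, h2, h3, h4⟩ := h hd
  have hx : ∀ x : S2, 1 / 2 ≤ 1 + ε * f x.1 := fun x => by
    have := abs_le.1 (hfB x)
    nlinarith
  exact ⟨⟨hε, fun z => hx (hopf z), h2, h3, h4⟩, fun x => by linarith [hx x]⟩

theorem Admissible.exists_thresholds {G : Subgroup SU2} (hG : Admissible G f) (L : ℕ → ℝ) :
    ∃ δ : ℕ → ℝ, (∀ N, 0 < δ N) ∧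
      ∀ ε : ℕ → ℝ, (∀ N, 0 < ε N ∧ ε N ≤ δ N) →
        (∀ N, (∀ x : S2, 0 < 1 + ε N * f x.1) ∧
          ∀ γ : ReebOrbit G f (ε N), γ.action < L N → γ.Nondegenerate) ∧
        ∀ (N M : ℕ) (γ : ReebOrbit G f (ε N)) (γ' : ReebOrbit G f (ε M)),
          γ.action < L N → γ'.action < L M → γ.loop.Homotopic γ'.loop →
            (γ.czIndex = γ'.czIndex → Equivalent γ γ') ∧
            (γ.czIndex < γ'.czIndex → γ.action < γ'.action) := by
  have := hG.finite
  obtain ⟨K, hK⟩ := exists_lipschitz_sphereField hG.smooth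
  choose δ hδ h using fun N => exists_smallParameter hG.smooth (n := Nat.card G) Nat.card_pos K (L N)
  refine ⟨δ, hδ, fun ε hε => ⟨fun N => ⟨(h N (ε N) (hε N).1 (hε N).2).2, fun γ hγ => ?_⟩,
    fun N M γ γ' hγ hγ' hhom => ?_⟩⟩
  · rw [ReebOrbit.action_eq_period] at hγ
    obtain ⟨-, -, -, -, -, hnd, -⟩ :=
      exists_isFibreOrbit hG (h N (ε N) (hε N).1 (hε N).2).1 hK γ hγ
    exact hnd
  · rw [ReebOrbit.action_eq_period] at hγ hγ'
    rw [ReebOrbit.action_eq_period, ReebOrbit.action_eq_period]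
    exact orbit_comparison hG hK (h N (ε N) (hε N).1 (hε N).2).1 (h M (ε M) (hε M).1 (hε M).2).1
      γ γ' hγ hγ' hhom

end Parameters

/-! ### Normal forms of the Morse functions and conjugation -/

section PolarData

/-- Near `p`, the function `f` is a round extremum or a saddle point. -/
def HasMorseForm (f : (Fin 3 → ℝ) → ℝ) (p : Fin 3 → ℝ) : Prop :=
  (∃ (s : ℤ) (a : ℝ) (k : ℕ), (s = 1 ∨ s = -1) ∧ 0 < a ∧ 8 * a ≤ 4 * 2 ^ k ∧ f p = s ∧
    HasQuadraticForm f p s (-(a * s)) (-(a * s)) k) ∨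
  (f p = 0 ∧ HasQuadraticForm f p 0 (-(1 / 2)) (1 / 2) 2)

/-- A finite group together with an invariant function with round extrema and saddle points. -/
structure MorsePair (G : Subgroup SU2) (f : (Fin 3 → ℝ) → ℝ) : Prop where
  finite : Finite G
  smooth : ContDiff ℝ ∞ f
  form : ∀ p : S2, IsCritical f p → HasMorseForm f p.1
  transitive : ∀ p q : S2, IsCritical f p → IsCritical f q → f p.1 = f q.1 →
    ∃ g ∈ G, cover g • p = q

theorem MorsePair.admissible {G : Subgroup SU2} {f : (Fin 3 → ℝ) → ℝ} (h : MorsePair G f) :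
    Admissible G f := by
  refine ⟨h.finite, h.smooth, fun z hz => ?_, h.transitive⟩
  rcases h.form _ hz with ⟨s, a, k, hs, ha, ha', hv, hq⟩ | ⟨hv, hq⟩
  · exact ⟨s, hv, hessType_elliptic h.smooth hz hs ha ha' hq⟩
  · exact ⟨0, by rw [hv, Int.cast_zero], hessType_saddle h.smooth hz hq⟩

theorem SO3.mulVec_dotProduct_mulVec (R : SO3) (x y : Fin 3 → ℝ) :
    (R.1 *ᵥ x) ⬝ᵥ (R.1 *ᵥ y) = x ⬝ᵥ y := by
  have hR := (Matrix.mem_orthogonalGroup_iff' _ _).1 (Matrix.mem_specialOrthogonalGroup_iff.1 R.2).1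
  rw [Matrix.dotProduct_mulVec, ← Matrix.mulVec_transpose, Matrix.mulVec_mulVec]
  change ((R.1)ᵀ * R.1) *ᵥ x ⬝ᵥ y = _
  rw [hR, Matrix.one_mulVec]

theorem SO3.mulVec_mulVec (R R' : SO3) (x : Fin 3 → ℝ) :
    R.1 *ᵥ (R'.1 *ᵥ x) = (R * R').1 *ᵥ x := Matrix.mulVec_mulVec x R.1 R'.1

theorem SO3.mulVec_inv_mulVec (R : SO3) (x : Fin 3 → ℝ) : R.1 *ᵥ ((R⁻¹).1 *ᵥ x) = x := by
  rw [SO3.mulVec_mulVec, mul_inv_cancel]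
  exact Matrix.one_mulVec x

theorem SO3.inv_mulVec_mulVec (R : SO3) (x : Fin 3 → ℝ) : (R⁻¹).1 *ᵥ (R.1 *ᵥ x) = x := by
  rw [SO3.mulVec_mulVec, inv_mul_cancel]
  exact Matrix.one_mulVec x

theorem HasQuadraticForm.rotate {f : (Fin 3 → ℝ) → ℝ} {p : Fin 3 → ℝ} {s a b : ℝ} {k : ℕ} (R : SO3)
    (h : HasQuadraticForm (fun x => f (R.1 *ᵥ x)) p s a b k) :
    HasQuadraticForm f (R.1 *ᵥ p) s a b k := by
  obtain ⟨R', hR', h⟩ := h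
  refine ⟨R * R', by rw [← SO3.mulVec_mulVec, hR'], ?_⟩
  filter_upwards [h] with y hy hy1
  rw [← SO3.mulVec_mulVec]
  exact hy hy1

theorem HasMorseForm.rotate {f : (Fin 3 → ℝ) → ℝ} {p : Fin 3 → ℝ} (R : SO3)
    (h : HasMorseForm (fun x => f (R.1 *ᵥ x)) p) : HasMorseForm f (R.1 *ᵥ p) := by
  rcases h with ⟨s, a, k, hs, ha, ha', hv, hq⟩ | ⟨hv, hq⟩
  · exact Or.inl ⟨s, a, k, hs, ha, ha', hv, hq.rotate⟩
  · exact Or.inr ⟨hv, hq.rotate⟩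

theorem contDiff_mulVec (M : Matrix (Fin 3) (Fin 3) ℝ) : ContDiff ℝ ∞ (fun x => M *ᵥ x) :=
  (Matrix.toLin' M).toContinuousLinearMap.contDiff

theorem IsCritical.rotate {f : (Fin 3 → ℝ) → ℝ} (R : SO3) (hf : ContDiff ℝ ∞ f) {p : S2}
    (h : IsCritical f p) : IsCritical (fun x => f (R.1 *ᵥ x)) (R⁻¹ • p) := by
  intro v hv
  have e : R.1 *ᵥ (R⁻¹ • p).1 = p.1 := SO3.mulVec_inv_mulVec R p.1
  have h1 : HasFDerivAt (fun x => f (R.1 *ᵥ x))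
      ((fderiv ℝ f p.1).comp (Matrix.toLin' R.1).toContinuousLinearMap) (R⁻¹ • p).1 := by
    refine HasFDerivAt.comp (g := f) _ ?_ (Matrix.toLin' R.1).toContinuousLinearMap.hasFDerivAt
    rw [e]
    exact (hf.differentiable (by simp) _).hasFDerivAt
  rw [h1.fderiv]
  refine h (R.1 *ᵥ v) ?_
  rw [← e, SO3.mulVec_dotProduct_mulVec]
  exact hv

/-- Critical points and normal forms of `f` are the images under the rotation `cover A` of those of
`f ∘ cover A`, and the transporting elements of the group are conjugated by `A`. -/
theorem MorsePair.conj {G : Subgroup SU2} {f : (Fin 3 → ℝ) → ℝ} (A : SU2)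
    (h : MorsePair G (fun x => f ((cover A).1 *ᵥ x))) :
    MorsePair (G.map (MulAut.conj A).toMonoidHom) f := by
  have hf : ContDiff ℝ ∞ f := by
    have e : f = fun x => (fun x => f ((cover A).1 *ᵥ x)) (((cover A)⁻¹).1 *ᵥ x) := by
      funext x
      beta_reduce
      rw [SO3.mulVec_inv_mulVec]
    rw [e]
    exact h.smooth.comp (contDiff_mulVec _)
  have hfin := h.finite
  refine ⟨?_, hf, fun p hp => ?_, fun p q hp hq hpq => ?_⟩
  · exact Set.Finite.to_subtype ((Set.toFinite (G : Set SU2)).image _)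
  · have := (h.form _ (hp.rotate (cover A) hf)).rotate
    rwa [show (cover A).1 *ᵥ ((cover A)⁻¹ • p).1 = p.1 from SO3.mulVec_inv_mulVec _ _] at this
  · obtain ⟨g, hg, e⟩ := h.transitive _ _ (hp.rotate (cover A) hf) (hq.rotate (cover A) hf) (by
      rw [show (cover A).1 *ᵥ ((cover A)⁻¹ • p).1 = p.1 from SO3.mulVec_inv_mulVec _ _,
        show (cover A).1 *ᵥ ((cover A)⁻¹ • q).1 = q.1 from SO3.mulVec_inv_mulVec _ _, hpq])
    refine ⟨A * g * A⁻¹, ⟨g, hg, rfl⟩, ?_⟩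
    rw [map_mul, map_mul, map_inv, mul_smul, mul_smul, e, smul_inv_smul]

/-- This inverts `stereo` by projection from the south pole. The two squared denominators are the
reason for the exponent `2` in the quadratic forms of adapted functions. -/
theorem stereo_div {y : Fin 3 → ℝ} (hy : y ⬝ᵥ y = 1) (h : 0 < 1 + y 2) :
    stereo (y 0 / (1 + y 2), y 1 / (1 + y 2)) = y := by
  have hy' : y 0 * y 0 + y 1 * y 1 + y 2 * y 2 = 1 := by
    simpa [dotProduct, Fin.sum_univ_three] using hy
  have e : y 0 ^ 2 + y 1 ^ 2 = (1 - y 2) * (1 + y 2) := by linear_combination hy'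
  have e1 : (y 0 / (1 + y 2)) ^ 2 + (y 1 / (1 + y 2)) ^ 2 = (1 - y 2) / (1 + y 2) := by
    rw [div_pow, div_pow, ← add_div, e]
    field_simp
  have e2 : 1 + (y 0 / (1 + y 2)) ^ 2 + (y 1 / (1 + y 2)) ^ 2 = 2 / (1 + y 2) := by
    rw [add_assoc, e1]
    field_simp
    ring
  have e3 : 1 - (y 0 / (1 + y 2)) ^ 2 - (y 1 / (1 + y 2)) ^ 2 = 2 * y 2 / (1 + y 2) := by
    rw [sub_sub, e1]
    field_simp
    ring
  funext i
  simp only [stereo, e2, e3]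
  fin_cases i <;> simp <;> field_simp

theorem HasNormalForm.hasQuadraticForm {f : (Fin 3 → ℝ) → ℝ} {p : Fin 3 → ℝ} {g : ℝ × ℝ → ℝ}
    {s a b : ℝ} (h : HasNormalForm f p g) (hg : ∀ q, g q = s + a * q.1 ^ 2 + b * q.2 ^ 2) :
    f p = s ∧ HasQuadraticForm f p s a b 2 := by
  obtain ⟨R, hR, h⟩ := h
  constructor
  · have h0 := h.self_of_nhds
    have e : stereo (0, 0) = ![0, 0, 1] := by simp [stereo]
    rw [e, hR, hg] at h0
    simpa using h0
  · refine ⟨R, hR, ?_⟩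
    have hc : ContinuousAt (fun y : Fin 3 → ℝ => (y 0 / (1 + y 2), y 1 / (1 + y 2))) ![0, 0, 1] := by
      have h2 : 1 + (![0, 0, 1] : Fin 3 → ℝ) 2 ≠ 0 := by simp
      have h3 : ContinuousAt (fun y : Fin 3 → ℝ => 1 + y 2) ![0, 0, 1] :=
        (continuous_const.add (continuous_apply 2)).continuousAt
      exact ((continuous_apply 0).continuousAt.div h3 h2).prodMk
        ((continuous_apply 1).continuousAt.div h3 h2)
    have hc' : Filter.Tendsto (fun y : Fin 3 → ℝ => (y 0 / (1 + y 2), y 1 / (1 + y 2)))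
        (𝓝 ![0, 0, 1]) (𝓝 (0, 0)) := by
      simpa [ContinuousAt] using hc
    have hpos : ∀ᶠ y : Fin 3 → ℝ in 𝓝 ![0, 0, 1], 0 < 1 + y 2 := by
      refine ContinuousAt.eventually_lt continuousAt_const
        (continuous_const.add (continuous_apply 2)).continuousAt ?_
      simp
    filter_upwards [hc'.eventually h, hpos] with y hy hy2 hy1
    rw [stereo_div hy1 hy2, hg] at hy
    rw [hy]
    field_simp
    ring

theorem IsAdapted.hasMorseForm {f : (Fin 3 → ℝ) → ℝ} {X₀ X₁ X₂ : Set (Fin 3 → ℝ)}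
    (h : IsAdapted f X₀ X₁ X₂) {p : S2} (hp : IsCritical f p) : HasMorseForm f p.1 := by
  rcases (h.1 p).1 hp with (hp | hp) | hp
  · obtain ⟨h1, h2⟩ := (h.2.1 _ hp).hasQuadraticForm (s := -1) (a := 1 / 2) (b := 1 / 2)
      (fun q => by ring)
    refine Or.inl ⟨-1, 1 / 2, 2, Or.inr rfl, by norm_num, by norm_num, by rw [h1]; simp, ?_⟩
    norm_num at h2 ⊢
    exact h2
  · obtain ⟨h1, h2⟩ := (h.2.2.1 _ hp).hasQuadraticForm (s := 0) (a := -(1 / 2)) (b := 1 / 2)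
      (fun q => by ring)
    exact Or.inr ⟨h1, h2⟩
  · obtain ⟨h1, h2⟩ := (h.2.2.2 _ hp).hasQuadraticForm (s := 1) (a := -(1 / 2)) (b := -(1 / 2))
      (fun q => by ring)
    refine Or.inl ⟨1, 1 / 2, 2, Or.inl rfl, by norm_num, by norm_num, by rw [h1]; simp, ?_⟩
    norm_num at h2 ⊢
    exact h2

/-- The values `-1`, `0`, `1` tell the three sets apart, so critical points of equal value lie in
the same set. -/
theorem IsAdapted.transitive {f : (Fin 3 → ℝ) → ℝ} {X₀ X₁ X₂ : Set (Fin 3 → ℝ)}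
    (h : IsAdapted f X₀ X₁ X₂) {G : Subgroup SU2}
    (hG : ∀ X : Set (Fin 3 → ℝ), X = X₀ ∨ X = X₁ ∨ X = X₂ → ∀ x ∈ X, ∀ y ∈ X,
      ∃ g ∈ G, (cover g).1 *ᵥ x = y) (p q : S2)
    (hp : IsCritical f p) (hq : IsCritical f q) (hpq : f p.1 = f q.1) : ∃ g ∈ G, cover g • p = q := by
  have v0 : ∀ x ∈ X₀, f x = -1 := fun x hx =>
    ((h.2.1 _ hx).hasQuadraticForm (s := -1) (a := 1 / 2) (b := 1 / 2) (fun q => by ring)).1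
  have v1 : ∀ x ∈ X₁, f x = 0 := fun x hx =>
    ((h.2.2.1 _ hx).hasQuadraticForm (s := 0) (a := -(1 / 2)) (b := 1 / 2) (fun q => by ring)).1
  have v2 : ∀ x ∈ X₂, f x = 1 := fun x hx =>
    ((h.2.2.2 _ hx).hasQuadraticForm (s := 1) (a := -(1 / 2)) (b := -(1 / 2)) (fun q => by ring)).1
  have key : ∃ X : Set (Fin 3 → ℝ), (X = X₀ ∨ X = X₁ ∨ X = X₂) ∧ p.1 ∈ X ∧ q.1 ∈ X := by
    rcases (h.1 p).1 hp with (hp | hp) | hp <;> rcases (h.1 q).1 hq with (hq | hq) | hq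
    · exact ⟨X₀, by simp, hp, hq⟩
    · rw [v0 _ hp, v1 _ hq] at hpq; norm_num at hpq
    · rw [v0 _ hp, v2 _ hq] at hpq; norm_num at hpq
    · rw [v1 _ hp, v0 _ hq] at hpq; norm_num at hpq
    · exact ⟨X₁, by simp, hp, hq⟩
    · rw [v1 _ hp, v2 _ hq] at hpq; norm_num at hpq
    · rw [v2 _ hp, v0 _ hq] at hpq; norm_num at hpq
    · rw [v2 _ hp, v1 _ hq] at hpq; norm_num at hpq
    · exact ⟨X₂, by simp, hp, hq⟩
  obtain ⟨X, hX, hpX, hqX⟩ := key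
  obtain ⟨g, hg, e⟩ := hG X hX _ hpX _ hqX
  exact ⟨g, hg, Subtype.ext e⟩

theorem IsAdapted.morsePair {f : (Fin 3 → ℝ) → ℝ} {X₀ X₁ X₂ : Set (Fin 3 → ℝ)}
    (h : IsAdapted f X₀ X₁ X₂) (hf : ContDiff ℝ ∞ f) {G : Subgroup SU2} (hfin : Finite G)
    (hG : ∀ X : Set (Fin 3 → ℝ), X = X₀ ∨ X = X₁ ∨ X = X₂ → ∀ x ∈ X, ∀ y ∈ X,
      ∃ g ∈ G, (cover g).1 *ᵥ x = y) : MorsePair G f :=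
  ⟨hfin, hf, fun _ hp => h.hasMorseForm hp, h.transitive hG⟩

end PolarData

/-! ### Cyclic groups and the height function -/

section Cyclic

theorem SU2.diag_apply (θ : ℝ) :
    (SU2.diag θ).1 0 0 = Complex.exp (θ * Complex.I) ∧ (SU2.diag θ).1 1 0 = 0 := ⟨rfl, rfl⟩

theorem SU2.mul_apply_col (A B : SU2) :
    (A * B).1 0 0 = A.1 0 0 * B.1 0 0 - conj (A.1 1 0) * B.1 1 0 ∧
    (A * B).1 1 0 = A.1 1 0 * B.1 0 0 + conj (A.1 0 0) * B.1 1 0 := by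
  constructor
  · change (A.1 * B.1) 0 0 = _
    rw [Matrix.mul_apply, Fin.sum_univ_two, SU2.apply_zero_one]
    ring
  · change (A.1 * B.1) 1 0 = _
    rw [Matrix.mul_apply, Fin.sum_univ_two, SU2.apply_one_one]

theorem SU2.inv_apply_col (A : SU2) :
    (A⁻¹).1 0 0 = conj (A.1 0 0) ∧ (A⁻¹).1 1 0 = -A.1 1 0 := by
  constructor
  · rfl
  · change conj (A.1 0 1) = _
    rw [SU2.apply_zero_one]
    simp

theorem SU2.diag_add (a b : ℝ) : SU2.diag (a + b) = SU2.diag a * SU2.diag b := by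
  obtain ⟨h0, h1⟩ := SU2.mul_apply_col (SU2.diag a) (SU2.diag b)
  refine SU2.ext_col ?_ ?_
  · rw [h0]
    simp only [(SU2.diag_apply _).1, (SU2.diag_apply _).2]
    push_cast
    rw [add_mul, Complex.exp_add]
    simp
  · rw [h1]
    simp [(SU2.diag_apply _).2]

theorem SU2.diag_two_pi : SU2.diag (2 * Real.pi) = 1 := by
  refine SU2.ext_col ?_ rfl
  rw [(SU2.diag_apply _).1]
  push_cast
  exact Complex.exp_two_pi_mul_I

theorem SU2.diag_intCast_mul (m : ℤ) (θ : ℝ) : SU2.diag (m * θ) = SU2.diag θ ^ m := by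
  let φ : Multiplicative ℝ →* SU2 :=
    { toFun := fun a => SU2.diag a.toAdd
      map_one' := by
        refine SU2.ext_col ?_ rfl
        rw [(SU2.diag_apply _).1]
        simp
      map_mul' := fun a b => SU2.diag_add _ _ }
  have h := map_zpow φ (Multiplicative.ofAdd θ) m
  rw [← zsmul_eq_mul]
  exact h

theorem finite_zpowers_diag {n : ℕ} (hn : 2 ≤ n) :
    Finite (Subgroup.zpowers (SU2.diag (2 * Real.pi / n))) := by
  have h0 : (n : ℝ) ≠ 0 := by positivity
  have h : SU2.diag (2 * Real.pi / n) ^ n = 1 := by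
    have h := SU2.diag_intCast_mul n (2 * Real.pi / n)
    rw [zpow_natCast, Int.cast_natCast, mul_div_cancel₀ _ h0, SU2.diag_two_pi] at h
    exact h.symm
  exact (isOfFinOrder_iff_pow_eq_one.2 ⟨n, by omega, h⟩).finite_zpowers

/-- Only the restriction of `f` to `S²` is known, so its derivative is tested along curves in `S²`:
rotations that mix the first coordinate with one of the other two, which must then vanish. -/
theorem critical_of_height {f : (Fin 3 → ℝ) → ℝ} (hf : ContDiff ℝ ∞ f) (h : ∀ x : S2, f x.1 = x.1 0)
    {p : S2} (hp : IsCritical f p) : p.1 = ![1, 0, 0] ∨ p.1 = ![-1, 0, 0] := by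
  have hp1 : p.1 0 * p.1 0 + p.1 1 * p.1 1 + p.1 2 * p.1 2 = 1 := by
    simpa [dotProduct, Fin.sum_univ_three] using p.2
  have key : ∀ (c : ℝ → Fin 3 → ℝ) (v : Fin 3 → ℝ), (∀ t, c t ⬝ᵥ c t = 1) → c 0 = p.1 →
      HasDerivAt c v 0 → p.1 ⬝ᵥ v = 0 → v 0 = 0 := by
    intro c v hc h0 hd hv
    have h1 : HasDerivAt (fun t => f (c t)) (fderiv ℝ f p.1 v) 0 :=
      HasFDerivAt.comp_hasDerivAt_of_eq 0 (hf.differentiable (by simp) p.1).hasFDerivAt hd h0.symm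
    have h2 : (fun t => f (c t)) = fun t => c t 0 := funext fun t => h ⟨c t, hc t⟩
    rw [h2, hp v hv] at h1
    exact ((hasDerivAt_pi.1 hd 0).unique h1)
  have hcs : ∀ t, Real.sin t ^ 2 + Real.cos t ^ 2 = 1 := Real.sin_sq_add_cos_sq
  have e1 : p.1 1 = 0 := by
    refine key (fun t => ![Real.cos t * p.1 0 + Real.sin t * p.1 1,
      Real.cos t * p.1 1 - Real.sin t * p.1 0, p.1 2]) ![p.1 1, -p.1 0, 0] (fun t => ?_) ?_ ?_ ?_
    · simp [dotProduct, Fin.sum_univ_three]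
      linear_combination (p.1 0 * p.1 0 + p.1 1 * p.1 1) * hcs t + hp1
    · funext i
      fin_cases i <;> simp
    · rw [hasDerivAt_pi]
      intro i
      have hc := Real.hasDerivAt_cos 0
      have hs := Real.hasDerivAt_sin 0
      fin_cases i
      · exact ((hc.mul_const _).add (hs.mul_const _)).congr_deriv (by simp)
      · exact ((hc.mul_const _).sub (hs.mul_const _)).congr_deriv (by simp)
      · exact hasDerivAt_const _ _
    · simp [dotProduct, Fin.sum_univ_three]
      ring
  have e2 : p.1 2 = 0 := by
    refine key (fun t => ![Real.cos t * p.1 0 + Real.sin t * p.1 2, p.1 1,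
      Real.cos t * p.1 2 - Real.sin t * p.1 0]) ![p.1 2, 0, -p.1 0] (fun t => ?_) ?_ ?_ ?_
    · simp [dotProduct, Fin.sum_univ_three]
      linear_combination (p.1 0 * p.1 0 + p.1 2 * p.1 2) * hcs t + hp1
    · funext i
      fin_cases i <;> simp
    · rw [hasDerivAt_pi]
      intro i
      have hc := Real.hasDerivAt_cos 0
      have hs := Real.hasDerivAt_sin 0
      fin_cases i
      · exact ((hc.mul_const _).add (hs.mul_const _)).congr_deriv (by simp)
      · exact hasDerivAt_const _ _
      · exact ((hc.mul_const _).sub (hs.mul_const _)).congr_deriv (by simp)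
    · simp [dotProduct, Fin.sum_univ_three]
      ring
  rw [e1, e2] at hp1
  have e0 : p.1 0 = 1 ∨ p.1 0 = -1 := by
    apply mul_self_eq_one_iff.1
    linarith
  rcases e0 with e0 | e0
  · left
    funext i
    fin_cases i <;> simp [e0, e1, e2]
  · right
    funext i
    fin_cases i <;> simp [e0, e1, e2]

theorem mem_SO3_of {M : Matrix (Fin 3) (Fin 3) ℝ} (h : M * Mᵀ = 1) (hd : M.det = 1) :
    M ∈ Matrix.specialOrthogonalGroup (Fin 3) ℝ :=
  Matrix.mem_specialOrthogonalGroup_iff.2 ⟨(Matrix.mem_orthogonalGroup_iff _ _).2 h, hd⟩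

/-- At the pole of height `s` the function is `s y₂`, and `(s y₂ - s)(1 + y₂) = -s (y₀² + y₁²)` on
the sphere. This is the case of exponent `1`. -/
theorem hasMorseForm_of_height {f : (Fin 3 → ℝ) → ℝ} (h : ∀ x : S2, f x.1 = x.1 0)
    {p : Fin 3 → ℝ} (hp : p = ![1, 0, 0] ∨ p = ![-1, 0, 0]) : HasMorseForm f p := by
  have aux : ∀ (s : ℤ) (R : SO3), (s = 1 ∨ s = -1) → R.1 *ᵥ ![0, 0, 1] = p → p 0 = s →
      (∀ y, (R.1 *ᵥ y) 0 = s * y 2) → HasMorseForm f p := by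
    intro s R hs hR hp0 h0
    have hv : f p = s := by
      have hn : p ⬝ᵥ p = 1 := by
        rw [← hR, SO3.mulVec_dotProduct_mulVec]
        simp
      rw [← hp0]
      exact h ⟨p, hn⟩
    refine Or.inl ⟨s, 1, 1, hs, one_pos, by norm_num, hv, R, hR, Filter.Eventually.of_forall ?_⟩
    intro y hy
    have hfy : f (R.1 *ᵥ y) = s * y 2 := by
      rw [← h0]
      exact h ⟨R.1 *ᵥ y, by rw [SO3.mulVec_dotProduct_mulVec, hy]⟩
    have hy' : y 0 * y 0 + y 1 * y 1 + y 2 * y 2 = 1 := by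
      simpa [dotProduct, Fin.sum_univ_three] using hy
    rw [hfy]
    linear_combination (s : ℝ) * hy'
  rcases hp with rfl | rfl
  · refine aux 1 ⟨!![0, 0, 1; 1, 0, 0; 0, 1, 0], mem_SO3_of ?_ ?_⟩ (Or.inl rfl) ?_ ?_ ?_
    · ext i j
      fin_cases i <;> fin_cases j <;> simp [Matrix.mul_apply, Fin.sum_univ_three]
    · simp [Matrix.det_fin_three]
    · funext i
      fin_cases i <;> simp [Matrix.mulVec, dotProduct, Fin.sum_univ_three]
    · simp
    · intro y
      simp [Matrix.mulVec, dotProduct, Fin.sum_univ_three]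
  · refine aux (-1) ⟨!![0, 0, -1; 0, 1, 0; 1, 0, 0], mem_SO3_of ?_ ?_⟩ (Or.inr rfl) ?_ ?_ ?_
    · ext i j
      fin_cases i <;> fin_cases j <;> simp [Matrix.mul_apply, Fin.sum_univ_three]
    · simp [Matrix.det_fin_three]
    · funext i
      fin_cases i <;> simp [Matrix.mulVec, dotProduct, Fin.sum_univ_three]
    · simp
    · intro y
      simp [Matrix.mulVec, dotProduct, Fin.sum_univ_three]

theorem morsePair_cyclic {n : ℕ} (hn : 2 ≤ n) {f : (Fin 3 → ℝ) → ℝ} (hf : ContDiff ℝ ∞ f)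
    (h : ∀ x : S2, f x.1 = x.1 0) : MorsePair (Subgroup.zpowers (SU2.diag (2 * Real.pi / n))) f := by
  refine ⟨finite_zpowers_diag hn, hf, fun p hp => hasMorseForm_of_height h (critical_of_height hf h hp),
    fun p q hp hq hpq => ⟨1, Subgroup.one_mem _, ?_⟩⟩
  rw [map_one, one_smul]
  rw [h, h] at hpq
  apply Subtype.ext
  rcases critical_of_height hf h hp with e | e <;> rcases critical_of_height hf h hq with e' | e' <;>
    rw [e, e'] at hpq ⊢ <;> norm_num at hpq

end Cyclic

/-! ### Binary dihedral groups -/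

section Dihedral

theorem finite_pow_eq_one {m : ℕ} (hm : 0 < m) : {z : ℂ | z ^ m = 1}.Finite := by
  refine (Polynomial.nthRootsFinset m (1 : ℂ)).finite_toSet.subset fun z hz => ?_
  exact (Polynomial.mem_nthRootsFinset hm _).2 hz

theorem finite_dihedral {n : ℕ} (hn : 2 ≤ n) :
    Finite (Subgroup.closure {SU2.diag (Real.pi / n), SU2.ofPair 0 1 (by simp)} : Subgroup SU2) := by
  have h0 : (n : ℝ) ≠ 0 := by positivity
  -- Every element is diagonal or antidiagonal with a `2n`-th root of unity in its first column. The
  -- even exponent makes this stable under the signs that arise in products and inverses.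
  let P : SU2 → Prop := fun A =>
    (A.1 0 0 ^ (2 * n) = 1 ∧ A.1 1 0 = 0) ∨ (A.1 0 0 = 0 ∧ A.1 1 0 ^ (2 * n) = 1)
  have hP : {A | P A}.Finite := by
    have hF : ({z : ℂ | z ^ (2 * n) = 1} ∪ {0}).Finite :=
      (finite_pow_eq_one (by omega)).union (Set.finite_singleton 0)
    refine Set.Finite.of_finite_image (f := fun A : SU2 => (A.1 0 0, A.1 1 0))
      ((hF.prod hF).subset ?_) ?_
    · rintro - ⟨A, hA, rfl⟩
      rcases hA with ⟨h1, h2⟩ | ⟨h1, h2⟩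
      · exact ⟨Or.inl h1, Or.inr h2⟩
      · exact ⟨Or.inr h1, Or.inl h2⟩
    · intro A _ B _ hAB
      exact SU2.ext_col (Prod.ext_iff.1 hAB).1 (Prod.ext_iff.1 hAB).2
  have hconj : ∀ z : ℂ, z ^ (2 * n) = 1 → conj z ^ (2 * n) = 1 := fun z hz => by
    rw [← map_pow, hz, map_one]
  have hneg : ∀ z : ℂ, (-z) ^ (2 * n) = z ^ (2 * n) := fun z => (even_two_mul n).neg_pow z
  refine Set.Finite.to_subtype (hP.subset fun A hA => ?_)
  induction hA using Subgroup.closure_induction with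
  | mem A hA =>
    rcases hA with rfl | rfl
    · refine Or.inl ⟨?_, rfl⟩
      rw [(SU2.diag_apply _).1, ← Complex.exp_nat_mul, Complex.exp_eq_one_iff]
      refine ⟨1, ?_⟩
      have : (n : ℂ) ≠ 0 := by exact_mod_cast h0
      push_cast
      field_simp
    · exact Or.inr ⟨rfl, one_pow _⟩
  | one => exact Or.inl ⟨one_pow _, rfl⟩
  | mul A B _ _ hA hB =>
    change P _
    simp only [P]
    rw [(SU2.mul_apply_col A B).1, (SU2.mul_apply_col A B).2]
    rcases hA with ⟨h1, h2⟩ | ⟨h1, h2⟩ <;> rcases hB with ⟨h3, h4⟩ | ⟨h3, h4⟩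
    · left
      simp [h2, h4, mul_pow, h1, h3]
    · right
      simp [h2, h3, mul_pow, hconj _ h1, h4]
    · right
      simp [h1, h4, mul_pow, h2, h3]
    · left
      simp [h1, h3, mul_pow, hneg, hconj _ h2, h4]
  | inv A _ hA =>
    change P _
    simp only [P]
    rw [(SU2.inv_apply_col A).1, (SU2.inv_apply_col A).2]
    rcases hA with ⟨h1, h2⟩ | ⟨h1, h2⟩
    · left
      exact ⟨hconj _ h1, by simp [h2]⟩
    · right
      exact ⟨by simp [h1], by rw [hneg, h2]⟩

theorem cover_diag (θ : ℝ) : (cover (SU2.diag θ)).1 =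
    !![1, 0, 0; 0, Real.cos (2 * θ), -Real.sin (2 * θ); 0, Real.sin (2 * θ), Real.cos (2 * θ)] := by
  have e : Complex.exp (θ * Complex.I) ^ 2 = Complex.exp ((2 * θ : ℝ) * Complex.I) := by
    rw [← Complex.exp_nat_mul]
    congr 1
    push_cast
    ring
  have hn : Complex.normSq (Complex.exp (θ * Complex.I)) = 1 := normSq_exp θ
  change coverMatrix (Complex.exp (θ * Complex.I)) 0 = _
  rw [coverMatrix, e, hn]
  have hre := Complex.exp_ofReal_mul_I_re (2 * θ)
  have him := Complex.exp_ofReal_mul_I_im (2 * θ)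
  ext i j
  fin_cases i <;> fin_cases j <;> simp [-Complex.ofReal_mul, hre, him]

theorem cover_diag_mulVec (θ φ : ℝ) : (cover (SU2.diag θ)).1 *ᵥ ![0, Real.cos φ, Real.sin φ] =
    ![0, Real.cos (φ + 2 * θ), Real.sin (φ + 2 * θ)] := by
  rw [cover_diag]
  funext i
  fin_cases i <;>
    simp [Matrix.mulVec, dotProduct, Fin.sum_univ_three, Real.cos_add, Real.sin_add] <;> ring

/-- The diagonal generator covers the rotation by `2π / n`, which steps through the two equatorial
orbits; the other generator swaps the poles. -/
theorem morsePair_dihedral {n : ℕ} (hn : 2 ≤ n) {f : (Fin 3 → ℝ) → ℝ} (hf : ContDiff ℝ ∞ f)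
    (h : IsAdapted f
      {p | ∃ k : ℤ, p = ![0, Real.cos ((Real.pi + 2 * k * Real.pi) / n),
        Real.sin ((Real.pi + 2 * k * Real.pi) / n)]}
      {p | ∃ k : ℤ, p = ![0, Real.cos (2 * k * Real.pi / n), Real.sin (2 * k * Real.pi / n)]}
      {![1, 0, 0], ![-1, 0, 0]}) :
    MorsePair (Subgroup.closure {SU2.diag (Real.pi / n), SU2.ofPair 0 1 (by simp)}) f := by
  have hrot : ∀ m : ℤ, SU2.diag (m * (Real.pi / n)) ∈
      (Subgroup.closure {SU2.diag (Real.pi / n), SU2.ofPair 0 1 (by simp)} : Subgroup SU2) := fun m => by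
    rw [SU2.diag_intCast_mul]
    exact zpow_mem (Subgroup.subset_closure (Set.mem_insert _ _)) m
  have hflip : SU2.ofPair 0 1 (by simp) ∈
      (Subgroup.closure {SU2.diag (Real.pi / n), SU2.ofPair 0 1 (by simp)} : Subgroup SU2) :=
    Subgroup.subset_closure (Or.inr rfl)
  have hmat : (cover (SU2.ofPair 0 1 (by simp))).1 = !![-1, 0, 0; 0, 1, 0; 0, 0, -1] := by
    change coverMatrix 0 1 = _
    ext i j
    fin_cases i <;> fin_cases j <;> simp [coverMatrix]
  refine h.morsePair hf (finite_dihedral hn) fun X hX x hx y hy => ?_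
  rcases hX with rfl | rfl | rfl
  · obtain ⟨k, rfl⟩ := hx
    obtain ⟨l, rfl⟩ := hy
    refine ⟨_, hrot (l - k), ?_⟩
    rw [cover_diag_mulVec]
    have e : (Real.pi + 2 * k * Real.pi) / n + 2 * (((l - k : ℤ) : ℝ) * (Real.pi / n)) =
        (Real.pi + 2 * l * Real.pi) / n := by
      push_cast
      ring
    rw [e]
  · obtain ⟨k, rfl⟩ := hx
    obtain ⟨l, rfl⟩ := hy
    refine ⟨_, hrot (l - k), ?_⟩
    rw [cover_diag_mulVec]
    have e : 2 * k * Real.pi / n + 2 * (((l - k : ℤ) : ℝ) * (Real.pi / n)) =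
        2 * l * Real.pi / n := by
      push_cast
      ring
    rw [e]
  · have hone : ∀ x : Fin 3 → ℝ, (cover 1).1 *ᵥ x = x := fun x => by
      rw [map_one]
      exact Matrix.one_mulVec x
    rcases hx with rfl | rfl <;> rcases hy with rfl | rfl
    · exact ⟨1, Subgroup.one_mem _, hone _⟩
    · refine ⟨_, hflip, ?_⟩
      rw [hmat]
      funext i
      fin_cases i <;> simp [Matrix.mulVec, dotProduct, Fin.sum_univ_three]
    · refine ⟨_, hflip, ?_⟩
      rw [hmat]
      funext i
      fin_cases i <;> simp [Matrix.mulVec, dotProduct, Fin.sum_univ_three]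
    · exact ⟨1, Subgroup.one_mem _, hone _⟩

end Dihedral

/-! ### Finiteness of symmetry groups -/

section Finiteness

theorem finite_cover_fibre (R : SO3) : {A : SU2 | cover A = R}.Finite := by
  have hsq : ∀ c : ℂ, {x : ℂ | x ^ 2 = c}.Finite := fun c => by
    refine (Polynomial.nthRootsFinset 2 c).finite_toSet.subset fun x hx => ?_
    exact (Polynomial.mem_nthRootsFinset two_pos c).2 hx
  -- The lower right block of `coverMatrix α β` determines `α² ± β²`; `a` and `b` are the resulting
  -- values of `α²` and `β²`.
  let a : ℂ := ⟨(R.1 1 1 + R.1 2 2) / 2, (R.1 2 1 - R.1 1 2) / 2⟩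
  let b : ℂ := ⟨(R.1 1 1 - R.1 2 2) / 2, -(R.1 2 1 + R.1 1 2) / 2⟩
  refine Set.Finite.of_finite_image (f := fun A : SU2 => (A.1 0 0, A.1 1 0))
    (((hsq a).prod (hsq b)).subset ?_) ?_
  · rintro - ⟨A, rfl, rfl⟩
    have h11 : (cover A).1 1 1 = (A.1 0 0 ^ 2 + A.1 1 0 ^ 2).re := rfl
    have h12 : (cover A).1 1 2 = -(A.1 0 0 ^ 2 + A.1 1 0 ^ 2).im := rfl
    have h21 : (cover A).1 2 1 = (A.1 0 0 ^ 2 - A.1 1 0 ^ 2).im := rfl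
    have h22 : (cover A).1 2 2 = (A.1 0 0 ^ 2 - A.1 1 0 ^ 2).re := rfl
    rw [Complex.add_re] at h11
    rw [Complex.add_im] at h12
    rw [Complex.sub_im] at h21
    rw [Complex.sub_re] at h22
    constructor
    · apply Complex.ext
      · change _ = ((cover A).1 1 1 + (cover A).1 2 2) / 2
        rw [h11, h22]
        ring
      · change _ = ((cover A).1 2 1 - (cover A).1 1 2) / 2
        rw [h21, h12]
        ring
    · apply Complex.ext
      · change _ = ((cover A).1 1 1 - (cover A).1 2 2) / 2
        rw [h11, h22]
        ring
      · change _ = -((cover A).1 2 1 + (cover A).1 1 2) / 2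
        rw [h21, h12]
        ring
  · intro A _ B _ hAB
    exact SU2.ext_col (Prod.ext_iff.1 hAB).1 (Prod.ext_iff.1 hAB).2

/-- A group of rotations that preserves a finite set whose sums of pairs contain multiples of the
coordinate vectors is finite, and so is its preimage in `SU(2)`. -/
theorem finite_of_preserves {G : Subgroup SU2} {W : Set (Fin 3 → ℝ)} (hW : W.Finite)
    (hspan : ∀ i, ∃ u ∈ W, ∃ w ∈ W, ∃ c : ℝ, c ≠ 0 ∧ u + w = c • Pi.single i 1)
    (hG : ∀ g ∈ G, ∀ x ∈ W, (cover g).1 *ᵥ x ∈ W) : Finite G := by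
  choose u hu w hw c hc he using hspan
  -- A rotation is determined by the images of the `u i` and `w i`, whose sums span `ℝ³`, and these
  -- images lie in a finite set.
  have hfin : {R : SO3 | ∀ x ∈ W, R.1 *ᵥ x ∈ W}.Finite := by
    refine Set.Finite.of_finite_image (f := fun R : SO3 => fun i => (R.1 *ᵥ u i, R.1 *ᵥ w i))
      ((Set.Finite.pi' (t := fun _ => W ×ˢ W) fun _ => hW.prod hW).subset ?_) ?_
    · rintro - ⟨R, hR, rfl⟩ i
      exact ⟨hR _ (hu i), hR _ (hw i)⟩
    · intro R _ R' _ hRR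
      apply Subtype.ext
      apply Matrix.ext_of_mulVec_single
      intro i
      have h := Prod.ext_iff.1 (congrFun hRR i)
      have h1 : R.1 *ᵥ (u i + w i) = R'.1 *ᵥ (u i + w i) := by
        rw [Matrix.mulVec_add, Matrix.mulVec_add]
        exact congrArg₂ (· + ·) h.1 h.2
      rw [he, Matrix.mulVec_smul, Matrix.mulVec_smul] at h1
      exact smul_right_injective _ (hc i) h1
  have := (hfin.preimage' (f := cover) fun R _ => finite_cover_fibre R)
  exact Set.Finite.to_subtype (this.subset fun g hg => hG g hg)

end Finiteness

/-! ### Transitivity on vertices, edges and faces from the star of one vertex -/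

section Rotations

/-- `y` is the image of `x` under a rotation in the image of `G`. -/
def Moves (G : Subgroup SU2) (x y : Fin 3 → ℝ) : Prop := ∃ g ∈ G, (cover g).1 *ᵥ x = y

variable {G : Subgroup SU2} {x y z : Fin 3 → ℝ}

theorem cover_mulVec_mulVec (g h : SU2) (x : Fin 3 → ℝ) :
    (cover g).1 *ᵥ ((cover h).1 *ᵥ x) = (cover (g * h)).1 *ᵥ x := by
  rw [map_mul, SO3.mulVec_mulVec]

theorem Moves.refl (x : Fin 3 → ℝ) : Moves G x x :=
  ⟨1, G.one_mem, by rw [map_one]; exact Matrix.one_mulVec x⟩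

theorem Moves.trans (h : Moves G x y) (h' : Moves G y z) : Moves G x z := by
  obtain ⟨g, hg, rfl⟩ := h
  obtain ⟨g', hg', rfl⟩ := h'
  exact ⟨g' * g, G.mul_mem hg' hg, by rw [cover_mulVec_mulVec]⟩

theorem Moves.symm (h : Moves G x y) : Moves G y x := by
  obtain ⟨g, hg, rfl⟩ := h
  exact ⟨g⁻¹, G.inv_mem hg, by rw [map_inv, SO3.inv_mulVec_mulVec]⟩

theorem radial_mulVec (R : SO3) (x : Fin 3 → ℝ) : radial (R.1 *ᵥ x) = R.1 *ᵥ radial x := by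
  rw [radial, radial, SO3.mulVec_dotProduct_mulVec, Matrix.mulVec_smul]

theorem Moves.radial (h : Moves G x y) : Moves G (radial x) (radial y) := by
  obtain ⟨g, hg, rfl⟩ := h
  exact ⟨g, hg, (radial_mulVec _ _).symm⟩

namespace Polyhedron

/-- The vertices of `Q` are the multiples by `r` of the elements of `W`. -/
structure IsModel (Q : Polyhedron) (r : ℝ) (W : Set (Fin 3 → ℝ)) : Prop where
  pos : 0 < r
  finite : W.Finite
  vertices_eq : Q.vertices = (fun x => r • x) '' W
  norm : ∀ x ∈ W, (r • x) ⬝ᵥ (r • x) = 1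

variable {Q : Polyhedron} {r : ℝ} {W : Set (Fin 3 → ℝ)}

theorem IsModel.mem_vertices (h : Q.IsModel r W) {x : Fin 3 → ℝ} : r • x ∈ Q.vertices ↔ x ∈ W := by
  rw [h.vertices_eq]
  constructor
  · rintro ⟨y, hy, e⟩
    rwa [← smul_right_injective _ h.pos.ne' e]
  · exact fun hx => ⟨x, hx, rfl⟩

theorem IsModel.finite_vertices (h : Q.IsModel r W) : Q.vertices.Finite := by
  rw [h.vertices_eq]
  exact h.finite.image _

theorem IsModel.norm_vertices (h : Q.IsModel r W) : ∀ x ∈ Q.vertices, x ⬝ᵥ x = 1 := by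
  rw [h.vertices_eq]
  rintro - ⟨x, hx, rfl⟩
  exact h.norm x hx

theorem IsModel.mulVec_mem_vertices (h : Q.IsModel r W) {g : SU2} (hg : g ∈ Q.rotations.comap cover)
    {x : Fin 3 → ℝ} (hx : x ∈ Q.vertices) : (cover g).1 *ᵥ x ∈ Q.vertices := by
  have hg' : cover g • {x : S2 | x.1 ∈ Q.vertices} = {x : S2 | x.1 ∈ Q.vertices} :=
    MulAction.mem_stabilizer_iff.1 (Subgroup.mem_comap.1 hg)
  let p : S2 := ⟨x, h.norm_vertices x hx⟩
  have hp : cover g • p ∈ {x : S2 | x.1 ∈ Q.vertices} := by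
    rw [← hg']
    exact Set.smul_mem_smul_set (show p ∈ {x : S2 | x.1 ∈ Q.vertices} from hx)
  exact hp

theorem IsModel.mulVec_mem (h : Q.IsModel r W) {g : SU2} (hg : g ∈ Q.rotations.comap cover)
    {x : Fin 3 → ℝ} (hx : x ∈ W) : (cover g).1 *ᵥ x ∈ W := by
  rw [← h.mem_vertices] at hx ⊢
  rw [← Matrix.mulVec_smul]
  exact h.mulVec_mem_vertices hg hx

/-- For a finite vertex set, being mapped into itself is enough to be preserved. -/
theorem IsModel.mem_comap (h : Q.IsModel r W) {g : SU2} (hg : ∀ x ∈ W, (cover g).1 *ᵥ x ∈ W) :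
    g ∈ Q.rotations.comap cover := by
  have hfin : {x : S2 | x.1 ∈ Q.vertices}.Finite :=
    h.finite_vertices.preimage (f := fun x : S2 => x.1) Subtype.val_injective.injOn
  refine Subgroup.mem_comap.2 ((MulAction.mem_stabilizer_set_iff_smul_set_subset hfin).2 ?_)
  rintro - ⟨x, hx, rfl⟩
  change x.1 ∈ Q.vertices at hx
  rw [h.vertices_eq] at hx
  obtain ⟨y, hy, e⟩ := hx
  change (cover g).1 *ᵥ x.1 ∈ Q.vertices
  rw [← e, Matrix.mulVec_smul, h.mem_vertices]
  exact hg y hy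

theorem IsModel.adjacent_mulVec (h : Q.IsModel r W) {g : SU2} (hg : g ∈ Q.rotations.comap cover)
    {u v : Fin 3 → ℝ} (huv : Q.Adjacent u v) : Q.Adjacent ((cover g).1 *ᵥ u) ((cover g).1 *ᵥ v) := by
  obtain ⟨hu, hv, hne, hmax⟩ := huv
  refine ⟨h.mulVec_mem_vertices hg hu, h.mulVec_mem_vertices hg hv, fun e => hne ?_, ?_⟩
  · rw [← SO3.inv_mulVec_mulVec (cover g) u, e, SO3.inv_mulVec_mulVec]
  · rw [SO3.mulVec_dotProduct_mulVec]
    exact hmax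

theorem IsModel.adjacent_le (h : Q.IsModel r W) {u v : Fin 3 → ℝ}
    (huv : Q.Adjacent (r • u) (r • v)) : u ≠ v ∧ ∀ x ∈ W, ∀ y ∈ W, x ≠ y → x ⬝ᵥ y ≤ u ⬝ᵥ v := by
  obtain ⟨-, -, hne, hmax⟩ := huv
  refine ⟨fun e => hne (by rw [e]), fun x hx y hy hxy => ?_⟩
  have := hmax _ (h.mem_vertices.2 hx) _ (h.mem_vertices.2 hy)
    (fun e => hxy (smul_right_injective _ h.pos.ne' e))
  rw [smul_dotProduct, dotProduct_smul, smul_dotProduct, dotProduct_smul] at this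
  simp only [smul_eq_mul] at this
  exact le_of_mul_le_mul_left (le_of_mul_le_mul_left this h.pos) h.pos

/-- A vertex `v` of the model, the rotation `ρ` by one step around it, and the `k` neighbours of `v`,
which are the iterated images of `n` under `ρ`. -/
structure HasStar (Q : Polyhedron) (W : Set (Fin 3 → ℝ)) (v n : Fin 3 → ℝ) (ρ : SU2) (k : ℕ) : Prop where
  vertex_mem : v ∈ W
  neighbour_mem : n ∈ W
  ne : v ≠ n
  mem_rotations : ρ ∈ Q.rotations.comap cover
  fixed : (cover ρ).1 *ᵥ v = v
  moves : ∀ x ∈ W, Moves (Q.rotations.comap cover) x v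
  period_pos : 0 < k
  period : (cover (ρ ^ k)).1 *ᵥ n = n
  neighbours : ∀ x ∈ W, v ≠ x → v ⬝ᵥ n ≤ v ⬝ᵥ x → ∃ i < k, x = (cover (ρ ^ i)).1 *ᵥ n
  opposite : ∀ i < k, n ≠ (cover (ρ ^ i)).1 *ᵥ n → v ⬝ᵥ n ≤ n ⬝ᵥ ((cover (ρ ^ i)).1 *ᵥ n) →
    i = 1 ∨ i + 1 = k

variable {v n : Fin 3 → ℝ} {ρ : SU2} {k : ℕ}

theorem HasStar.pow_fixed (hs : Q.HasStar W v n ρ k) (i : ℕ) : (cover (ρ ^ i)).1 *ᵥ v = v := by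
  induction i with
  | zero =>
    rw [pow_zero, map_one]
    exact Matrix.one_mulVec v
  | succ i ih => rw [pow_succ, ← cover_mulVec_mulVec, hs.fixed, ih]

theorem HasStar.pow_period (hs : Q.HasStar W v n ρ k) (i j : ℕ) :
    (cover (ρ ^ (i + k * j))).1 *ᵥ n = (cover (ρ ^ i)).1 *ᵥ n := by
  induction j with
  | zero => simp
  | succ j ih =>
    rw [mul_add, mul_one, ← add_assoc, pow_add, ← cover_mulVec_mulVec, hs.period, ih]

theorem HasStar.exists_neighbour (h : Q.IsModel r W) (hs : Q.HasStar W v n ρ k) {u : Fin 3 → ℝ}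
    (hu : Q.Adjacent (r • v) u) : ∃ i < k, u = r • ((cover (ρ ^ i)).1 *ᵥ n) := by
  have huV := hu.2.1
  rw [h.vertices_eq] at huV
  obtain ⟨x, hx, rfl⟩ := huV
  obtain ⟨hne, hle⟩ := h.adjacent_le hu
  obtain ⟨i, hi, e⟩ := hs.neighbours x hx hne (hle _ hs.vertex_mem _ hs.neighbour_mem hs.ne)
  exact ⟨i, hi, by rw [e]⟩

theorem HasStar.exists_vertex (h : Q.IsModel r W) (hs : Q.HasStar W v n ρ k) {u : Fin 3 → ℝ}
    (hu : u ∈ Q.vertices) : ∃ g ∈ Q.rotations.comap cover, (cover g).1 *ᵥ u = r • v := by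
  rw [h.vertices_eq] at hu
  obtain ⟨x, hx, rfl⟩ := hu
  obtain ⟨g, hg, e⟩ := hs.moves x hx
  exact ⟨g, hg, by rw [Matrix.mulVec_smul, e]⟩

/-- Move one end of the edge to `v`; the other end becomes a neighbour of `v`, which a power of `ρ`
carries back to `n`. -/
theorem HasStar.moves_edge (h : Q.IsModel r W) (hs : Q.HasStar W v n ρ k) {x : Fin 3 → ℝ}
    (hx : x ∈ Q.edges) : Moves (Q.rotations.comap cover) x (LinkOrbits.radial (r • v + r • n)) := by
  obtain ⟨u, w, huw, rfl⟩ := hx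
  apply Moves.radial
  obtain ⟨g, hg, e⟩ := hs.exists_vertex h huw.1
  have hadj := h.adjacent_mulVec hg huw
  rw [e] at hadj
  obtain ⟨i, -, hi⟩ := hs.exists_neighbour h hadj
  have m1 : Moves (Q.rotations.comap cover) (u + w) (r • v + r • ((cover (ρ ^ i)).1 *ᵥ n)) :=
    ⟨g, hg, by rw [Matrix.mulVec_add, e, hi]⟩
  have m2 : Moves (Q.rotations.comap cover) (r • v + r • n) (r • v + r • ((cover (ρ ^ i)).1 *ᵥ n)) :=
    ⟨ρ ^ i, pow_mem hs.mem_rotations i, by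
      rw [Matrix.mulVec_add, Matrix.mulVec_smul, Matrix.mulVec_smul, hs.pow_fixed]⟩
  exact m1.trans m2.symm

/-- Move one corner to `v` and a second one to `n`. By `opposite` the third is then `ρ n` or `ρ⁻¹
n`, and `ρ` carries the second configuration to the first. -/
theorem HasStar.moves_face (h : Q.IsModel r W) (hs : Q.HasStar W v n ρ k) {x : Fin 3 → ℝ}
    (hx : x ∈ Q.faces) :
    Moves (Q.rotations.comap cover) x
      (LinkOrbits.radial (r • v + r • n + r • ((cover ρ).1 *ᵥ n))) := by
  obtain ⟨u, w, y, huw, hwy, huy, rfl⟩ := hx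
  apply Moves.radial
  obtain ⟨g, hg, e⟩ := hs.exists_vertex h huw.1
  obtain ⟨i, hik, hi⟩ := hs.exists_neighbour h (e ▸ h.adjacent_mulVec hg huw)
  obtain ⟨j, hjk, hj⟩ := hs.exists_neighbour h (e ▸ h.adjacent_mulVec hg huy)
  have hg' : ρ ^ (k - i) * g ∈ Q.rotations.comap cover := mul_mem (pow_mem hs.mem_rotations _) hg
  -- This is `j - i` modulo `k`, the position of the third corner relative to the second.
  set c := (j + (k - i)) % k with hc
  have hck : c < k := Nat.mod_lt _ hs.period_pos
  have ew : (cover (ρ ^ (k - i) * g)).1 *ᵥ w = r • n := by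
    rw [← cover_mulVec_mulVec, hi, Matrix.mulVec_smul, cover_mulVec_mulVec, ← pow_add,
      Nat.sub_add_cancel hik.le, hs.period]
  have ey : (cover (ρ ^ (k - i) * g)).1 *ᵥ y = r • ((cover (ρ ^ c)).1 *ᵥ n) := by
    rw [← cover_mulVec_mulVec, hj, Matrix.mulVec_smul, cover_mulVec_mulVec, ← pow_add,
      add_comm (k - i), ← Nat.mod_add_div (j + (k - i)) k, hs.pow_period]
  have hadj := h.adjacent_mulVec hg' hwy
  rw [ew, ey] at hadj
  obtain ⟨hne, hle⟩ := h.adjacent_le hadj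
  have m1 : Moves (Q.rotations.comap cover) (u + w + y)
      (r • v + r • n + r • ((cover (ρ ^ c)).1 *ᵥ n)) :=
    ⟨ρ ^ (k - i) * g, hg', by
      rw [Matrix.mulVec_add, Matrix.mulVec_add, ew, ey, ← cover_mulVec_mulVec, e, Matrix.mulVec_smul,
        hs.pow_fixed]⟩
  rcases hs.opposite c hck hne (hle _ hs.vertex_mem _ hs.neighbour_mem hs.ne) with h1 | h1
  · rw [h1, pow_one] at m1
    exact m1
  · refine m1.trans ⟨ρ, hs.mem_rotations, ?_⟩
    rw [Matrix.mulVec_add, Matrix.mulVec_add, Matrix.mulVec_smul, Matrix.mulVec_smul,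
      Matrix.mulVec_smul, hs.fixed, cover_mulVec_mulVec, ← pow_succ', h1, hs.period]
    abel

theorem morsePair_of_hasStar (h : Q.IsModel r W) (hs : Q.HasStar W v n ρ k)
    (hspan : ∀ i, ∃ u ∈ W, ∃ w ∈ W, ∃ c : ℝ, c ≠ 0 ∧ u + w = c • Pi.single i 1)
    {f : (Fin 3 → ℝ) → ℝ} (hf : ContDiff ℝ ∞ f) (ha : IsAdapted f Q.vertices Q.edges Q.faces) :
    MorsePair (Q.rotations.comap cover) f := by
  refine ha.morsePair hf (finite_of_preserves h.finite hspan fun g hg x hx => h.mulVec_mem hg hx) ?_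
  rintro X (rfl | rfl | rfl) x hx y hy
  · exact Moves.trans (hs.exists_vertex h hx) (Moves.symm (hs.exists_vertex h hy))
  · exact (hs.moves_edge h hx).trans (hs.moves_edge h hy).symm
  · exact (hs.moves_face h hx).trans (hs.moves_face h hy).symm

end Polyhedron

end Rotations

/-! ### Explicit rotations -/

section Rotations

theorem cover_ofPair_mulVec (α β : ℂ) (h : Complex.normSq α + Complex.normSq β = 1) (x : Fin 3 → ℝ) :
    (cover (SU2.ofPair α β h)).1 *ᵥ x = coverMatrix α β *ᵥ x := rfl

theorem mulVec_fin_three (M : Matrix (Fin 3) (Fin 3) ℝ) (a b c : ℝ) :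
    M *ᵥ ![a, b, c] = ![M 0 0 * a + M 0 1 * b + M 0 2 * c, M 1 0 * a + M 1 1 * b + M 1 2 * c,
      M 2 0 * a + M 2 1 * b + M 2 2 * c] := by
  funext i
  fin_cases i <;> simp [Matrix.mulVec, dotProduct, Fin.sum_univ_three]

/-- A lift of the half turn about the first coordinate axis. -/
def halfTurn₀ : SU2 := SU2.ofPair Complex.I 0 (by simp)

/-- A lift of the half turn about the second coordinate axis. -/
def halfTurn₁ : SU2 := SU2.ofPair 0 1 (by simp)

/-- A lift of the cyclic permutation of the coordinates. -/
def cyclicTurn : SU2 := SU2.ofPair ⟨1 / 2, 1 / 2⟩ ⟨1 / 2, -(1 / 2)⟩ (by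
  simp only [Complex.normSq_mk]; norm_num)

/-- A lift of the quarter turn about the first coordinate axis. -/
def quarterTurn : SU2 := SU2.diag (Real.pi / 4)

/-- A lift of a rotation of order five. -/
def fifthTurn : SU2 :=
  SU2.ofPair ⟨Real.goldenRatio / 2, 0⟩ ⟨(Real.goldenRatio - 1) / 2, -(1 / 2)⟩ (by
    simp only [Complex.normSq_mk]
    linear_combination (1 / 2 : ℝ) * Real.goldenRatio_sq)

theorem halfTurn₀_mulVec (a b c : ℝ) : (cover halfTurn₀).1 *ᵥ ![a, b, c] = ![a, -b, -c] := by
  rw [halfTurn₀, cover_ofPair_mulVec, mulVec_fin_three]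
  simp [coverMatrix]

theorem halfTurn₁_mulVec (a b c : ℝ) : (cover halfTurn₁).1 *ᵥ ![a, b, c] = ![-a, b, -c] := by
  rw [halfTurn₁, cover_ofPair_mulVec, mulVec_fin_three]
  simp [coverMatrix]

theorem cyclicTurn_mulVec (a b c : ℝ) : (cover cyclicTurn).1 *ᵥ ![a, b, c] = ![c, a, b] := by
  rw [cyclicTurn, cover_ofPair_mulVec, mulVec_fin_three]
  simp [coverMatrix, Complex.normSq_mk, pow_two]
  norm_num

theorem quarterTurn_mulVec (a b c : ℝ) : (cover quarterTurn).1 *ᵥ ![a, b, c] = ![a, -c, b] := by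
  rw [quarterTurn, cover_diag, mulVec_fin_three, show 2 * (Real.pi / 4) = Real.pi / 2 by ring]
  simp

/-- The half angle of this turn is `π / 5`, with `cos (π / 5) = φ / 2`, and its axis is the vertex
`(0, 1, φ)`, since `(φ - 1) : 1 = 1 : φ`. -/
theorem fifthTurn_mulVec (a b c : ℝ) : (cover fifthTurn).1 *ᵥ ![a, b, c] =
    ![((Real.goldenRatio - 1) * a - Real.goldenRatio * b + c) / 2,
      (Real.goldenRatio * a + b + (Real.goldenRatio - 1) * c) / 2,
      (-a + (Real.goldenRatio - 1) * b + Real.goldenRatio * c) / 2] := by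
  have h := Real.goldenRatio_sq
  rw [fifthTurn, cover_ofPair_mulVec, mulVec_fin_three]
  simp only [coverMatrix, Complex.normSq_mk, pow_two, Complex.mul_re, Complex.mul_im, Complex.sub_re,
    Complex.sub_im, Complex.add_re, Complex.add_im, Complex.conj_re, Complex.conj_im]
  generalize Real.goldenRatio = φ at h
  funext i
  fin_cases i <;> simp <;> grind

theorem cover_pow_succ_mulVec (g : SU2) (i : ℕ) (x : Fin 3 → ℝ) :
    (cover (g ^ (i + 1))).1 *ᵥ x = (cover g).1 *ᵥ ((cover (g ^ i)).1 *ᵥ x) := by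
  rw [cover_mulVec_mulVec, pow_succ']

theorem cover_pow_zero_mulVec (g : SU2) (x : Fin 3 → ℝ) : (cover (g ^ 0)).1 *ᵥ x = x := by
  rw [pow_zero, map_one]
  exact Matrix.one_mulVec x

theorem moves_of_eq {G : Subgroup SU2} {g : SU2} (hg : g ∈ G) {x y : Fin 3 → ℝ}
    (h : (cover g).1 *ᵥ x = y) : Moves G x y := ⟨g, hg, h⟩

end Rotations

/-! ### The tetrahedron, octahedron and icosahedron -/

namespace Polyhedron

theorem isModel_of_radial {Q : Polyhedron} {W : Set (Fin 3 → ℝ)} {c : ℝ} (hc : 0 < c)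
    (hW : ∀ x ∈ W, x ⬝ᵥ x = c) (hfin : W.Finite) (h : Q.vertices = radial '' W) :
    Q.IsModel (√c)⁻¹ W := by
  refine ⟨inv_pos.2 (Real.sqrt_pos.2 hc), hfin, ?_, fun x hx => ?_⟩
  · rw [h]
    exact Set.image_congr fun x hx => by rw [radial, hW x hx]
  · rw [smul_dotProduct, dotProduct_smul, hW x hx, smul_eq_mul, smul_eq_mul, ← mul_assoc,
      ← mul_inv, Real.mul_self_sqrt hc.le, inv_mul_cancel₀ hc.ne']

section Tetrahedron

/-- The vertices of a tetrahedron inscribed in a cube. -/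
def tetrahedronModel : Set (Fin 3 → ℝ) := {![1, 1, 1], ![1, -1, -1], ![-1, 1, -1], ![-1, -1, 1]}

theorem isModel_tetrahedron : tetrahedron.IsModel (√3)⁻¹ tetrahedronModel := by
  refine isModel_of_radial (by norm_num) ?_ (by simp [tetrahedronModel]) rfl
  rintro x (rfl | rfl | rfl | rfl) <;> simp [dotProduct, Fin.sum_univ_three] <;> norm_num

theorem hasStar_tetrahedron :
    tetrahedron.HasStar tetrahedronModel ![1, 1, 1] ![1, -1, -1] cyclicTurn 3 := by
  have m0 : halfTurn₀ ∈ tetrahedron.rotations.comap cover := by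
    refine isModel_tetrahedron.mem_comap ?_
    rintro x (rfl | rfl | rfl | rfl) <;> rw [halfTurn₀_mulVec] <;> simp [tetrahedronModel]
  have m1 : halfTurn₁ ∈ tetrahedron.rotations.comap cover := by
    refine isModel_tetrahedron.mem_comap ?_
    rintro x (rfl | rfl | rfl | rfl) <;> rw [halfTurn₁_mulVec] <;> simp [tetrahedronModel]
  have mc : cyclicTurn ∈ tetrahedron.rotations.comap cover := by
    refine isModel_tetrahedron.mem_comap ?_
    rintro x (rfl | rfl | rfl | rfl) <;> rw [cyclicTurn_mulVec] <;> simp [tetrahedronModel]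
  have p0 := cover_pow_zero_mulVec cyclicTurn ![1, -1, -1]
  have p1 : (cover (cyclicTurn ^ 1)).1 *ᵥ ![1, -1, -1] = ![-1, 1, -1] := by
    rw [cover_pow_succ_mulVec, p0, cyclicTurn_mulVec]
  have p2 : (cover (cyclicTurn ^ 2)).1 *ᵥ ![1, -1, -1] = ![-1, -1, 1] := by
    rw [cover_pow_succ_mulVec, p1, cyclicTurn_mulVec]
  have p3 : (cover (cyclicTurn ^ 3)).1 *ᵥ ![1, -1, -1] = ![1, -1, -1] := by
    rw [cover_pow_succ_mulVec, p2, cyclicTurn_mulVec]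
  refine ⟨by simp [tetrahedronModel], by simp [tetrahedronModel], fun e => ?_, mc,
    cyclicTurn_mulVec _ _ _, ?_, by norm_num, p3, ?_, ?_⟩
  · have := congrFun e 1
    norm_num at this
  · rintro x (rfl | rfl | rfl | rfl)
    · exact Moves.refl _
    · exact moves_of_eq m0 (by rw [halfTurn₀_mulVec]; simp)
    · exact moves_of_eq m1 (by rw [halfTurn₁_mulVec]; simp)
    · exact moves_of_eq (mul_mem m0 m1) (by
        rw [← cover_mulVec_mulVec, halfTurn₁_mulVec, halfTurn₀_mulVec]; simp)
  · rintro x (rfl | rfl | rfl | rfl) hne -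
    · exact absurd rfl hne
    · exact ⟨0, by norm_num, p0.symm⟩
    · exact ⟨1, by norm_num, p1.symm⟩
    · exact ⟨2, by norm_num, p2.symm⟩
  · intro i hi hne _
    interval_cases i
    · exact absurd p0.symm hne
    · exact Or.inl rfl
    · exact Or.inr rfl

theorem span_tetrahedron (i : Fin 3) : ∃ u ∈ tetrahedronModel, ∃ w ∈ tetrahedronModel,
    ∃ c : ℝ, c ≠ 0 ∧ u + w = c • Pi.single i 1 := by
  refine ⟨![1, 1, 1], by simp [tetrahedronModel], ?_⟩
  fin_cases i
  · refine ⟨![1, -1, -1], by simp [tetrahedronModel], 2, two_ne_zero, ?_⟩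
    funext j
    fin_cases j <;> simp <;> norm_num
  · refine ⟨![-1, 1, -1], by simp [tetrahedronModel], 2, two_ne_zero, ?_⟩
    funext j
    fin_cases j <;> simp <;> norm_num
  · refine ⟨![-1, -1, 1], by simp [tetrahedronModel], 2, two_ne_zero, ?_⟩
    funext j
    fin_cases j <;> simp <;> norm_num

end Tetrahedron

section Octahedron

/-- The vertices of the standard octahedron. -/
def octahedronModel : Set (Fin 3 → ℝ) :=
  {![1, 0, 0], ![-1, 0, 0], ![0, 1, 0], ![0, -1, 0], ![0, 0, 1], ![0, 0, -1]}

theorem isModel_octahedron : octahedron.IsModel 1 octahedronModel := by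
  refine ⟨one_pos, by simp [octahedronModel], by simp [vertices, octahedronModel], ?_⟩
  rintro x (rfl | rfl | rfl | rfl | rfl | rfl) <;> simp [dotProduct, Fin.sum_univ_three]

theorem hasStar_octahedron :
    octahedron.HasStar octahedronModel ![1, 0, 0] ![0, 1, 0] quarterTurn 4 := by
  have m1 : halfTurn₁ ∈ octahedron.rotations.comap cover := by
    refine isModel_octahedron.mem_comap ?_
    rintro x (rfl | rfl | rfl | rfl | rfl | rfl) <;> rw [halfTurn₁_mulVec] <;> simp [octahedronModel]
  have mc : cyclicTurn ∈ octahedron.rotations.comap cover := by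
    refine isModel_octahedron.mem_comap ?_
    rintro x (rfl | rfl | rfl | rfl | rfl | rfl) <;> rw [cyclicTurn_mulVec] <;> simp [octahedronModel]
  have mq : quarterTurn ∈ octahedron.rotations.comap cover := by
    refine isModel_octahedron.mem_comap ?_
    rintro x (rfl | rfl | rfl | rfl | rfl | rfl) <;> rw [quarterTurn_mulVec] <;>
      simp [octahedronModel]
  have p0 := cover_pow_zero_mulVec quarterTurn ![0, 1, 0]
  have p1 : (cover (quarterTurn ^ 1)).1 *ᵥ ![0, 1, 0] = ![0, 0, 1] := by
    rw [cover_pow_succ_mulVec, p0, quarterTurn_mulVec, neg_zero]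
  have p2 : (cover (quarterTurn ^ 2)).1 *ᵥ ![0, 1, 0] = ![0, -1, 0] := by
    rw [cover_pow_succ_mulVec, p1, quarterTurn_mulVec]
  have p3 : (cover (quarterTurn ^ 3)).1 *ᵥ ![0, 1, 0] = ![0, 0, -1] := by
    rw [cover_pow_succ_mulVec, p2, quarterTurn_mulVec, neg_zero]
  have p4 : (cover (quarterTurn ^ 4)).1 *ᵥ ![0, 1, 0] = ![0, 1, 0] := by
    rw [cover_pow_succ_mulVec, p3, quarterTurn_mulVec, neg_neg]
  have b0 : Moves (octahedron.rotations.comap cover) ![-1, 0, 0] ![1, 0, 0] :=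
    moves_of_eq m1 (by rw [halfTurn₁_mulVec]; simp)
  have b2 : ∀ a : ℝ, Moves (octahedron.rotations.comap cover) ![0, 0, a] ![a, 0, 0] := fun a =>
    moves_of_eq mc (by rw [cyclicTurn_mulVec])
  have b1 : ∀ a : ℝ, Moves (octahedron.rotations.comap cover) ![0, a, 0] ![a, 0, 0] := fun a =>
    (moves_of_eq mc (cyclicTurn_mulVec _ _ _)).trans (b2 a)
  refine ⟨by simp [octahedronModel], by simp [octahedronModel], fun e => ?_, mq,
    by rw [quarterTurn_mulVec, neg_zero], ?_, by norm_num, p4, ?_, ?_⟩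
  · have := congrFun e 0
    norm_num at this
  · rintro x (rfl | rfl | rfl | rfl | rfl | rfl)
    · exact Moves.refl _
    · exact b0
    · exact b1 _
    · exact (b1 _).trans b0
    · exact b2 _
    · exact (b2 _).trans b0
  · rintro x (rfl | rfl | rfl | rfl | rfl | rfl) hne hle
    · exact absurd rfl hne
    -- The antipode of `v` is excluded: its product with `v` is `-1`, while neighbours have product
    -- `0`.
    · rw [dotProduct, dotProduct, Fin.sum_univ_three, Fin.sum_univ_three] at hle
      change (1 * 0 + 0 * 1 + 0 * 0 : ℝ) ≤ 1 * -1 + 0 * 0 + 0 * 0 at hle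
      norm_num at hle
    · exact ⟨0, by norm_num, p0.symm⟩
    · exact ⟨2, by norm_num, p2.symm⟩
    · exact ⟨1, by norm_num, p1.symm⟩
    · exact ⟨3, by norm_num, p3.symm⟩
  · intro i hi hne hle
    interval_cases i
    · exact absurd p0.symm hne
    · exact Or.inl rfl
    -- Opposite neighbours of `v` are antipodal, hence not adjacent.
    · rw [p2] at hle
      rw [dotProduct, dotProduct, Fin.sum_univ_three, Fin.sum_univ_three] at hle
      change (1 * 0 + 0 * 1 + 0 * 0 : ℝ) ≤ 0 * 0 + 1 * -1 + 0 * 0 at hle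
      norm_num at hle
    · exact Or.inr rfl

theorem span_octahedron (i : Fin 3) : ∃ u ∈ octahedronModel, ∃ w ∈ octahedronModel,
    ∃ c : ℝ, c ≠ 0 ∧ u + w = c • Pi.single i 1 := by
  refine ⟨Pi.single i 1, ?_, Pi.single i 1, ?_, 2, two_ne_zero, (two_smul ℝ _).symm⟩ <;>
  · have h0 : (Pi.single 0 1 : Fin 3 → ℝ) = ![1, 0, 0] := by
      funext j
      fin_cases j <;> simp
    have h1 : (Pi.single 1 1 : Fin 3 → ℝ) = ![0, 1, 0] := by
      funext j
      fin_cases j <;> simp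
    have h2 : (Pi.single 2 1 : Fin 3 → ℝ) = ![0, 0, 1] := by
      funext j
      fin_cases j <;> simp
    fin_cases i
    · change Pi.single 0 1 ∈ _
      rw [h0]
      simp [octahedronModel]
    · change Pi.single 1 1 ∈ _
      rw [h1]
      simp [octahedronModel]
    · change Pi.single 2 1 ∈ _
      rw [h2]
      simp [octahedronModel]

end Octahedron

section Icosahedron

open Real (goldenRatio)

/-- The vertices of the standard icosahedron with edges of length two. -/
def icosahedronModel : Set (Fin 3 → ℝ) :=
  {x | ∃ s ∈ ({1, -1} : Set ℝ), ∃ t ∈ ({1, -1} : Set ℝ),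
    x = ![0, s, t * goldenRatio] ∨ x = ![s, t * goldenRatio, 0] ∨ x = ![t * goldenRatio, 0, s]}

theorem forall_mem_icosahedronModel {P : (Fin 3 → ℝ) → Prop} :
    (∀ x ∈ icosahedronModel, P x) ↔ ∀ s ∈ ({1, -1} : Set ℝ), ∀ t ∈ ({1, -1} : Set ℝ),
      P ![0, s, t * goldenRatio] ∧ P ![s, t * goldenRatio, 0] ∧ P ![t * goldenRatio, 0, s] := by
  constructor
  · intro h s hs t ht
    exact ⟨h _ ⟨s, hs, t, ht, Or.inl rfl⟩, h _ ⟨s, hs, t, ht, Or.inr (Or.inl rfl)⟩,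
      h _ ⟨s, hs, t, ht, Or.inr (Or.inr rfl)⟩⟩
  · rintro h x ⟨s, hs, t, ht, rfl | rfl | rfl⟩
    · exact (h s hs t ht).1
    · exact (h s hs t ht).2.1
    · exact (h s hs t ht).2.2

theorem finite_icosahedronModel : icosahedronModel.Finite := by
  have hF : ({1, -1} : Set ℝ).Finite := by simp
  have h := (((hF.prod hF).image fun p => (![0, p.1, p.2 * goldenRatio] : Fin 3 → ℝ)).union
    ((hF.prod hF).image fun p => (![p.1, p.2 * goldenRatio, 0] : Fin 3 → ℝ))).union
    ((hF.prod hF).image fun p => (![p.2 * goldenRatio, 0, p.1] : Fin 3 → ℝ))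
  refine h.subset (forall_mem_icosahedronModel.2 fun s hs t ht => ⟨?_, ?_, ?_⟩)
  · exact Or.inl (Or.inl ⟨(s, t), ⟨hs, ht⟩, rfl⟩)
  · exact Or.inl (Or.inr ⟨(s, t), ⟨hs, ht⟩, rfl⟩)
  · exact Or.inr ⟨(s, t), ⟨hs, ht⟩, rfl⟩

theorem isModel_icosahedron : icosahedron.IsModel (√(goldenRatio + 2))⁻¹ icosahedronModel := by
  have hφ := Real.goldenRatio_sq
  have hpos := Real.goldenRatio_pos
  refine isModel_of_radial (by positivity) ?_ finite_icosahedronModel rfl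
  refine forall_mem_icosahedronModel.2 fun s hs t ht => ?_
  have hs2 : s * s = 1 := by rcases hs with rfl | rfl <;> norm_num
  have ht2 : t * t = 1 := by rcases ht with rfl | rfl <;> norm_num
  simp only [dotProduct, Fin.sum_univ_three, Matrix.cons_val_zero, Matrix.cons_val_one, Matrix.cons_val]
  refine ⟨?_, ?_, ?_⟩ <;> linear_combination hs2 + goldenRatio ^ 2 * ht2 + hφ

theorem neg_mem_signs {s : ℝ} (hs : s ∈ ({1, -1} : Set ℝ)) : -s ∈ ({1, -1} : Set ℝ) := by
  rcases hs with rfl | rfl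
  · exact Or.inr rfl
  · exact Or.inl (neg_neg 1)

theorem mem_icosahedronModel {s t : ℝ} (hs : s ∈ ({1, -1} : Set ℝ)) (ht : t ∈ ({1, -1} : Set ℝ)) :
    ![0, s, t * goldenRatio] ∈ icosahedronModel ∧ ![s, t * goldenRatio, 0] ∈ icosahedronModel ∧
      ![t * goldenRatio, 0, s] ∈ icosahedronModel :=
  forall_mem_icosahedronModel.1 (fun _ h => h) s hs t ht

theorem fifthTurn_mem : fifthTurn ∈ icosahedron.rotations.comap cover := by
  have hφ := Real.goldenRatio_sq
  refine isModel_icosahedron.mem_comap (forall_mem_icosahedronModel.2 fun s hs t ht => ?_)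
  have h1 : (1 : ℝ) ∈ ({1, -1} : Set ℝ) := Or.inl rfl
  have h2 : (-1 : ℝ) ∈ ({1, -1} : Set ℝ) := Or.inr rfl
  have pp := mem_icosahedronModel h1 h1
  have pm := mem_icosahedronModel h1 h2
  have mp := mem_icosahedronModel h2 h1
  have mm := mem_icosahedronModel h2 h2
  have key : ∀ {a b c a' b' c' : ℝ}, ![a', b', c'] ∈ icosahedronModel →
      ((goldenRatio - 1) * a - goldenRatio * b + c) / 2 = a' →
      (goldenRatio * a + b + (goldenRatio - 1) * c) / 2 = b' →
      (-a + (goldenRatio - 1) * b + goldenRatio * c) / 2 = c' →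
      (cover fifthTurn).1 *ᵥ ![a, b, c] ∈ icosahedronModel := by
    rintro a b c a' b' c' hmem rfl rfl rfl
    rwa [fifthTurn_mulVec]
  rcases hs with rfl | rfl <;> rcases ht with rfl | rfl
  · exact ⟨key pp.1 (by grind) (by grind) (by grind), key mp.2.1 (by grind) (by grind) (by grind),
      key pp.2.1 (by grind) (by grind) (by grind)⟩
  · exact ⟨key mm.2.2 (by grind) (by grind) (by grind), key mp.2.2 (by grind) (by grind) (by grind),
      key mp.1 (by grind) (by grind) (by grind)⟩
  · exact ⟨key pp.2.2 (by grind) (by grind) (by grind), key pm.2.2 (by grind) (by grind) (by grind),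
      key pm.1 (by grind) (by grind) (by grind)⟩
  · exact ⟨key mm.1 (by grind) (by grind) (by grind), key pm.2.1 (by grind) (by grind) (by grind),
      key mm.2.1 (by grind) (by grind) (by grind)⟩

theorem fifthTurn_mulVec_eq {a b c a' b' c' : ℝ}
    (h0 : ((goldenRatio - 1) * a - goldenRatio * b + c) / 2 = a')
    (h1 : (goldenRatio * a + b + (goldenRatio - 1) * c) / 2 = b')
    (h2 : (-a + (goldenRatio - 1) * b + goldenRatio * c) / 2 = c') :
    (cover fifthTurn).1 *ᵥ ![a, b, c] = ![a', b', c'] := by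
  rw [fifthTurn_mulVec, h0, h1, h2]

/-- The cyclic permutation exchanges the three golden rectangles. In the rectangle of the target
vertex the first coordinate is zero, so the half turns realize all sign changes of the other two. -/
theorem moves_icosahedron : ∀ x ∈ icosahedronModel,
    Moves (icosahedron.rotations.comap cover) x ![0, 1, goldenRatio] := by
  have m0 : halfTurn₀ ∈ icosahedron.rotations.comap cover := by
    refine isModel_icosahedron.mem_comap (forall_mem_icosahedronModel.2 fun s hs t ht => ?_)
    simp only [halfTurn₀_mulVec, ← neg_mul, neg_zero]
    exact ⟨(mem_icosahedronModel (neg_mem_signs hs) (neg_mem_signs ht)).1,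
      (mem_icosahedronModel hs (neg_mem_signs ht)).2.1, (mem_icosahedronModel (neg_mem_signs hs) ht).2.2⟩
  have m1 : halfTurn₁ ∈ icosahedron.rotations.comap cover := by
    refine isModel_icosahedron.mem_comap (forall_mem_icosahedronModel.2 fun s hs t ht => ?_)
    simp only [halfTurn₁_mulVec, ← neg_mul, neg_zero]
    exact ⟨(mem_icosahedronModel hs (neg_mem_signs ht)).1,
      (mem_icosahedronModel (neg_mem_signs hs) ht).2.1,
      (mem_icosahedronModel (neg_mem_signs hs) (neg_mem_signs ht)).2.2⟩
  have mc : cyclicTurn ∈ icosahedron.rotations.comap cover := by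
    refine isModel_icosahedron.mem_comap (forall_mem_icosahedronModel.2 fun s hs t ht => ?_)
    simp only [cyclicTurn_mulVec]
    exact ⟨(mem_icosahedronModel hs ht).2.2, (mem_icosahedronModel hs ht).1,
      (mem_icosahedronModel hs ht).2.1⟩
  refine forall_mem_icosahedronModel.2 fun s hs t ht => ?_
  have b0 : Moves (icosahedron.rotations.comap cover) ![0, s, t * goldenRatio]
      ![0, 1, goldenRatio] := by
    rcases hs with rfl | rfl <;> rcases ht with rfl | rfl
    · rw [one_mul]
      exact Moves.refl _
    · exact moves_of_eq m1 (by rw [halfTurn₁_mulVec]; simp)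
    · exact moves_of_eq (mul_mem m0 m1) (by
        rw [← cover_mulVec_mulVec, halfTurn₁_mulVec, halfTurn₀_mulVec]; simp)
    · exact moves_of_eq m0 (by rw [halfTurn₀_mulVec]; simp)
  have b1 := (moves_of_eq mc (cyclicTurn_mulVec s (t * goldenRatio) 0)).trans b0
  exact ⟨b0, b1, (moves_of_eq mc (cyclicTurn_mulVec (t * goldenRatio) 0 s)).trans b1⟩

theorem hasStar_icosahedron :
    icosahedron.HasStar icosahedronModel ![0, 1, goldenRatio] ![0, -1, goldenRatio] fifthTurn 5 := by
  have hφ := Real.goldenRatio_sq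
  have hφ1 := Real.one_lt_goldenRatio
  have h1 : (1 : ℝ) ∈ ({1, -1} : Set ℝ) := Or.inl rfl
  have h2 : (-1 : ℝ) ∈ ({1, -1} : Set ℝ) := Or.inr rfl
  have p0 := cover_pow_zero_mulVec fifthTurn ![0, -1, goldenRatio]
  have p1 : (cover (fifthTurn ^ 1)).1 *ᵥ ![0, -1, goldenRatio] = ![goldenRatio, 0, 1] := by
    rw [cover_pow_succ_mulVec, p0]
    exact fifthTurn_mulVec_eq (by grind) (by grind) (by grind)
  have p2 : (cover (fifthTurn ^ 2)).1 *ᵥ ![0, -1, goldenRatio] = ![1, goldenRatio, 0] := by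
    rw [cover_pow_succ_mulVec, p1]
    exact fifthTurn_mulVec_eq (by grind) (by grind) (by grind)
  have p3 : (cover (fifthTurn ^ 3)).1 *ᵥ ![0, -1, goldenRatio] = ![-1, goldenRatio, 0] := by
    rw [cover_pow_succ_mulVec, p2]
    exact fifthTurn_mulVec_eq (by grind) (by grind) (by grind)
  have p4 : (cover (fifthTurn ^ 4)).1 *ᵥ ![0, -1, goldenRatio] = ![-goldenRatio, 0, 1] := by
    rw [cover_pow_succ_mulVec, p3]
    exact fifthTurn_mulVec_eq (by grind) (by grind) (by grind)
  have p5 : (cover (fifthTurn ^ 5)).1 *ᵥ ![0, -1, goldenRatio] = ![0, -1, goldenRatio] := by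
    rw [cover_pow_succ_mulVec, p4]
    exact fifthTurn_mulVec_eq (by grind) (by grind) (by grind)
  refine ⟨?_, ?_, fun e => ?_, fifthTurn_mem, ?_, moves_icosahedron, by norm_num, p5, ?_, ?_⟩
  · simpa using (mem_icosahedronModel h1 h1).1
  · simpa using (mem_icosahedronModel h2 h1).1
  · have := congrFun e 1
    norm_num at this
  · exact fifthTurn_mulVec_eq (by grind) (by grind) (by grind)
  · refine forall_mem_icosahedronModel.2 fun s hs t ht => ?_
    -- The product of adjacent vertices is `φ² - 1 = φ`.
    have aux : ∀ {a b c : ℝ}, ((![0, 1, goldenRatio] : Fin 3 → ℝ) ⬝ᵥ ![0, -1, goldenRatio] ≤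
        ![0, 1, goldenRatio] ⬝ᵥ ![a, b, c]) → goldenRatio ≤ b + goldenRatio * c := by
      intro a b c h
      simp [dotProduct, Fin.sum_univ_three] at h
      nlinarith
    rcases hs with rfl | rfl <;> rcases ht with rfl | rfl
    · simp only [one_mul]
      exact ⟨fun h => absurd rfl h, fun _ _ => ⟨2, by norm_num, p2.symm⟩,
        fun _ _ => ⟨1, by norm_num, p1.symm⟩⟩
    · simp only [neg_one_mul]
      exact ⟨fun _ h => by nlinarith [aux h], fun _ h => by nlinarith [aux h],
        fun _ _ => ⟨4, by norm_num, p4.symm⟩⟩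
    · simp only [one_mul]
      exact ⟨fun _ _ => ⟨0, by norm_num, p0.symm⟩, fun _ _ => ⟨3, by norm_num, p3.symm⟩,
        fun _ h => by nlinarith [aux h]⟩
    · simp only [neg_one_mul]
      exact ⟨fun _ h => by nlinarith [aux h], fun _ h => by nlinarith [aux h],
        fun _ h => by nlinarith [aux h]⟩
  · intro i hi hne hle
    interval_cases i
    · exact absurd p0.symm hne
    · exact Or.inl rfl
    -- For `i = 2` and `i = 3` the product with `n` is `-φ`, too small for an edge.
    · rw [p2] at hle
      simp [dotProduct, Fin.sum_univ_three] at hle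
      nlinarith
    · rw [p3] at hle
      simp [dotProduct, Fin.sum_univ_three] at hle
      nlinarith
    · exact Or.inr rfl

theorem span_icosahedron (i : Fin 3) : ∃ u ∈ icosahedronModel, ∃ w ∈ icosahedronModel,
    ∃ c : ℝ, c ≠ 0 ∧ u + w = c • Pi.single i 1 := by
  have h1 : (1 : ℝ) ∈ ({1, -1} : Set ℝ) := Or.inl rfl
  have h2 : (-1 : ℝ) ∈ ({1, -1} : Set ℝ) := Or.inr rfl
  have hc : 2 * goldenRatio ≠ 0 := by have := Real.goldenRatio_pos; positivity
  have pp := mem_icosahedronModel h1 h1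
  have mp := mem_icosahedronModel h2 h1
  fin_cases i
  · refine ⟨_, pp.2.2, _, mp.2.2, _, hc, ?_⟩
    funext j
    fin_cases j <;> simp <;> ring
  · refine ⟨_, pp.2.1, _, mp.2.1, _, hc, ?_⟩
    funext j
    fin_cases j <;> simp <;> ring
  · refine ⟨_, pp.1, _, mp.1, _, hc, ?_⟩
    funext j
    fin_cases j <;> simp <;> ring

end Icosahedron

theorem morsePair_polyhedral (Q : Polyhedron) {f : (Fin 3 → ℝ) → ℝ} (hf : ContDiff ℝ ∞ f)
    (ha : IsAdapted f Q.vertices Q.edges Q.faces) : MorsePair (Q.rotations.comap cover) f := by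
  cases Q with
  | tetrahedron =>
    exact morsePair_of_hasStar isModel_tetrahedron hasStar_tetrahedron span_tetrahedron hf ha
  | octahedron => exact morsePair_of_hasStar isModel_octahedron hasStar_octahedron span_octahedron hf ha
  | icosahedron =>
    exact morsePair_of_hasStar isModel_icosahedron hasStar_icosahedron span_icosahedron hf ha

end Polyhedron

/-! ### Assembly of the three types of groups -/

theorem GroupType.IsMorseFunction.morsePair {τ : GroupType} {f : (Fin 3 → ℝ) → ℝ}
    (h : τ.IsMorseFunction f) : MorsePair τ.standardGroup f := by
  obtain ⟨hf, -, h⟩ := h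
  cases τ with
  | cyclic n hn => exact morsePair_cyclic hn hf h
  | dihedral n hn => exact morsePair_dihedral hn hf h
  | polyhedral Q => exact Q.morsePair_polyhedral hf h

end LinkOrbits

end

theorem proposition4p3 (τ : LinkOrbits.GroupType) (A : LinkOrbits.SU2)
    (G : Subgroup LinkOrbits.SU2)
    (hG : G = τ.standardGroup.map (MulAut.conj A).toMonoidHom)
    (f : (Fin 3 → ℝ) → ℝ)
    (hf : τ.IsMorseFunction fun x => f ((LinkOrbits.cover A).1.mulVec x)) :
    ∃ δ : ℕ → ℝ, (∀ N, 0 < δ N) ∧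
      ∀ ε : ℕ → ℝ, (∀ N, 0 < ε N ∧ ε N ≤ δ N) →
        (∀ N, (∀ x : LinkOrbits.S2, 0 < 1 + ε N * f x.1) ∧
          ∀ γ : LinkOrbits.ReebOrbit G f (ε N), γ.action < τ.threshold N → γ.Nondegenerate) ∧
        ∀ (N M : ℕ) (γ : LinkOrbits.ReebOrbit G f (ε N)) (γ' : LinkOrbits.ReebOrbit G f (ε M)),
          γ.action < τ.threshold N → γ'.action < τ.threshold M →
          γ.loop.Homotopic γ'.loop →
            (γ.czIndex = γ'.czIndex → LinkOrbits.Equivalent γ γ') ∧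
            (γ.czIndex < γ'.czIndex → γ.action < γ'.action) := by
  subst hG
  exact (hf.morsePair.conj A).admissible.exists_thresholds τ.threshold
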